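/- Let $G_D$ be a finite connected simple bipartite graph embedded in the plane, with black vertices $b_1,\dots,b_n$, white vertices $w_1,\dots,w_n$ and positive edge weights $\nu$, which has a perfect matching and in which every edge belongs to some perfect matching. Let $K$ be a Kasteleyn matrix of $(G_D,\nu)$: a real $n\times n$ matrix, rows indexed by black and columns by white vertices, with $|K_{bw}|=\nu(bw)$ if $bw$ is an edge and $K_{bw}=0$ otherwise, such that around each interior face of degree $d$ the product of the signs of $K$ is $(-1)^{d/2+1}$. Assume that $K$ is $1$-non-degenerate and $2$-non-degenerate, i.e. all $(n-1)\times(n-1)$ and all $(n-2)\times(n-2)$ minors of $K$ are non-zero. Let $b_0$ be a black vertex on the boundary of the outer face, let $2m$ be the degree of the outer face, and let $w_1,\dots,w_m$ be (after relabelling) the white vertices met in counterclockwise order along the outer boundary, starting from $b_0$. Then for every generic strictly convex $(m+1)$-gon $Q$, $m+1\ge 3$, with vertices $p_0,\dots,p_m\in\mathbb C$ in (clockwise or counterclockwise) cyclic order and edge vectors $q_k=p_k-p_{k-1}$, $1\le k\le m$ (generic: some non-zero real polynomial in the coordinates of the vertices, depending only on $G_D$, $b_0$ and $K$, does not vanish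 at $Q$), the following holds. (a) There is a unique complex matrix $\tilde K$, obtained from $K$ by multiplying rows and columns by non-zero constants, whose vector of row sums is a non-zero multiple of the indicator function of $b_0$ and whose column sum is $q_k$ at $w_k$ for $1\le k\le m$ and $0$ at every other white vertex. (b) Let $G_D'$ be the graph dual to $G_D$, where the outer face has been divided into $m+1$ outer faces $F_0,\dots,F_m$ by lines to infinity from $b_0,w_1,\dots,w_m$ ($F_0$ lies between the lines of $b_0$ and $w_1$, $F_k$ between those of $w_k$ and $w_{k+1}$, and $F_m$ between those of $w_m$ and $b_0$). There is a unique function $\psi$ on the vertices of $G_D'$ with $\psi(F_0)=p_0$ and such that for each edge $bw$ of $G_D$, $\psi(\text{face to the left of } bw)-\psi(\text{face to the right of } bw)=\tilde K_{bw}$, where $bw$ is directed from $b$ to $w$. (c) Extend $\psi$ linearly to the edges of $G_D'$. For each $i$ the $\psi$-image of the union of the edges of $G_D'$ dual to the edges of $G_D$ at $b_i$ is a non-degenerate closed line segment; let $L_i$ be its relative interior. The $L_1,\dots,L_n$ form a T-graph whose set of root vertices is the set $\{p_0,\dots,p_m\}$ of vertices of $Q$; that is, the $L_i$ are pairwise disjoint,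 their union $U$ is connected, $\overline U\setminus U=\{p_0,\dots,p_m\}$, and these points lie on the boundary of the infinite component of $\mathbb C\setminus\overline U$. (d) $G_D=G_D(L)$ up to gauge equivalence: there are simple closed curves $C$ with convex interior that encircle $U$ and pass through all $p_k$, and for every such $C$ the following holds. Let the faces be the bounded connected components of $\mathbb C\setminus(U\cup C)$. There are an outer face (a face adjacent to $C$), called the dual root, and a bijection $w\mapsto F_w$ from the white vertices to all the other faces, such that $F_w$ contains the interior of the convex hull of the $\psi$-images of the vertices of $G_D'$ around $w$, such that $b_iw$ is an edge of $G_D$ if and only if the portion of $L_i$ in the boundary of $F_w$ has positive length $\ell(b_iw)$, and such that the weights $\ell$ and $\nu$ are gauge equivalent, i.e. $\ell(bw)/\nu(bw)=f_1(w)f_2(b)$ on all edges, with positive functions $f_1,f_2$. (e) For every vertex $v$ of $G_D'$, $\psi(v)$ is a vertex of the T-graph (an endpoint of some $L_i$), and $\psi(F_k)=p_k$ is a root vertex for every outer face $F_k$, $0\le k\le m$. -/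

import Mathlib

open MeasureTheory

noncomputable section

/-! ### Plane bipartite graphs -/

/-- A simple bipartite graph with black vertices `b_1, ..., b_n` and white vertices
`w_1, ..., w_n`, given by the set of its edges (pairs (black end, white end)), together with a
rotation system: `rotB e` is the next edge after `e`, counterclockwise, around the black end
of `e`, and `rotW e` is the next edge after `e`, counterclockwise, around the white end. -/
structure BipartiteMap (n : ℕ) where
  edges : Finset (Fin n × Fin n)
  rotB : Equiv.Perm edges
  rotW : Equiv.Perm edges
  rotB_sameCycle : ∀ e e' : edges, rotB.SameCycle e e' ↔ e.1.1 = e'.1.1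
  rotW_sameCycle : ∀ e e' : edges, rotW.SameCycle e e' ↔ e.1.2 = e'.1.2

namespace BipartiteMap

variable {n : ℕ} (G : BipartiteMap n)

/-- The underlying graph; `Sum.inl b` is the black vertex `b`, `Sum.inr w` the white vertex `w`. -/
def graph : SimpleGraph (Fin n ⊕ Fin n) :=
  SimpleGraph.fromRel fun u v => ∃ e ∈ G.edges, u = Sum.inl e.1 ∧ v = Sum.inr e.2

/-- Direct every edge from its black to its white end. The edges that have a given face on their
left form one cycle of this permutation. A face of degree `2 * l` gives a cycle of length `l`; its
boundary consists of the edges `e` (with the face on the left of `e`) and the edges `rotB e` (with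
the face on the right of `rotB e`), where `e` runs through the cycle. -/
def facePerm : Equiv.Perm G.edges := G.rotW * G.rotB

/-- The faces of the map. -/
def Face : Type := Quotient (Equiv.Perm.SameCycle.setoid G.facePerm)

/-- The face on the left of the edge `e`, directed from its black to its white end. -/
def leftFace (e : G.edges) : G.Face :=
  Quotient.mk (Equiv.Perm.SameCycle.setoid G.facePerm) e

/-- Half the degree of the face on the left of `e`. -/
def halfDegree (e : G.edges) : ℕ := Function.minimalPeriod G.facePerm e

end BipartiteMap

/-- A finite connected plane bipartite graph with `n` black and `n` white vertices: a connected
bipartite map that satisfies the Euler formula of the sphere. (Which face is the outer one is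
specified separately.) -/
structure PlaneBipartiteGraph (n : ℕ) extends BipartiteMap n where
  connected : toBipartiteMap.graph.Connected
  euler : 2 * n + Nat.card toBipartiteMap.Face = edges.card + 2

/-! ### Kasteleyn matrices, degeneracy, gauge equivalence -/

namespace BipartiteMap

variable {n : ℕ} (G : BipartiteMap n)

/-- `K` is a Kasteleyn matrix of `G` with edge weights `ν`, where the outer face is the face on
the left of `e₀`: the product of the signs around each other face is `(-1) ^ (d / 2 + 1)`,
`d` being its degree. -/
structure IsKasteleyn (e₀ : G.edges) (ν : G.edges → ℝ) (K : Matrix (Fin n) (Fin n) ℝ) : Prop where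
  abs_eq : ∀ e : G.edges, |K e.1.1 e.1.2| = ν e
  eq_zero : ∀ b w, (b, w) ∉ G.edges → K b w = 0
  sign_face : ∀ e : G.edges, G.leftFace e ≠ G.leftFace e₀ →
    (∏ i ∈ Finset.range (G.halfDegree e),
      Real.sign (K ((G.facePerm ^ i) e).1.1 ((G.facePerm ^ i) e).1.2) *
        Real.sign (K (G.rotB ((G.facePerm ^ i) e)).1.1 (G.rotB ((G.facePerm ^ i) e)).1.2)) =
      (-1) ^ (G.halfDegree e + 1)

/-- Two weight functions on the edges are gauge equivalent. -/
def GaugeEquivalent (ν₁ ν₂ : G.edges → ℝ) : Prop :=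
  ∃ f₁ f₂ : Fin n → ℝ, (∀ w, 0 < f₁ w) ∧ (∀ b, 0 < f₂ b) ∧
    ∀ e : G.edges, ν₁ e / ν₂ e = f₁ e.1.2 * f₂ e.1.1

end BipartiteMap

/-- All `(n - k) × (n - k)` minors are non-zero. -/
def IsNonDegenerate (k : ℕ) {n : ℕ} (K : Matrix (Fin n) (Fin n) ℝ) : Prop :=
  ∀ r c : Fin (n - k) ↪o Fin n, (K.submatrix r c).det ≠ 0

/-- `p 0, ..., p m` are, in cyclic order (counterclockwise or clockwise), the vertices of a
strictly convex polygon. -/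
def IsConvexPolygon {m : ℕ} (p : Fin (m + 1) → ℂ) : Prop :=
  3 ≤ m + 1 ∧
    ((∀ i j k, i < j → j < k → 0 < (starRingEnd ℂ (p j - p i) * (p k - p i)).im) ∨
      (∀ i j k, i < j → j < k → (starRingEnd ℂ (p j - p i) * (p k - p i)).im < 0))

/-! ### The Kasteleyn flow

Here `e₀` is an edge with the outer face on its left, and `b₀ = e₀.1.1` is its black end. The outer
boundary, walked counterclockwise from `b₀`, meets the white vertices `w_1, ..., w_m`, where `w_k` is
the white end of `(facePerm ^ k) e₀` and `m = halfDegree e₀`. -/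

namespace BipartiteMap

variable {n : ℕ} (G : BipartiteMap n) (e₀ : G.edges)

/-- The row vector that is `q_k = p k - p (k - 1)` at the outer white vertex `w_k`, for
`1 ≤ k ≤ m`, and zero at all other white vertices. -/
def outerFlow (p : Fin (G.halfDegree e₀ + 1) → ℂ) (w : Fin n) : ℂ :=
  ∑ k : Fin (G.halfDegree e₀),
    if ((G.facePerm ^ (k.1 + 1)) e₀).1.2 = w then p k.succ - p k.castSucc else 0

/-- `Kt` arises from `K` by multiplying the rows and the columns by non-zero constants, its row
sums form a non-zero multiple of the indicator function of `b₀`, and its column sums are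
prescribed by the edge vectors of the polygon `p`. -/
structure IsKasteleynFlow (K : Matrix (Fin n) (Fin n) ℝ) (p : Fin (G.halfDegree e₀ + 1) → ℂ)
    (Kt : Matrix (Fin n) (Fin n) ℂ) : Prop where
  gauge : ∃ g f : Fin n → ℂ, (∀ b, g b ≠ 0) ∧ (∀ w, f w ≠ 0) ∧
    ∀ b w, Kt b w = g b * (K b w : ℂ) * f w
  row_sum : ∃ c : ℂ, c ≠ 0 ∧ ∀ b, ∑ w, Kt b w = if b = e₀.1.1 then c else 0
  col_sum : ∀ w, ∑ b, Kt b w = G.outerFlow e₀ p w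

/-- The vertices of the dual graph: the interior faces, and the `m + 1` pieces into which the outer
face is divided by the dotted lines from `b₀, w_1, ..., w_m` to infinity. Piece `k` lies between the
lines from `w_k` and `w_{k+1}`, with `b₀` in the role of `w_0` and `w_{m+1}`. -/
def DualVertex : Type := {F : G.Face // F ≠ G.leftFace e₀} ⊕ Fin (G.halfDegree e₀ + 1)

/-- The `k`-th piece of the outer face (`k ≤ m`). -/
def outerPiece (k : ℕ) : G.DualVertex e₀ := Sum.inr (Fin.ofNat (G.halfDegree e₀ + 1) k)

/-- For an edge `e` with the outer face on its left, the least `k` with `e = (facePerm ^ k) e₀`. -/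
def outerIndex (e : G.edges) : ℕ := sInf {k : ℕ | (G.facePerm ^ k) e₀ = e}

open Classical in
/-- The dual vertex on the left of `e` (directed from black to white). On the outer face, the edge
`(facePerm ^ k) e₀` with `1 ≤ k ≤ m` has the `k`-th piece on its left. -/
def left (e : G.edges) : G.DualVertex e₀ :=
  if h : G.leftFace e = G.leftFace e₀ then
    G.outerPiece e₀ (G.outerIndex e₀ (G.facePerm.symm e) + 1)
  else Sum.inl ⟨G.leftFace e, h⟩

open Classical in
/-- The dual vertex on the right of `e` (directed from black to white). On the outer face, the edge
`rotB ((facePerm ^ k) e₀)` with `0 ≤ k ≤ m - 1` has the `k`-th piece on its right. -/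
def right (e : G.edges) : G.DualVertex e₀ :=
  if h : G.leftFace (G.rotB.symm e) = G.leftFace e₀ then
    G.outerPiece e₀ (G.outerIndex e₀ (G.rotB.symm e))
  else Sum.inl ⟨G.leftFace (G.rotB.symm e), h⟩

/-- `ψ` integrates the flow: the flow `Kt b w` from `b` to `w`, rotated counterclockwise by a right
angle, goes from the dual vertex on the right of the edge to the one on its left, and there it is
the gradient of `ψ`. The additive constant is fixed by sending the first outer piece to `p 0`. -/
structure IsIntegral (p : Fin (G.halfDegree e₀ + 1) → ℂ) (Kt : Matrix (Fin n) (Fin n) ℂ)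
    (ψ : G.DualVertex e₀ → ℂ) : Prop where
  grad : ∀ e : G.edges, ψ (G.left e₀ e) - ψ (G.right e₀ e) = Kt e.1.1 e.1.2
  base : ψ (Sum.inr 0) = p 0

/-- The image under `ψ` (extended linearly to the dual edges) of the union of the dual edges around
the black vertex `b`. -/
def blackImage (ψ : G.DualVertex e₀ → ℂ) (b : Fin n) : Set ℂ :=
  ⋃ e : {e : G.edges // e.1.1 = b}, segment ℝ (ψ (G.right e₀ e.1)) (ψ (G.left e₀ e.1))

/-- The tile of the white vertex `w`: the convex hull of the images of the dual vertices
around `w`. -/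
def whiteTile (ψ : G.DualVertex e₀ → ℂ) (w : Fin n) : Set ℂ :=
  convexHull ℝ (⋃ e : {e : G.edges // e.1.2 = w}, {ψ (G.right e₀ e.1), ψ (G.left e₀ e.1)})

end BipartiteMap

/-! ### T-graphs and their dimer graphs -/

/-- The union of the unbounded connected components of the complement of `S` (for bounded `S` there
is exactly one). -/
def unboundedPart (S : Set ℂ) : Set ℂ :=
  {z | z ∈ Sᶜ ∧ ¬ Bornology.IsBounded (connectedComponentIn Sᶜ z)}

/-- The union of the bounded connected components of the complement of `S`. -/
def boundedPart (S : Set ℂ) : Set ℂ :=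
  {z | z ∈ Sᶜ ∧ Bornology.IsBounded (connectedComponentIn Sᶜ z)}

/-- The open segments `L i` form a T-graph in the plane with set of root vertices `R`: they are
pairwise disjoint, and their union is connected and contains all of its limit points except for
those in `R`, which are finitely many points on the boundary of the infinite component of the
complement of its closure. -/
structure IsTGraph {ι : Type} [Finite ι] (L : ι → Set ℂ) (R : Set ℂ) : Prop where
  isSegment : ∀ i, ∃ x y : ℂ, x ≠ y ∧ L i = openSegment ℝ x y
  disjoint : Pairwise fun i j => Disjoint (L i) (L j)
  connected : IsConnected (⋃ i, L i)
  roots : closure (⋃ i, L i) \ (⋃ i, L i) = R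
  finite : R.Finite
  outer : R ⊆ frontier (unboundedPart (closure (⋃ i, L i)))

/-- `C` is a simple closed curve that encircles the segments `L i` and contains the roots `R`. -/
structure IsEnclosingCurve {ι : Type} (L : ι → Set ℂ) (R C : Set ℂ) : Prop where
  simpleClosed : ∃ γ : Circle → ℂ, Continuous γ ∧ Function.Injective γ ∧ Set.range γ = C
  encircles : (⋃ i, L i) ⊆ boundedPart C
  roots : R ⊆ C

/-- `F` is a face of the T-graph, with respect to the enclosing curve `C`: a bounded connected
component of the complement of the segments and `C`. -/
def IsTFace {ι : Type} (L : ι → Set ℂ) (C F : Set ℂ) : Prop :=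
  Bornology.IsBounded F ∧
    ∃ z ∈ ((⋃ i, L i) ∪ C)ᶜ, F = connectedComponentIn ((⋃ i, L i) ∪ C)ᶜ z

/-- An outer face: one that is adjacent to `C`, i.e. touches it elsewhere than in a root. -/
def IsOuterTFace {ι : Type} (L : ι → Set ℂ) (R C F : Set ℂ) : Prop :=
  IsTFace L C F ∧ (closure F ∩ (C \ R)).Nonempty

/-- The Euclidean length of the portion of the segment `S` in the boundary of the face `F`. -/
def portionLength (S F : Set ℂ) : ℝ :=
  (Measure.hausdorffMeasure 1 (frontier F ∩ S)).toReal

/-- The weighted graph `G` (weights `ν`) is, up to gauge equivalence, the dimer graph of the T-graph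
`L` with roots `R`, built with the enclosing curve `C` and the outer face `Fr` as dual root. The black
vertex `b` corresponds to the segment `L b`, and the white vertex `w` to the face `F w`; the `F w`
are all the faces, each once, except for `Fr`. -/
structure IsDimerGraphUpToGauge {n : ℕ} (G : BipartiteMap n) (ν : G.edges → ℝ)
    (L : Fin n → Set ℂ) (R C : Set ℂ) (F : Fin n → Set ℂ) (Fr : Set ℂ) : Prop where
  dualRoot : IsOuterTFace L R C Fr
  injective : Function.Injective F
  range_eq : Set.range F = {A | IsTFace L C A} \ {Fr}
  adj_iff : ∀ b w, (b, w) ∈ G.edges ↔ 0 < portionLength (L b) (F w)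
  gauge : G.GaugeEquivalent (fun e => portionLength (L e.1.1) (F e.1.2)) ν

end

/-! ### Sign changes in cyclic sequences -/

namespace CyclicSign

open Equiv Finset
open scoped Classical

variable {X ι V : Type*} [DecidableEq ι] {σ : Perm X} {c : X → ι}

/-! The matrix `K` is invertible, and the flow is forced. Its column factors `f` form, up to scale,
the column of `K⁻¹` at `b₀`, so that `K f` is the indicator of `b₀`. The row factors `g` are then
real combinations of the edge vectors of the polygon, with entries of `K⁻¹` as coefficients. By
planarity a flow without sources is the gradient of a function on the faces, which yields `ψ`. The
dual edges around a black vertex `b` all map to one line of direction `g b`, and those around a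
white vertex form, with an outer side if there is one, a closed polygon. It must be shown that these
polygons tile the interior of `Q`, and that each line is folded exactly twice.

Both facts come from one count. Fix real numbers on the edges that sum to zero around every vertex
of one colour. Each vertex of this colour then sees at least two sign changes between consecutive
edges. The Kasteleyn condition is invariant under gauge and forces an odd number of corners without
sign change, here called flat, in every interior face. Euler's formula says that the total number of
corners is exactly the sum of these lower bounds, once the outer boundary is added to the cyclic
orders, so all bounds are attained (`unique_of_card_le`). Without the outer boundary there are too
few corners, hence `K` has no kernel (`det_ne_zero`).

At black vertices the numbers are the signed lengths `K b w * f w` (`blackCount`). Each black vertex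
has one upper and one lower fold, so its image is a segment, and each interior face has exactly one
flat black corner, so its image is interior to a segment. At white vertices the numbers are the
values on the sides of a generic linear functional (`white_count`). Each polygon has only one local
maximum for every such functional, so it is strictly convex (`convexCycle_of_unique_descent`).
Uniqueness of flat white corners makes neighbouring tiles turn the same way, and by connectedness
all turn like `Q` (`Realization.convex`).

Winding numbers give the tiling. Summed over all tiles they leave only the outer polygon, because
the contributions on the line of one black vertex telescope (`eventually_sum_tile`). Thus tiles are
disjoint and cover `Q`. Two segments cannot cross: around a common point, at least three touching
tile germs would have to share the two directions of a generic line (`disjoint_seg`).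

Finally, for a convex enclosing curve, the faces are the tiles, enlarged beyond the sides of `Q`
that they carry, and one region beyond the side from `p m` to `p 0`, along which the segment of `b₀`
lies. The segment of `b` meets the boundary of the face of `w` in length `ν * |f w| * ‖g b‖`, which
is a gauge transform of `ν`. The general position needed is that the `g b` are pairwise non-parallel
and not parallel to the edge vectors `q_k`. The relevant polynomial is non-zero because the entries
and the `2 × 2` minors of `K⁻¹` do not vanish. -/

theorem class_apply (hc : ∀ x y, c x = c y ↔ σ.SameCycle x y) (x : X) : c (σ x) = c x :=
  ((hc x (σ x)).2 ⟨1, by simp⟩).symm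

theorem class_symm_apply (hc : ∀ x y, c x = c y ↔ σ.SameCycle x y) (x : X) :
    c (σ.symm x) = c x := by
  have := class_apply hc (σ.symm x)
  rwa [apply_symm_apply, eq_comm] at this

theorem sum_class_comp {M : Type*} [AddCommMonoid M] [Fintype X]
    (hσ : ∀ x, c (σ x) = c x) (i : ι) (F : X → M) :
    ∑ x with c x = i, F (σ x) = ∑ x with c x = i, F x :=
  Finset.sum_equiv σ (by simp [hσ]) (by simp)

/-- Steps of a function along a permutation sum to zero over each class. -/
theorem sum_class_sub {M : Type*} [AddCommGroup M] [Fintype X]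
    (hσ : ∀ x, c (σ x) = c x) (i : ι) (F : X → M) :
    ∑ x with c x = i, (F (σ x) - F x) = 0 := by
  rw [sum_sub_distrib, sum_class_comp hσ, sub_self]

/-- If all steps but one vanish, so does the remaining one. -/
theorem eq_of_forall_ne_step {M : Type*} [AddCommGroup M] [Fintype X]
    (hσ : ∀ x, c (σ x) = c x) (F : X → M) (x₀ : X)
    (h : ∀ x, c x = c x₀ → x ≠ x₀ → F (σ x) = F x) : F (σ x₀) = F x₀ := by
  have h1 := sum_class_sub hσ (c x₀) F
  rw [Finset.sum_eq_single x₀] at h1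
  · exact sub_eq_zero.1 h1
  · intro x hx hne
    rw [h x (by simpa using hx) hne, sub_self]
  · simp

/-- Discrete intermediate value principle: on the way along the cycle from `x` to `y` the property
must be lost at some step. -/
theorem exists_step [Finite X] (hc : ∀ x y, c x = c y ↔ σ.SameCycle x y) {P : X → Prop}
    {x y : X} (hx : P x) (hy : ¬ P y) (hxy : c x = c y) :
    ∃ z, c z = c x ∧ P z ∧ ¬ P (σ z) := by
  obtain ⟨k, hk⟩ := ((hc x y).1 hxy).exists_nat_pow_eq
  by_contra! H
  have key : ∀ j : ℕ, P ((σ ^ j) x) ∧ c ((σ ^ j) x) = c x := by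
    intro j
    induction j with
    | zero => simpa using hx
    | succ j ih =>
      rw [pow_succ', Perm.mul_apply]
      exact ⟨H _ ih.2 ih.1, by rw [class_apply hc, ih.2]⟩
  exact hy (hk ▸ (key k).1)

theorem eq_of_step_eq {M : Type*} [Finite X] (hc : ∀ x y, c x = c y ↔ σ.SameCycle x y)
    {F : X → M} (hF : ∀ x, F (σ x) = F x) {x y : X} (hxy : c x = c y) : F x = F y := by
  by_contra hne
  obtain ⟨z, -, h1, h2⟩ := exists_step hc (P := fun z => F z = F x) rfl (Ne.symm hne) hxy
  exact h2 ((hF z).trans h1)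

theorem exists_pos_neg {s : Finset X} {r : X → ℝ} (hr : ∀ x ∈ s, r x ≠ 0) (hs : s.Nonempty)
    (h0 : ∑ x ∈ s, r x = 0) : (∃ x ∈ s, 0 < r x) ∧ ∃ x ∈ s, r x < 0 := by
  constructor
  · by_contra! H
    obtain ⟨x, hx⟩ := hs
    have := (sum_eq_zero_iff_of_nonpos H).1 h0 x hx
    exact hr x hx this
  · by_contra! H
    obtain ⟨x, hx⟩ := hs
    have := (sum_eq_zero_iff_of_nonneg H).1 h0 x hx
    exact hr x hx this

variable [Fintype X]

/-- The descents of a sign sequence in a class. -/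
noncomputable def descents (σ : Perm X) (c : X → ι) (r : X → ℝ) (i : ι) : Finset X :=
  {x | c x = i ∧ 0 < r x ∧ r (σ x) < 0}

/-- The ascents of a sign sequence in a class. -/
noncomputable def ascents (σ : Perm X) (c : X → ι) (r : X → ℝ) (i : ι) : Finset X :=
  {x | c x = i ∧ r x < 0 ∧ 0 < r (σ x)}

/-- The corners at `v` without sign change. -/
noncomputable def flats (σ : Perm X) (hd : X → V) (r : X → ℝ) (v : V) : Finset X :=
  {x | hd x = v ∧ 0 < r x * r (σ x)}

theorem one_le_card_descents (hc : ∀ x y, c x = c y ↔ σ.SameCycle x y) {r : X → ℝ}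
    (hr : ∀ x, r x ≠ 0) {i : ι} (hi : ∃ x, c x = i) (h0 : ∑ x with c x = i, r x = 0) :
    1 ≤ #(descents σ c r i) ∧ 1 ≤ #(ascents σ c r i) := by
  obtain ⟨⟨x, hx, hx'⟩, y, hy, hy'⟩ := exists_pos_neg (s := {x | c x = i}) (fun x _ => hr x)
    (by obtain ⟨x, hx⟩ := hi; exact ⟨x, by simpa using hx⟩) h0
  simp only [mem_filter, mem_univ, true_and] at hx hy
  constructor
  · obtain ⟨z, hz, h1, h2⟩ := exists_step hc (P := fun z => 0 < r z) hx' hy'.not_gt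
      (hx.trans hy.symm)
    refine card_pos.2 ⟨z, ?_⟩
    simp only [descents, mem_filter, mem_univ, true_and]
    exact ⟨hz.trans hx, h1, lt_of_le_of_ne (not_lt.1 h2) (hr _)⟩
  · obtain ⟨z, hz, h1, h2⟩ := exists_step hc (P := fun z => r z < 0) hy' hx'.not_gt
      (hy.trans hx.symm)
    refine card_pos.2 ⟨z, ?_⟩
    simp only [ascents, mem_filter, mem_univ, true_and]
    exact ⟨hz.trans hy, h1, lt_of_le_of_ne (not_lt.1 h2) (hr _).symm⟩

/-- Each corner `(x, σ x)` is a descent, an ascent or flat. Sign changes are sorted by vertex and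
flat corners by face, which is what lets Euler's formula enter. -/
theorem card_eq_descents_add [Fintype ι] [Fintype V] {r : X → ℝ} (hr : ∀ x, r x ≠ 0)
    (hd : X → V) :
    Fintype.card X = ∑ i, (#(descents σ c r i) + #(ascents σ c r i)) +
      ∑ v, #(flats σ hd r v) := by
  have e1 : ∑ i, #(descents σ c r i) = #({x | 0 < r x ∧ r (σ x) < 0} : Finset X) := by
    rw [card_eq_sum_card_fiberwise (f := c) (t := univ) (by simp)]
    refine sum_congr rfl fun i _ => congrArg _ ?_
    ext x; simp only [descents, mem_filter, mem_univ, true_and]; tauto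
  have e2 : ∑ i, #(ascents σ c r i) = #({x | r x < 0 ∧ 0 < r (σ x)} : Finset X) := by
    rw [card_eq_sum_card_fiberwise (f := c) (t := univ) (by simp)]
    refine sum_congr rfl fun i _ => congrArg _ ?_
    ext x; simp only [ascents, mem_filter, mem_univ, true_and]; tauto
  have e3 : ∑ v, #(flats σ hd r v) = #({x | 0 < r x * r (σ x)} : Finset X) := by
    rw [card_eq_sum_card_fiberwise (f := hd) (t := univ) (by simp)]
    refine sum_congr rfl fun i _ => congrArg _ ?_
    ext x; simp only [flats, mem_filter, mem_univ, true_and]; tauto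
  rw [sum_add_distrib, e1, e2, e3, ← card_union_of_disjoint, ← card_union_of_disjoint,
    ← card_univ]
  · congr 1
    ext x
    simp only [mem_univ, mem_union, mem_filter, true_and, true_iff]
    rcases lt_or_gt_of_ne (hr x) with h | h <;> rcases lt_or_gt_of_ne (hr (σ x)) with h' | h'
    · exact .inr (mul_pos_of_neg_of_neg h h')
    · exact .inl (.inr ⟨h, h'⟩)
    · exact .inl (.inl ⟨h, h'⟩)
    · exact .inr (mul_pos h h')
  · rw [disjoint_left]
    intro x hx hx'
    simp only [mem_union, mem_filter, mem_univ, true_and] at hx hx'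
    rcases hx with ⟨h, h'⟩ | ⟨h, h'⟩ <;> nlinarith
  · rw [disjoint_left]
    intro x hx hx'
    simp only [mem_filter, mem_univ, true_and] at hx hx'
    linarith

theorem two_mul_card_add_flats_le [Fintype ι] [Fintype V]
    (hc : ∀ x y, c x = c y ↔ σ.SameCycle x y) (hsurj : ∀ i, ∃ x, c x = i) {r : X → ℝ}
    (hr : ∀ x, r x ≠ 0) (h0 : ∀ i, ∑ x with c x = i, r x = 0) (hd : X → V) :
    2 * Fintype.card ι + ∑ v, #(flats σ hd r v) ≤ Fintype.card X := by
  rw [card_eq_descents_add (σ := σ) (c := c) hr hd]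
  have : ∑ _i : ι, 2 ≤ ∑ i, (#(descents σ c r i) + #(ascents σ c r i)) :=
    sum_le_sum fun i _ => by
      have := one_le_card_descents hc hr (hsurj i) (h0 i)
      omega
  simp only [sum_const, card_univ, smul_eq_mul] at this
  omega

/-- When the number of corners is as small as the lower bounds allow, every class has one descent
and one ascent, and the numbers of flat corners agree with their lower bounds. -/
theorem unique_of_card_le [Fintype ι] [Fintype V]
    (hc : ∀ x y, c x = c y ↔ σ.SameCycle x y) (hsurj : ∀ i, ∃ x, c x = i) {r : X → ℝ}
    (hr : ∀ x, r x ≠ 0) (h0 : ∀ i, ∑ x with c x = i, r x = 0) (hd : X → V) (low : V → ℕ)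
    (hlow : ∀ v, low v ≤ #(flats σ hd r v))
    (hcard : Fintype.card X ≤ 2 * Fintype.card ι + ∑ v, low v) :
    (∀ x y, c x = c y → 0 < r x → r (σ x) < 0 → 0 < r y → r (σ y) < 0 → x = y) ∧
    (∀ x y, c x = c y → r x < 0 → 0 < r (σ x) → r y < 0 → 0 < r (σ y) → x = y) ∧
    ∀ v, #(flats σ hd r v) = low v := by
  have key := card_eq_descents_add (σ := σ) (c := c) hr hd
  have h1 : ∀ i ∈ univ, 2 ≤ #(descents σ c r i) + #(ascents σ c r i) := fun i _ => by
      have := one_le_card_descents hc hr (hsurj i) (h0 i)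
      omega
  have h2 := sum_le_sum h1
  have h3 : ∑ v, low v ≤ ∑ v, #(flats σ hd r v) := sum_le_sum fun v _ => hlow v
  have h4 : ∑ _i : ι, 2 = 2 * Fintype.card ι := by simp [mul_comm]
  -- The total equals the sum of the lower bounds, so every single bound is attained.
  have h5 := (sum_eq_sum_iff_of_le h1).1 (by omega)
  have h6 := (sum_eq_sum_iff_of_le fun v (_ : v ∈ univ) => hlow v).1 (by omega)
  refine ⟨fun x y hxy hx hx' hy hy' => ?_, fun x y hxy hx hx' hy hy' => ?_,
    fun v => (h6 v (mem_univ v)).symm⟩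
  · have := one_le_card_descents hc hr (hsurj (c x)) (h0 (c x))
    have := h5 (c x) (mem_univ _)
    exact card_le_one.1 (show #(descents σ c r (c x)) ≤ 1 by omega) x
      (by simp [descents, hx, hx']) y (by simp [descents, hxy, hy, hy'])
  · have := one_le_card_descents hc hr (hsurj (c x)) (h0 (c x))
    have := h5 (c x) (mem_univ _)
    exact card_le_one.1 (show #(ascents σ c r (c x)) ≤ 1 by omega) x
      (by simp [ascents, hx, hx']) y (by simp [ascents, hxy, hy, hy'])

/-- A function with steps `r` attains its maximum over a class at the unique descent. -/
theorem le_of_unique_descent {r κ : X → ℝ} (hσ : ∀ x, c (σ x) = c x) (hr : ∀ x, r x ≠ 0)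
    (hκ : ∀ x, κ (σ x) = κ x + r x)
    (hu : ∀ x y, c x = c y → 0 < r x → r (σ x) < 0 → 0 < r y → r (σ y) < 0 → x = y)
    {x : X} (hx : 0 < r x) (hx' : r (σ x) < 0) {y : X} (hy : c y = c x) : κ y ≤ κ (σ x) := by
  -- The step into a maximiser is positive and the step out of it negative, so its predecessor is
  -- the unique descent.
  obtain ⟨z, hz, hz'⟩ := exists_max_image ({z | c z = c x} : Finset X) κ ⟨x, by simp⟩
  simp only [mem_filter, mem_univ, true_and] at hz hz'
  have hcs : c (σ.symm z) = c x := by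
    rw [← hz]; conv_rhs => rw [← σ.apply_symm_apply z]
    rw [hσ]
  have h1 := hz' (σ z) (by rw [hσ, hz])
  have h2 := hz' (σ.symm z) hcs
  have h3 := hκ (σ.symm z)
  rw [σ.apply_symm_apply] at h3
  rw [hκ] at h1
  have := hu x (σ.symm z) hcs.symm hx hx' (lt_of_le_of_ne (by linarith) (hr _).symm)
    (by rw [σ.apply_symm_apply]; exact lt_of_le_of_ne (by linarith) (hr _))
  rw [this, σ.apply_symm_apply]
  exact hz' y hy

theorem ge_of_unique_ascent {r κ : X → ℝ} (hσ : ∀ x, c (σ x) = c x) (hr : ∀ x, r x ≠ 0)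
    (hκ : ∀ x, κ (σ x) = κ x + r x)
    (hu : ∀ x y, c x = c y → r x < 0 → 0 < r (σ x) → r y < 0 → 0 < r (σ y) → x = y)
    {x : X} (hx : r x < 0) (hx' : 0 < r (σ x)) {y : X} (hy : c y = c x) : κ (σ x) ≤ κ y := by
  have := le_of_unique_descent (r := fun x => - r x) (κ := fun x => - κ x) hσ
    (fun x => neg_ne_zero.2 (hr x)) (fun x => by rw [hκ]; ring)
    (fun x y h => by simpa using hu x y h) (x := x) (by simpa) (by simpa) hy
  linarith

/-- Strict version: the maximum is attained nowhere else. -/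
theorem lt_of_unique_descent {r κ : X → ℝ} (hσ : ∀ x, c (σ x) = c x) (hr : ∀ x, r x ≠ 0)
    (hκ : ∀ x, κ (σ x) = κ x + r x)
    (hu : ∀ x y, c x = c y → 0 < r x → r (σ x) < 0 → 0 < r y → r (σ y) < 0 → x = y)
    {x : X} (hx : 0 < r x) (hx' : r (σ x) < 0) {y : X} (hy : c y = c x) (hne : y ≠ σ x) :
    κ y < κ (σ x) := by
  refine lt_of_le_of_ne (le_of_unique_descent hσ hr hκ hu hx hx' hy) fun he => hne ?_
  have hmax := fun z => le_of_unique_descent (y := z) hσ hr hκ hu hx hx'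
  have hcs : c (σ.symm y) = c x := by
    rw [← hy]; conv_rhs => rw [← σ.apply_symm_apply y]
    rw [hσ]
  have h1 := hmax (σ y) (by rw [hσ, hy])
  have h2 := hmax (σ.symm y) hcs
  have h3 := hκ (σ.symm y)
  rw [σ.apply_symm_apply] at h3
  rw [hκ] at h1
  have := hu x (σ.symm y) hcs.symm hx hx' (lt_of_le_of_ne (by linarith) (hr _).symm)
    (by rw [σ.apply_symm_apply]; exact lt_of_le_of_ne (by linarith) (hr _))
  rw [this, σ.apply_symm_apply]

/-- The product of signs is `-1` to the number of negative terms. Comparison with the exponent `#A +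
1` makes the number of positive terms odd. -/
theorem odd_card_of_prod_sign {α : Type*} {A : Finset α} {ρ : α → ℝ} (hρ : ∀ a ∈ A, ρ a ≠ 0)
    (h : ∏ a ∈ A, Real.sign (ρ a) = (-1) ^ (#A + 1)) : Odd #{a ∈ A | 0 < ρ a} := by
  have h1 : ∏ a ∈ A, Real.sign (ρ a) = ∏ a ∈ A, if 0 < ρ a then (1 : ℝ) else -1 :=
    prod_congr rfl fun a ha => by
      split_ifs with h
      · exact Real.sign_of_pos h
      · exact Real.sign_of_neg (lt_of_le_of_ne (not_lt.1 h) (hρ a ha))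
  rw [h1, prod_ite, prod_const_one, one_mul, prod_const] at h
  have h2 := card_filter_add_card_filter_not (s := A) (fun a => 0 < ρ a)
  by_contra hodd
  rw [Nat.not_odd_iff_even] at hodd
  rw [← h2] at h
  have h3 : ((-1 : ℝ)) ^ (#{a ∈ A | 0 < ρ a} + #{a ∈ A | ¬ 0 < ρ a} + 1)
      = - (-1) ^ #{a ∈ A | ¬ 0 < ρ a} := by
    rw [pow_succ, pow_add, hodd.neg_one_pow]; ring
  rw [h3] at h
  have h4 : ((-1 : ℝ)) ^ #{a ∈ A | ¬ 0 < ρ a} ≠ 0 := by simp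
  apply h4; linarith

end CyclicSign


/-! ### Faces as cycles, and the parity of flat corners -/

namespace BipartiteMap

open Equiv Finset CyclicSign
open scoped Classical

variable {n : ℕ} (G : BipartiteMap n)

noncomputable instance : Fintype G.Face := by
  unfold Face; infer_instance

variable {G}

theorem leftFace_eq_iff {a b : G.edges} :
    G.leftFace a = G.leftFace b ↔ G.facePerm.SameCycle a b :=
  Quotient.eq

theorem leftFace_surjective : Function.Surjective G.leftFace := fun F => Quotient.exists_rep F

theorem leftFace_facePerm (a : G.edges) : G.leftFace (G.facePerm a) = G.leftFace a :=
  class_apply (c := G.leftFace) (fun _ _ => leftFace_eq_iff) a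

theorem rotB_fst (a : G.edges) : (G.rotB a).1.1 = a.1.1 :=
  class_apply (c := fun a : G.edges => a.1.1) (fun x y => (G.rotB_sameCycle x y).symm) a

theorem rotW_snd (a : G.edges) : (G.rotW a).1.2 = a.1.2 :=
  class_apply (c := fun a : G.edges => a.1.2) (fun x y => (G.rotW_sameCycle x y).symm) a

theorem facePerm_apply (a : G.edges) : G.facePerm a = G.rotW (G.rotB a) := rfl

theorem facePerm_snd (a : G.edges) : (G.facePerm a).1.2 = (G.rotB a).1.2 := rotW_snd _

theorem halfDegree_pos (e : G.edges) : 0 < G.halfDegree e :=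
  Function.minimalPeriod_pos_of_mem_periodicPts
    (Function.Injective.mem_periodicPts G.facePerm.injective e)

theorem facePerm_pow_halfDegree (e : G.edges) : (G.facePerm ^ G.halfDegree e) e = e := by
  rw [← Perm.iterate_eq_pow]
  exact Function.iterate_minimalPeriod

theorem facePerm_pow_injOn (e : G.edges) {i j : ℕ} (hi : i < G.halfDegree e)
    (hj : j < G.halfDegree e) (h : (G.facePerm ^ i) e = (G.facePerm ^ j) e) : i = j := by
  rw [← Perm.iterate_eq_pow, ← Perm.iterate_eq_pow] at h
  exact Function.iterate_injOn_Iio_minimalPeriod hi hj h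

theorem exists_pow_of_leftFace_eq {e a : G.edges} (h : G.leftFace a = G.leftFace e) :
    ∃ i < G.halfDegree e, (G.facePerm ^ i) e = a := by
  obtain ⟨k, hk⟩ := (leftFace_eq_iff.1 h.symm).exists_nat_pow_eq
  refine ⟨k % G.halfDegree e, Nat.mod_lt _ (halfDegree_pos e), ?_⟩
  rw [← hk, ← Perm.iterate_eq_pow, ← Perm.iterate_eq_pow, halfDegree,
    Function.iterate_mod_minimalPeriod_eq]

theorem leftFace_pow (e : G.edges) (i : ℕ) : G.leftFace ((G.facePerm ^ i) e) = G.leftFace e :=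
  leftFace_eq_iff.2 (Perm.sameCycle_pow_left.2 (Perm.SameCycle.refl _ _))

theorem face_eq_image (e : G.edges) :
    ({a | G.leftFace a = G.leftFace e} : Finset G.edges) =
      (range (G.halfDegree e)).image fun i => (G.facePerm ^ i) e := by
  ext a
  simp only [mem_filter, mem_univ, true_and, mem_image, mem_range]
  constructor
  · exact exists_pow_of_leftFace_eq
  · rintro ⟨i, -, rfl⟩
    exact leftFace_pow e i

theorem prod_face {M : Type*} [CommMonoid M] (e : G.edges) (F : G.edges → M) :
    ∏ i ∈ range (G.halfDegree e), F ((G.facePerm ^ i) e) =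
      ∏ a with G.leftFace a = G.leftFace e, F a := by
  rw [face_eq_image, prod_image]
  intro i hi j hj h
  exact facePerm_pow_injOn e (by simpa using hi) (by simpa using hj) h

theorem card_face (e : G.edges) :
    #({a | G.leftFace a = G.leftFace e} : Finset G.edges) = G.halfDegree e := by
  rw [face_eq_image, card_image_of_injOn, card_range]
  intro i hi j hj h
  exact facePerm_pow_injOn e (by simpa using hi) (by simpa using hj) h

theorem _root_.Real.sign_mul' (x y : ℝ) : Real.sign (x * y) = Real.sign x * Real.sign y := by
  rcases lt_trichotomy x 0 with hx | rfl | hx <;> rcases lt_trichotomy y 0 with hy | rfl | hy <;>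
    simp [Real.sign_of_neg, Real.sign_of_pos, mul_pos_of_neg_of_neg, mul_neg_of_neg_of_pos,
      mul_neg_of_pos_of_neg, *]

theorem _root_.Real.sign_mul_self {x : ℝ} (hx : x ≠ 0) : Real.sign x * Real.sign x = 1 := by
  rcases Real.sign_apply_eq_of_ne_zero x hx with h | h <;> simp [h]

theorem IsKasteleyn.ne_zero {e₀ : G.edges} {ν : G.edges → ℝ} {K : Matrix (Fin n) (Fin n) ℝ}
    (hK : G.IsKasteleyn e₀ ν K) (hν : ∀ e, 0 < ν e) (e : G.edges) : K e.1.1 e.1.2 ≠ 0 := by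
  intro h
  have := hK.abs_eq e
  rw [h, abs_zero] at this
  exact (hν e).ne this

theorem IsKasteleyn.prod_sign {e₀ : G.edges} {ν : G.edges → ℝ} {K : Matrix (Fin n) (Fin n) ℝ}
    (hK : G.IsKasteleyn e₀ ν K) {e : G.edges} (he : G.leftFace e ≠ G.leftFace e₀) :
    ∏ a with G.leftFace a = G.leftFace e, (Real.sign (K a.1.1 a.1.2) *
      Real.sign (K (G.rotB a).1.1 (G.rotB a).1.2)) =
      (-1) ^ (#({a | G.leftFace a = G.leftFace e} : Finset G.edges) + 1) := by
  rw [← prod_face e fun a => Real.sign (K a.1.1 a.1.2) *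
    Real.sign (K (G.rotB a).1.1 (G.rotB a).1.2), hK.sign_face e he, card_face]

theorem prod_face_facePerm {M : Type*} [CommMonoid M] (F : G.Face) (f : G.edges → M) :
    ∏ a with G.leftFace a = F, f (G.facePerm a) = ∏ a with G.leftFace a = F, f a :=
  Finset.prod_equiv G.facePerm (by simp [leftFace_facePerm]) (by simp)

/-- In a gauge transform of a Kasteleyn matrix, the number of black corners of an interior face
without sign change is odd. -/
theorem IsKasteleyn.odd_black {e₀ : G.edges} {ν : G.edges → ℝ} {K : Matrix (Fin n) (Fin n) ℝ}
    (hK : G.IsKasteleyn e₀ ν K) (hν : ∀ e, 0 < ν e) {α β : Fin n → ℝ} (hα : ∀ b, α b ≠ 0)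
    (hβ : ∀ w, β w ≠ 0) {ρ : G.edges → ℝ} (hρ : ∀ e, ρ e = α e.1.1 * (K e.1.1 e.1.2 * β e.1.2))
    {F : G.Face} (hF : F ≠ G.leftFace e₀) :
    Odd #({a | G.leftFace a = F ∧ 0 < ρ a * ρ (G.rotB a)} : Finset G.edges) := by
  obtain ⟨e, rfl⟩ := leftFace_surjective F
  rw [← filter_filter]
  have hne : ∀ a, ρ a ≠ 0 := fun a => by
    rw [hρ]; exact mul_ne_zero (hα _) (mul_ne_zero (hK.ne_zero hν a) (hβ _))
  refine odd_card_of_prod_sign (fun a _ => mul_ne_zero (hne _) (hne _)) ?_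
  rw [← hK.prod_sign hF]
  -- The row factor occurs twice at a black corner and cancels. The column factors of consecutive
  -- white vertices cancel only in the product around the face.
  have h1 : ∀ a : G.edges, Real.sign (ρ a * ρ (G.rotB a)) =
      (Real.sign (K a.1.1 a.1.2) * Real.sign (K (G.rotB a).1.1 (G.rotB a).1.2)) *
        (Real.sign (β a.1.2) * Real.sign (β (G.facePerm a).1.2)) := fun a => by
    rw [hρ, hρ, rotB_fst, facePerm_snd]
    simp only [Real.sign_mul']
    linear_combination (Real.sign (K a.1.1 a.1.2) * Real.sign (K a.1.1 (G.rotB a).1.2) *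
        (Real.sign (β a.1.2) * Real.sign (β (G.rotB a).1.2))) * Real.sign_mul_self (hα a.1.1)
  rw [prod_congr rfl fun a _ => h1 a, prod_mul_distrib, prod_mul_distrib (s := filter _ _)
    (f := fun a : G.edges => Real.sign (β a.1.2)),
    prod_face_facePerm (G.leftFace e) fun a : G.edges => Real.sign (β a.1.2),
    ← prod_mul_distrib, prod_congr rfl fun (a : G.edges) _ => Real.sign_mul_self (hβ a.1.2)]
  simp

/-- In a gauge transform of a Kasteleyn matrix, the number of white corners of an interior face
without sign change is odd. -/
theorem IsKasteleyn.odd_white {e₀ : G.edges} {ν : G.edges → ℝ} {K : Matrix (Fin n) (Fin n) ℝ}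
    (hK : G.IsKasteleyn e₀ ν K) (hν : ∀ e, 0 < ν e) {α β : Fin n → ℝ} (hα : ∀ b, α b ≠ 0)
    (hβ : ∀ w, β w ≠ 0) {ρ : G.edges → ℝ} (hρ : ∀ e, ρ e = α e.1.1 * (K e.1.1 e.1.2 * β e.1.2))
    {F : G.Face} (hF : F ≠ G.leftFace e₀) :
    Odd #({a | G.leftFace a = F ∧ 0 < ρ (G.rotB a) * ρ (G.facePerm a)} : Finset G.edges) := by
  obtain ⟨e, rfl⟩ := leftFace_surjective F
  rw [← filter_filter]
  have hne : ∀ a, ρ a ≠ 0 := fun a => by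
    rw [hρ]; exact mul_ne_zero (hα _) (mul_ne_zero (hK.ne_zero hν a) (hβ _))
  refine odd_card_of_prod_sign (fun a _ => mul_ne_zero (hne _) (hne _)) ?_
  rw [← hK.prod_sign hF]
  -- Here the column factor cancels at the corner. Shifting the last two factors by `facePerm` pairs
  -- each edge `a` with `rotB a` again and cancels the row factors.
  have h1 : ∀ a : G.edges, Real.sign (ρ (G.rotB a) * ρ (G.facePerm a)) =
      Real.sign (K (G.rotB a).1.1 (G.rotB a).1.2) * Real.sign (α a.1.1) *
        (Real.sign (K (G.facePerm a).1.1 (G.facePerm a).1.2) *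
          Real.sign (α (G.facePerm a).1.1)) := fun a => by
    rw [hρ, hρ, rotB_fst, facePerm_snd]
    simp only [Real.sign_mul']
    linear_combination (Real.sign (K a.1.1 (G.rotB a).1.2) * Real.sign (α a.1.1) *
        (Real.sign (K (G.facePerm a).1.1 (G.rotB a).1.2) *
          Real.sign (α (G.facePerm a).1.1))) * Real.sign_mul_self (hβ (G.rotB a).1.2)
  rw [prod_congr rfl fun a _ => h1 a, prod_mul_distrib,
    prod_face_facePerm (G.leftFace e) fun a : G.edges => Real.sign (K a.1.1 a.1.2) *
      Real.sign (α a.1.1), ← prod_mul_distrib]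
  refine prod_congr rfl fun a _ => ?_
  linear_combination (Real.sign (K (G.rotB a).1.1 (G.rotB a).1.2) * Real.sign (K a.1.1 a.1.2)) *
    Real.sign_mul_self (hα a.1.1)

end BipartiteMap

/-! ### Euler's formula and connectedness -/

namespace PlaneBipartiteGraph

open Equiv Finset BipartiteMap
open scoped Classical

variable {n : ℕ} (G : PlaneBipartiteGraph n)

theorem card_edges : Fintype.card G.edges + 2 = 2 * n + Fintype.card G.Face := by
  have := G.euler
  rw [Nat.card_eq_fintype_card] at this
  rw [Fintype.card_coe]
  omega

/-- The form in which connectedness is used: values and truth values are carried along edges. -/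
theorem const_of_edges {M : Type*} {F : Fin n ⊕ Fin n → M}
    (h : ∀ e : G.edges, F (Sum.inl e.1.1) = F (Sum.inr e.1.2)) (u v : Fin n ⊕ Fin n) :
    F u = F v := by
  obtain ⟨p⟩ := G.connected.preconnected u v
  induction p with
  | nil => rfl
  | cons hadj _ ih =>
    refine Eq.trans ?_ ih
    rw [BipartiteMap.graph, SimpleGraph.fromRel_adj] at hadj
    rcases hadj.2 with ⟨e, he, rfl, rfl⟩ | ⟨e, he, rfl, rfl⟩
    · exact h ⟨e, he⟩
    · exact (h ⟨e, he⟩).symm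

/-- Otherwise the property of being `b` would agree at the ends of all edges, although it
distinguishes two vertices. -/
theorem exists_edge_fst (b : Fin n) : ∃ e : G.edges, e.1.1 = b := by
  by_contra! H
  have := G.const_of_edges (F := fun u => u = Sum.inl b) (fun e => by
    simpa using H e) (Sum.inl b) (Sum.inr b)
  simp at this

theorem exists_edge_snd (w : Fin n) : ∃ e : G.edges, e.1.2 = w := by
  by_contra! H
  have := G.const_of_edges (F := fun u => u = Sum.inr w) (fun e => by
    simpa using H e) (Sum.inl w) (Sum.inr w)
  simp at this

end PlaneBipartiteGraph


/-! ### Non-vanishing minors and a strict Hall condition -/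

namespace IsNonDegenerate

open Finset Matrix
open scoped Classical

variable {k n : ℕ} {K : Matrix (Fin n) (Fin n) ℝ}

/-- The columns outside `S` do not contribute, so the rows in `R` give a square homogeneous system
whose determinant is one of the minors. -/
theorem eq_zero_of_mulVec (h : IsNonDegenerate k K) {R S : Finset (Fin n)} (hR : #R = n - k)
    (hS : #S = n - k) {v : Fin n → ℝ} (hv : ∀ w ∉ S, v w = 0)
    (hKv : ∀ b ∈ R, (K *ᵥ v) b = 0) : v = 0 := by
  have key : (fun j => v (S.orderEmbOfFin hS j)) = 0 := by
    refine Matrix.eq_zero_of_mulVec_eq_zero (h (R.orderEmbOfFin hR) (S.orderEmbOfFin hS)) ?_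
    ext i
    rw [Pi.zero_apply, ← hKv _ (R.orderEmbOfFin_mem hR i)]
    simp only [mulVec, dotProduct, submatrix_apply]
    rw [← sum_subset (subset_univ S) (fun w _ hw => by rw [hv w hw, mul_zero])]
    conv_rhs => rw [← S.map_orderEmbOfFin_univ hS]
    rw [sum_map]
    rfl
  ext w
  by_cases hw : w ∈ S
  · have : w ∈ Set.range (S.orderEmbOfFin hS) := by rw [range_orderEmbOfFin]; exact hw
    obtain ⟨j, rfl⟩ := this
    exact congrFun key j
  · exact hv w hw

theorem eq_zero_one (h : IsNonDegenerate 1 K) (b w : Fin n) {v : Fin n → ℝ} (hv : v w = 0)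
    (hKv : ∀ b' ≠ b, (K *ᵥ v) b' = 0) : v = 0 :=
  h.eq_zero_of_mulVec (R := univ.erase b) (S := univ.erase w) (by simp) (by simp)
    (fun w' hw' => by
      have : w' = w := by simpa using hw'
      rw [this, hv])
    fun b' hb' => hKv b' (by simpa using hb')

theorem eq_zero_two (h : IsNonDegenerate 2 K) {b₁ b₂ w₁ w₂ : Fin n} (hb : b₁ ≠ b₂)
    (hw : w₁ ≠ w₂) {v : Fin n → ℝ} (hv₁ : v w₁ = 0) (hv₂ : v w₂ = 0)
    (hKv : ∀ b, b ≠ b₁ → b ≠ b₂ → (K *ᵥ v) b = 0) : v = 0 := by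
  refine h.eq_zero_of_mulVec (R := (univ.erase b₁).erase b₂) (S := (univ.erase w₁).erase w₂)
    (by rw [card_erase_of_mem (by simp [hb.symm])]; simp; omega)
    (by rw [card_erase_of_mem (by simp [hw.symm])]; simp; omega)
    (fun w' hw' => ?_) fun b' hb' => hKv b' (by simp at hb'; tauto) (by simp at hb'; tauto)
  by_cases h2 : w' = w₂
  · rw [h2, hv₂]
  · have : w' = w₁ := by simpa [h2] using hw'
    rw [this, hv₁]

/-- A proper non-empty set of columns has more than its size in neighbouring rows. -/
theorem card_lt_neighbors (h : IsNonDegenerate 1 K) {A B : Finset (Fin n)} (hA : A.Nonempty)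
    (hA' : A ≠ univ) (hAB : ∀ w ∈ A, ∀ b, K b w ≠ 0 → b ∈ B) : #A < #B := by
  by_contra! hle
  -- Dropping one row of `B` leaves fewer equations than unknowns on `A`. A solution extended by
  -- zero vanishes at a column outside `A` and is killed by all rows but `b`. If `B` is empty, any
  -- row may be dropped.
  obtain ⟨b, hb⟩ : ∃ b, #(B.erase b) < #A := by
    rcases B.eq_empty_or_nonempty with rfl | ⟨b, hb⟩
    · obtain ⟨w, hw⟩ := hA
      exact ⟨w, by simpa using card_pos.2 ⟨w, hw⟩⟩
    · refine ⟨b, ?_⟩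
      rw [card_erase_of_mem hb]
      have := card_pos.2 ⟨b, hb⟩
      omega
  obtain ⟨w₀, hw₀⟩ : ∃ w, w ∉ A := by
    by_contra! H
    exact hA' (eq_univ_iff_forall.2 H)
  let L : Matrix (B.erase b) A ℝ := K.submatrix (fun i => i.1) (fun j => j.1)
  have hker : LinearMap.ker L.mulVecLin ≠ ⊥ := by
    refine LinearMap.ker_ne_bot_of_finrank_lt ?_
    simp only [Module.finrank_fintype_fun_eq_card, Fintype.card_coe]
    exact hb
  obtain ⟨x, hx, hx0⟩ := (Submodule.ne_bot_iff _).1 hker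
  rw [LinearMap.mem_ker, mulVecLin_apply] at hx
  let v : Fin n → ℝ := fun w => if h : w ∈ A then x ⟨w, h⟩ else 0
  have hvA : ∀ w ∉ A, v w = 0 := fun w hw => dif_neg hw
  have hv : v = 0 := by
    refine h.eq_zero_one b w₀ (hvA w₀ hw₀) fun b' hb' => ?_
    have hsum : (K *ᵥ v) b' = ∑ w : A, K b' w.1 * x w := by
      simp only [mulVec, dotProduct]
      rw [← sum_subset (subset_univ A) (fun w _ hw => by rw [hvA w hw, mul_zero]), ← sum_coe_sort]
      refine sum_congr rfl fun w _ => ?_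
      simp [v]
    rw [hsum]
    by_cases hB : b' ∈ B
    · exact congrFun hx ⟨b', mem_erase.2 ⟨hb', hB⟩⟩
    · refine sum_eq_zero fun w _ => ?_
      have : K b' w.1 = 0 := by
        by_contra hK
        exact hB (hAB w.1 w.2 b' hK)
      rw [this, zero_mul]
  apply hx0
  ext w
  have := congrFun hv w.1
  simpa [v] using this

end IsNonDegenerate

/-! ### Invertibility, potentials, and faces that meet a white vertex once -/

namespace PlaneBipartiteGraph

open Equiv Finset BipartiteMap CyclicSign Matrix
open scoped Classical

variable {n : ℕ} (G : PlaneBipartiteGraph n)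

theorem sum_fst {M : Type*} [AddCommMonoid M] (b : Fin n) (F : Fin n → Fin n → M)
    (hF : ∀ w, (b, w) ∉ G.edges → F b w = 0) :
    ∑ e : G.edges with e.1.1 = b, F e.1.1 e.1.2 = ∑ w, F b w := by
  rw [← sum_subset (subset_univ ({w | (b, w) ∈ G.edges} : Finset (Fin n)))
    (fun w _ hw => hF w (by simpa using hw))]
  refine sum_bij (fun e _ => e.1.2) (fun e he => ?_) (fun e he e' he' h => ?_) (fun w hw => ?_)
    (fun e he => ?_)
  · simp only [mem_filter, mem_univ, true_and] at he ⊢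
    rw [← he]; exact e.2
  · simp only [mem_filter, mem_univ, true_and] at he he'
    exact Subtype.ext (Prod.ext (he.trans he'.symm) h)
  · exact ⟨⟨(b, w), by simpa using hw⟩, by simp, rfl⟩
  · simp only [mem_filter, mem_univ, true_and] at he
    rw [he]

theorem sum_snd {M : Type*} [AddCommMonoid M] (w : Fin n) (F : Fin n → Fin n → M)
    (hF : ∀ b, (b, w) ∉ G.edges → F b w = 0) :
    ∑ e : G.edges with e.1.2 = w, F e.1.1 e.1.2 = ∑ b, F b w := by
  rw [← sum_subset (subset_univ ({b | (b, w) ∈ G.edges} : Finset (Fin n)))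
    (fun b _ hb => hF b (by simpa using hb))]
  refine sum_bij (fun e _ => e.1.1) (fun e he => ?_) (fun e he e' he' h => ?_) (fun b hb => ?_)
    (fun e he => ?_)
  · simp only [mem_filter, mem_univ, true_and] at he ⊢
    rw [← he]; exact e.2
  · simp only [mem_filter, mem_univ, true_and] at he he'
    exact Subtype.ext (Prod.ext h (he.trans he'.symm))
  · exact ⟨⟨(b, w), by simpa using hb⟩, by simp, rfl⟩
  · simp only [mem_filter, mem_univ, true_and] at he
    rw [he]

variable {G} in
/-- A non-degenerate Kasteleyn matrix is invertible. -/
theorem det_ne_zero {e₀ : G.edges} {ν : G.edges → ℝ} {K : Matrix (Fin n) (Fin n) ℝ}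
    (hK : G.IsKasteleyn e₀ ν K) (hν : ∀ e, 0 < ν e) (h1 : IsNonDegenerate 1 K) : K.det ≠ 0 := by
  intro hdet
  obtain ⟨v, hv0, hv⟩ := Matrix.exists_mulVec_eq_zero_iff.2 hdet
  -- Otherwise `v` would be zero by `1`-non-degeneracy.
  have hvw : ∀ w, v w ≠ 0 := fun w hw =>
    hv0 (h1.eq_zero_one e₀.1.1 w hw fun b _ => by rw [hv, Pi.zero_apply])
  let ρ : G.edges → ℝ := fun e => K e.1.1 e.1.2 * v e.1.2
  -- There are `E = 2n + F - 2` black corners, whereas `2n` sign changes and a flat corner in each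
  -- of the `F - 1` interior faces would be required.
  have hle := two_mul_card_add_flats_le (σ := G.rotB) (c := fun e : G.edges => e.1.1) (r := ρ)
    (fun x y => (G.rotB_sameCycle x y).symm) G.exists_edge_fst
    (fun e => mul_ne_zero (hK.ne_zero hν e) (hvw _))
    (fun b => by
      have := G.sum_fst b (fun b w => K b w * v w) fun w hw => by rw [hK.eq_zero b w hw, zero_mul]
      exact this.trans (congrFun hv b))
    G.leftFace
  have hflat : ∀ F ∈ univ.erase (G.leftFace e₀), 1 ≤ #(flats G.rotB G.leftFace ρ F) :=
    fun F hF => (hK.odd_black hν (α := fun _ => 1) (β := v) (by simp) hvw (ρ := ρ)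
      (fun e => by simp [ρ]) (mem_erase.1 hF).1).pos
  have h2 := (sum_le_sum hflat).trans
    (sum_le_sum_of_subset (f := fun F => #(flats G.rotB G.leftFace ρ F)) (erase_subset _ univ))
  simp only [sum_const, card_erase_of_mem (mem_univ _), card_univ, smul_eq_mul, mul_one] at h2
  have := G.card_edges
  have hpos : 0 < Fintype.card G.Face := Fintype.card_pos_iff.2 ⟨G.leftFace e₀⟩
  rw [Fintype.card_fin] at hle
  omega

/-! ### Closed flows -/

section Flow

variable (𝕜 : Type*) [Field 𝕜]

/-- Row sums and column sums of a flow. -/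
noncomputable def boundary : (G.edges → 𝕜) →ₗ[𝕜] (Fin n ⊕ Fin n → 𝕜) where
  toFun ω := Sum.elim (fun b => ∑ e : G.edges with e.1.1 = b, ω e)
    (fun w => ∑ e : G.edges with e.1.2 = w, ω e)
  map_add' ω ω' := by ext (b | w) <;> simp [sum_add_distrib]
  map_smul' t ω := by ext (b | w) <;> simp [mul_sum]

/-- The differences of a function on the faces across the edges. -/
def gradient : (G.Face → 𝕜) →ₗ[𝕜] (G.edges → 𝕜) where
  toFun η e := η (G.leftFace e) - η (G.leftFace (G.rotB.symm e))
  map_add' η η' := by ext; simp; ring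
  map_smul' t η := by ext; simp; ring

theorem leftFace_rotW (e : G.edges) : G.leftFace (G.rotW e) = G.leftFace (G.rotB.symm e) := by
  rw [← leftFace_facePerm (G.rotB.symm e), facePerm_apply, apply_symm_apply]

theorem boundary_single (e : G.edges) :
    G.boundary 𝕜 (Pi.single e 1) = Pi.single (Sum.inl e.1.1) 1 + Pi.single (Sum.inr e.1.2) 1 := by
  ext (b | w)
  · simp [boundary, Pi.single_apply, eq_comm]
  · simp [boundary, Pi.single_apply, eq_comm]

theorem range_gradient_le : LinearMap.range (G.gradient 𝕜) ≤ LinearMap.ker (G.boundary 𝕜) := by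
  rintro _ ⟨η, rfl⟩
  rw [LinearMap.mem_ker]
  ext (b | w)
  · have := sum_class_sub (σ := G.rotB) (c := fun e : G.edges => e.1.1) rotB_fst b
      (fun e => η (G.leftFace (G.rotB.symm e)))
    simp only [symm_apply_apply] at this
    simpa [boundary, gradient] using this
  · have := sum_class_sub (σ := G.rotW) (c := fun e : G.edges => e.1.2) rotW_snd w
      (fun e => η (G.leftFace e))
    rw [← neg_eq_zero, ← sum_neg_distrib] at this
    simpa [boundary, gradient, leftFace_rotW] using this

/-- The faces around one vertex get a common value, by crossing its edges in turn. The two ends of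
an edge share a face, so connectedness does the rest. -/
theorem face_const_of_gradient {M : Type*} {η : G.Face → M}
    (h : ∀ e, η (G.leftFace (G.rotB e)) = η (G.leftFace e)) (F F' : G.Face) : η F = η F' := by
  have hW : ∀ e, η (G.leftFace (G.rotW e)) = η (G.leftFace e) := fun e => by
    rw [leftFace_rotW, ← h, apply_symm_apply]
  choose eB heB using G.exists_edge_fst
  choose eW heW using G.exists_edge_snd
  have key := G.const_of_edges (F := Sum.elim (fun b => η (G.leftFace (eB b)))
    (fun w => η (G.leftFace (eW w)))) (fun e => by
      have h1 := eq_of_step_eq (σ := G.rotB) (c := fun e : G.edges => e.1.1)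
        (fun x y => (G.rotB_sameCycle x y).symm) (F := fun a => η (G.leftFace a)) h (heB e.1.1)
      have h2 := eq_of_step_eq (σ := G.rotW) (c := fun e : G.edges => e.1.2)
        (fun x y => (G.rotW_sameCycle x y).symm) (F := fun a => η (G.leftFace a)) hW (heW e.1.2)
      exact h1.trans h2.symm)
  obtain ⟨a, rfl⟩ := leftFace_surjective F
  obtain ⟨a', rfl⟩ := leftFace_surjective F'
  have h1 := fun a : G.edges => eq_of_step_eq (σ := G.rotB) (c := fun e : G.edges => e.1.1)
        (fun x y => (G.rotB_sameCycle x y).symm) (F := fun a => η (G.leftFace a)) h (heB a.1.1)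
  have := key (Sum.inl a.1.1) (Sum.inl a'.1.1)
  exact (h1 a).symm.trans (this.trans (h1 a'))

theorem finrank_ker_le_one {V : Type*} [AddCommGroup V] [Module 𝕜 V] {W : Submodule 𝕜 V}
    (f : V →ₗ[𝕜] 𝕜) (hf : ∀ v ∈ W, f v = 0 → v = 0) : Module.finrank 𝕜 W ≤ 1 := by
  have : Function.Injective (f.comp W.subtype) := by
    rw [← LinearMap.ker_eq_bot, LinearMap.ker_eq_bot']
    rintro ⟨v, hv⟩ h
    exact Subtype.ext (hf v hv h)
  simpa using LinearMap.finrank_le_finrank_of_injective this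

/-- On a plane graph, a flow without sources is the gradient of a function on the faces. -/
theorem ker_boundary [CharZero 𝕜] :
    LinearMap.ker (G.boundary 𝕜) = LinearMap.range (G.gradient 𝕜) := by
  symm
  refine Submodule.eq_of_le_of_finrank_le (G.range_gradient_le 𝕜) ?_
  have hn : Nonempty (Fin n ⊕ Fin n) := G.connected.nonempty
  obtain ⟨u₀⟩ := hn
  have hF : Nonempty G.Face := by
    rcases u₀ with b | w
    · exact ⟨G.leftFace (G.exists_edge_fst b).choose⟩
    · exact ⟨G.leftFace (G.exists_edge_snd w).choose⟩
  obtain ⟨F₀⟩ := hF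
  -- Only constants have zero gradient, so the gradients have dimension at least `F - 1`.
  have h1 : Module.finrank 𝕜 (LinearMap.ker (G.gradient 𝕜)) ≤ 1 := by
    refine finrank_ker_le_one 𝕜 (LinearMap.proj F₀) fun η hη h0 => ?_
    ext F
    rw [G.face_const_of_gradient (η := η) (fun e => ?_) F F₀]
    · exact h0
    · have := congrFun (LinearMap.mem_ker.1 hη) (G.rotB e)
      simp only [gradient, LinearMap.coe_mk, AddHom.coe_mk, symm_apply_apply, Pi.zero_apply] at this
      exact sub_eq_zero.1 this
  -- A functional in this kernel takes opposite values at the ends of each edge and is determined by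
  -- one value. Hence `boundary` has rank at least `2n - 1` and its kernel dimension at most `E - 2n
  -- + 1`, which is `F - 1` by Euler's formula.
  have h2 : Module.finrank 𝕜 (LinearMap.ker (G.boundary 𝕜).dualMap) ≤ 1 := by
    refine finrank_ker_le_one 𝕜
      (Module.Dual.eval 𝕜 (Fin n ⊕ Fin n → 𝕜) (Pi.single u₀ 1)) fun φ hφ h0 => ?_
    have hsum : ∀ e : G.edges, φ (Pi.single (Sum.inl e.1.1) 1) =
        - φ (Pi.single (Sum.inr e.1.2) 1) := fun e => by
      have := LinearMap.congr_fun (LinearMap.mem_ker.1 hφ) (Pi.single e 1)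
      rw [LinearMap.dualMap_apply, boundary_single, map_add] at this
      exact eq_neg_of_add_eq_zero_left this
    have hc := G.const_of_edges (F := Sum.elim (fun b => φ (Pi.single (Sum.inl b) 1))
      (fun w => - φ (Pi.single (Sum.inr w) 1))) hsum
    have h0' : φ (Pi.single u₀ 1) = 0 := h0
    refine LinearMap.pi_ext' fun u => LinearMap.ext_ring ?_
    simp only [LinearMap.comp_apply, LinearMap.single_apply, LinearMap.zero_apply]
    have := hc u u₀
    rcases u with b | w <;> rcases u₀ with b' | w' <;> simp_all
  have h3 := LinearMap.finrank_range_add_finrank_ker (G.gradient 𝕜)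
  have h4 := LinearMap.finrank_range_add_finrank_ker (G.boundary 𝕜).dualMap
  have h5 := LinearMap.finrank_range_add_finrank_ker (G.boundary 𝕜)
  rw [LinearMap.finrank_range_dualMap_eq_finrank_range, Subspace.dual_finrank_eq] at h4
  simp only [Module.finrank_fintype_fun_eq_card, Fintype.card_sum, Fintype.card_fin] at h3 h4 h5
  have := G.card_edges
  omega

theorem exists_potential [CharZero 𝕜] {ω : G.edges → 𝕜}
    (hb : ∀ b, ∑ e : G.edges with e.1.1 = b, ω e = 0)
    (hw : ∀ w, ∑ e : G.edges with e.1.2 = w, ω e = 0) :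
    ∃ η : G.Face → 𝕜, ∀ e, ω e = η (G.leftFace e) - η (G.leftFace (G.rotB.symm e)) := by
  have : ω ∈ LinearMap.ker (G.boundary 𝕜) := by
    rw [LinearMap.mem_ker]
    ext (b | w)
    · simpa [boundary] using hb b
    · simpa [boundary] using hw w
  rw [ker_boundary] at this
  obtain ⟨η, rfl⟩ := this
  exact ⟨η, fun e => rfl⟩

end Flow

variable {G} in
/-- A face meets each white vertex at most once. -/
theorem eq_of_leftFace_eq {e₀ : G.edges} {ν : G.edges → ℝ} {K : Matrix (Fin n) (Fin n) ℝ}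
    (hK : G.IsKasteleyn e₀ ν K) (h1 : IsNonDegenerate 1 K)
    {e₁ e₂ : G.edges} (hw : e₁.1.2 = e₂.1.2) (hF : G.leftFace e₁ = G.leftFace e₂) : e₁ = e₂ := by
  by_contra hne
  have hex := ((G.rotW_sameCycle e₁ e₂).2 hw).exists_nat_pow_eq
  let T := Nat.find hex
  have hT : (G.rotW ^ T) e₁ = e₂ := Nat.find_spec hex
  have hT' : ∀ t < T, (G.rotW ^ t) e₁ ≠ e₂ := fun t ht => Nat.find_min hex ht
  have hT0 : 0 < T := by
    rcases Nat.eq_zero_or_pos T with h | h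
    · rw [h] at hT; exact absurd hT hne
    · exact h
  -- The flow through the edges from `e₁` up to, but excluding, `e₂` around their white vertex. On a
  -- gradient it telescopes to a difference of two values at the same face. This is the algebraic
  -- form of a closed curve through that face and the white vertex.
  let Λ : (G.edges → ℝ) →ₗ[ℝ] ℝ := ∑ t ∈ range T, LinearMap.proj ((G.rotW ^ t) e₁)
  have hΛ : ∀ ω, Λ ω = ∑ t ∈ range T, ω ((G.rotW ^ t) e₁) := fun ω => by simp [Λ]
  have hmem : Λ ∈ (LinearMap.ker (G.boundary ℝ)).dualAnnihilator := by
    rw [Submodule.mem_dualAnnihilator]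
    intro ω hω
    rw [ker_boundary] at hω
    obtain ⟨η, rfl⟩ := hω
    rw [hΛ]
    have : ∀ t, G.gradient ℝ η ((G.rotW ^ t) e₁) =
        η (G.leftFace ((G.rotW ^ t) e₁)) - η (G.leftFace ((G.rotW ^ (t + 1)) e₁)) := fun t => by
      rw [pow_succ', Perm.mul_apply, leftFace_rotW]; rfl
    rw [sum_congr rfl fun t _ => this t, sum_range_sub' (fun t => η (G.leftFace ((G.rotW ^ t) e₁))),
      hT, ← hF]
    simp
  rw [← LinearMap.range_dualMap_eq_dualAnnihilator_ker] at hmem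
  obtain ⟨φ, hφ⟩ := hmem
  -- As `Λ` vanishes on closed flows, it factors through `boundary`. On an edge `bw`, `x b + y w`
  -- then counts the occurrences of the edge in `Λ`.
  let x : Fin n → ℝ := fun b => φ (Pi.single (Sum.inl b) 1)
  let y : Fin n → ℝ := fun w => φ (Pi.single (Sum.inr w) 1)
  have hxy : ∀ e : G.edges, x e.1.1 + y e.1.2 =
      ∑ t ∈ range T, (Pi.single e 1 : G.edges → ℝ) ((G.rotW ^ t) e₁) := fun e => by
    rw [← hΛ, ← hφ, LinearMap.dualMap_apply, boundary_single, map_add]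
  have hpow : ∀ t : ℕ, ((G.rotW ^ t) e₁).1.2 = e₁.1.2 := fun t =>
    ((G.rotW_sameCycle _ _).1 (Perm.sameCycle_pow_left.2 (Perm.SameCycle.refl _ _)))
  have hoff : ∀ e : G.edges, e.1.2 ≠ e₁.1.2 → x e.1.1 + y e.1.2 = 0 := fun e he => by
    rw [hxy]
    refine sum_eq_zero fun t _ => Pi.single_eq_of_ne (fun h => he ?_) _
    rw [← h, hpow]
  have hx1 : x e₁.1.1 + y e₁.1.2 ≠ 0 := by
    rw [hxy]
    refine (lt_of_lt_of_le one_pos ?_).ne'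
    have hle := single_le_sum (f := fun t => (Pi.single e₁ 1 : G.edges → ℝ) ((G.rotW ^ t) e₁))
      (fun t _ => by rw [Pi.single_apply]; split_ifs <;> norm_num) (mem_range.2 hT0)
    exact (Pi.single_eq_same (M := fun _ : G.edges => ℝ) e₁ 1).symm.le.trans hle
  have hx2 : x e₂.1.1 + y e₁.1.2 = 0 := by
    rw [hw, hxy]
    exact sum_eq_zero fun t ht => Pi.single_eq_of_ne (hT' t (mem_range.1 ht)) _
  have hedge : ∀ b w, K b w ≠ 0 → w ≠ e₁.1.2 → x b = - y w := fun b w hbw hne => by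
    have hmem : (b, w) ∈ G.edges := by
      by_contra h; exact hbw (hK.eq_zero b w h)
    exact eq_neg_of_add_eq_zero_left (hoff ⟨(b, w), hmem⟩ hne)
  -- Away from the white vertex of `e₁`, the numbers `x b` and `-y w` agree along edges. So black
  -- vertices split into the non-empty sets `B` and `Bᶜ`, and the other `n - 1` white vertices into
  -- `A` and `A'` with neighbours in `B` and `Bᶜ` respectively. The strict Hall condition gives `(#A
  -- + 1) + (#A' + 1) ≤ n`, a contradiction.
  let B : Finset (Fin n) := {b | x b ≠ - y e₁.1.2}
  let A : Finset (Fin n) := (univ.erase e₁.1.2).filter fun w => y w ≠ y e₁.1.2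
  let A' : Finset (Fin n) := (univ.erase e₁.1.2).filter fun w => ¬ y w ≠ y e₁.1.2
  have hAA' : #A + #A' = n - 1 := by
    rw [card_filter_add_card_filter_not]; simp
  have hBB : #B + #Bᶜ = n := by rw [card_add_card_compl]; simp
  have hB1 : 0 < #B := card_pos.2 ⟨e₁.1.1, by
    simp only [B, mem_filter, mem_univ, true_and]
    intro h; apply hx1; rw [h]; simp⟩
  have hB2 : 0 < #Bᶜ := card_pos.2 ⟨e₂.1.1, by
    simp only [B, mem_compl, mem_filter, mem_univ, true_and, not_not]
    exact eq_neg_of_add_eq_zero_left hx2⟩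
  have hA : 0 < #A → #A < #B := fun h => by
    refine h1.card_lt_neighbors (card_pos.1 h) (fun h => ?_) fun w hwA b hbw => ?_
    · have := h ▸ mem_univ e₁.1.2
      simp [A] at this
    · simp only [A, mem_filter, mem_erase, mem_univ, and_true] at hwA
      simp only [B, mem_filter, mem_univ, true_and]
      rw [hedge b w hbw hwA.1]
      exact fun h => hwA.2 (neg_injective h)
  have hA' : 0 < #A' → #A' < #Bᶜ := fun h => by
    refine h1.card_lt_neighbors (card_pos.1 h) (fun h => ?_) fun w hwA b hbw => ?_
    · have := h ▸ mem_univ e₁.1.2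
      simp [A'] at this
    · simp only [A', mem_filter, mem_erase, mem_univ, and_true, not_not] at hwA
      simp only [B, mem_compl, mem_filter, mem_univ, true_and, not_not]
      rw [hedge b w hbw hwA.1, hwA.2]
  omega

variable {G} in
/-- Black vertices have degree at least two. -/
theorem rotB_ne {e₀ : G.edges} {ν : G.edges → ℝ} {K : Matrix (Fin n) (Fin n) ℝ}
    (hK : G.IsKasteleyn e₀ ν K) (h1 : IsNonDegenerate 1 K) (hn : 2 ≤ n) (e : G.edges) :
    G.rotB e ≠ e := by
  intro h
  have hdeg : ∀ e' : G.edges, e'.1.1 = e.1.1 → e' = e := fun e' he' => by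
    obtain ⟨k, rfl⟩ := ((G.rotB_sameCycle e e').2 he'.symm).exists_nat_pow_eq
    induction k with
    | zero => simp
    | succ k ih =>
      rw [pow_succ', Perm.mul_apply, ih, h]
      rw [pow_succ', Perm.mul_apply, rotB_fst] at he'
      exact he'
  -- If `e` is the only edge at its black end, the other `n - 1` columns have neighbours only in the
  -- other `n - 1` rows.
  have := h1.card_lt_neighbors (A := univ.erase e.1.2) (B := univ.erase e.1.1)
    (card_pos.1 (by simp; omega)) (fun h => by simp [erase_eq_self] at h)
    (fun w hw b hb => by
      refine mem_erase.2 ⟨?_, mem_univ b⟩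
      rintro rfl
      have hmem : (e.1.1, w) ∈ G.edges := by
        by_contra h; exact hb (hK.eq_zero _ w h)
      have := hdeg ⟨(e.1.1, w), hmem⟩ rfl
      exact (mem_erase.1 hw).1 (congrArg (fun e : G.edges => e.1.2) this))
  simp at this

end PlaneBipartiteGraph


/-! ### The dual graph with divided outer face, and the extended cyclic orders -/

namespace BipartiteMap

open Equiv Finset CyclicSign
open scoped Classical

variable {n : ℕ} (G : BipartiteMap n) (e₀ : G.edges)

noncomputable instance : Fintype (G.DualVertex e₀) :=
  inferInstanceAs (Fintype ({F : G.Face // F ≠ G.leftFace e₀} ⊕ Fin (G.halfDegree e₀ + 1)))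

/-- The edges with the outer face on their left, in cyclic order. -/
def outerEdge (k : ℕ) : G.edges := (G.facePerm ^ k) e₀

/-- The edges with the outer face on their right, in cyclic order. -/
def exitEdge (i : Fin (G.halfDegree e₀)) : G.edges := G.rotB (G.outerEdge e₀ i)

variable {G e₀}

theorem outerEdge_halfDegree : G.outerEdge e₀ (G.halfDegree e₀) = e₀ := facePerm_pow_halfDegree e₀

theorem leftFace_outerEdge (k : ℕ) : G.leftFace (G.outerEdge e₀ k) = G.leftFace e₀ :=
  leftFace_pow e₀ k

theorem rotW_exitEdge (i : Fin (G.halfDegree e₀)) :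
    G.rotW (G.exitEdge e₀ i) = G.outerEdge e₀ (i + 1) := by
  rw [outerEdge, pow_succ']; rfl

theorem exitEdge_injective : Function.Injective (G.exitEdge e₀) := fun i j h =>
  Fin.ext (facePerm_pow_injOn e₀ i.2 j.2 (G.rotB.injective h))

theorem exists_exitEdge {e : G.edges} (h : G.leftFace (G.rotB.symm e) = G.leftFace e₀) :
    ∃ i, G.exitEdge e₀ i = e := by
  obtain ⟨i, hi, hi'⟩ := exists_pow_of_leftFace_eq h
  exact ⟨⟨i, hi⟩, by rw [exitEdge, outerEdge, hi', apply_symm_apply]⟩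

theorem outerIndex_outerEdge {k : ℕ} (hk : k < G.halfDegree e₀) :
    G.outerIndex e₀ (G.outerEdge e₀ k) = k := by
  have hmem : k ∈ {k' : ℕ | (G.facePerm ^ k') e₀ = G.outerEdge e₀ k} := rfl
  have h1 : G.outerIndex e₀ (G.outerEdge e₀ k) ≤ k := Nat.sInf_le hmem
  have h2 := Nat.sInf_mem ⟨k, hmem⟩
  exact facePerm_pow_injOn e₀ (lt_of_le_of_lt h1 hk) hk h2

theorem left_boundary {e : G.edges} (h : G.leftFace e = G.leftFace e₀) :
    G.left e₀ e = G.outerPiece e₀ (G.outerIndex e₀ (G.facePerm.symm e) + 1) := dif_pos h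

theorem right_boundary {e : G.edges} (h : G.leftFace (G.rotB.symm e) = G.leftFace e₀) :
    G.right e₀ e = G.outerPiece e₀ (G.outerIndex e₀ (G.rotB.symm e)) := dif_pos h

/-- Indexing by the preceding edge lets the index run over `1, ..., m`. Thus `e₀`, as the edge of
index `m` rather than `0`, has the last piece on its left. -/
theorem left_outerEdge (i : Fin (G.halfDegree e₀)) :
    G.left e₀ (G.outerEdge e₀ (i + 1)) = Sum.inr i.succ := by
  have h : G.facePerm.symm (G.outerEdge e₀ (i + 1)) = G.outerEdge e₀ i := by
    rw [symm_apply_eq, outerEdge, pow_succ']; rfl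
  rw [left_boundary (leftFace_outerEdge _), h, outerIndex_outerEdge i.2, outerPiece]
  congr 1
  ext
  simp [Fin.ofNat, Nat.mod_eq_of_lt]

theorem right_exitEdge (i : Fin (G.halfDegree e₀)) :
    G.right e₀ (G.exitEdge e₀ i) = Sum.inr i.castSucc := by
  have h : G.rotB.symm (G.exitEdge e₀ i) = G.outerEdge e₀ i := by
    rw [symm_apply_eq]; rfl
  rw [right_boundary (h ▸ leftFace_outerEdge _), h, outerIndex_outerEdge i.2, outerPiece]
  congr 1
  ext
  simp only [Fin.ofNat, Fin.val_castSucc]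
  exact Nat.mod_eq_of_lt (by omega)

theorem left_interior {e : G.edges} (h : G.leftFace e ≠ G.leftFace e₀) :
    G.left e₀ e = Sum.inl ⟨G.leftFace e, h⟩ := dif_neg h

theorem right_interior {e : G.edges} (h : G.leftFace (G.rotB.symm e) ≠ G.leftFace e₀) :
    G.right e₀ e = Sum.inl ⟨G.leftFace (G.rotB.symm e), h⟩ := dif_neg h

/-! ### The cyclic order around white vertices, with the outer boundary included -/

variable (G e₀)

/-- The involution exchanging the edge `exitEdge i` with the `i`-th boundary element. -/
noncomputable def boundarySwap : Perm (G.edges ⊕ Fin (G.halfDegree e₀)) :=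
  Function.Involutive.toPerm
    (Sum.elim (fun e => if h : ∃ i, G.exitEdge e₀ i = e then Sum.inr h.choose else Sum.inl e)
      fun i => Sum.inl (G.exitEdge e₀ i)) <| by
    rintro (e | i)
    · by_cases h : ∃ i, G.exitEdge e₀ i = e
      · simp only [Sum.elim_inl, dif_pos h, Sum.elim_inr]
        rw [h.choose_spec]
      · simp [dif_neg h]
    · have h : ∃ j, G.exitEdge e₀ j = G.exitEdge e₀ i := ⟨i, rfl⟩
      simp only [Sum.elim_inl, dif_pos h, Sum.elim_inr]
      rw [exitEdge_injective h.choose_spec]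

/-- The edges and the boundary elements in counterclockwise order around the white vertices. -/
noncomputable def whitePerm : Perm (G.edges ⊕ Fin (G.halfDegree e₀)) :=
  sumCongr G.rotW 1 * G.boundarySwap e₀

/-- The white vertex of an edge or boundary element. -/
def white : G.edges ⊕ Fin (G.halfDegree e₀) → Fin n :=
  Sum.elim (fun e => e.1.2) fun i => (G.exitEdge e₀ i).1.2

/-- The dual vertex before an edge or boundary element. -/
noncomputable def whiteTail : G.edges ⊕ Fin (G.halfDegree e₀) → G.DualVertex e₀ :=
  Sum.elim (G.left e₀) fun i => Sum.inr i.castSucc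

/-- The dual vertex after an edge or boundary element. -/
noncomputable def whiteHead : G.edges ⊕ Fin (G.halfDegree e₀) → G.DualVertex e₀ :=
  Sum.elim (G.right e₀) fun i => Sum.inr i.succ

variable {G e₀}

theorem whitePerm_exit (i : Fin (G.halfDegree e₀)) :
    G.whitePerm e₀ (Sum.inl (G.exitEdge e₀ i)) = Sum.inr i := by
  have h : ∃ j, G.exitEdge e₀ j = G.exitEdge e₀ i := ⟨i, rfl⟩
  have : G.boundarySwap e₀ (Sum.inl (G.exitEdge e₀ i)) = Sum.inr h.choose := dif_pos h
  rw [whitePerm, Perm.mul_apply, this, exitEdge_injective h.choose_spec]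
  rfl

theorem whitePerm_inl {e : G.edges} (h : ¬ ∃ i, G.exitEdge e₀ i = e) :
    G.whitePerm e₀ (Sum.inl e) = Sum.inl (G.rotW e) := by
  have : G.boundarySwap e₀ (Sum.inl e) = Sum.inl e := dif_neg h
  rw [whitePerm, Perm.mul_apply, this]
  rfl

theorem whitePerm_inr (i : Fin (G.halfDegree e₀)) :
    G.whitePerm e₀ (Sum.inr i) = Sum.inl (G.outerEdge e₀ (i + 1)) := by
  rw [← rotW_exitEdge]; rfl

theorem white_whitePerm (x : G.edges ⊕ Fin (G.halfDegree e₀)) :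
    G.white e₀ (G.whitePerm e₀ x) = G.white e₀ x := by
  rcases x with e | i
  · by_cases h : ∃ i, G.exitEdge e₀ i = e
    · obtain ⟨i, rfl⟩ := h
      rw [whitePerm_exit]; rfl
    · rw [whitePerm_inl h]; exact rotW_snd e
  · rw [whitePerm_inr, ← rotW_exitEdge]; exact rotW_snd _

theorem class_of_sameCycle {X ι : Type*} [Finite X] {σ : Perm X} {c : X → ι}
    (hσ : ∀ x, c (σ x) = c x) {x y : X} (h : σ.SameCycle x y) : c x = c y := by
  obtain ⟨k, rfl⟩ := h.exists_nat_pow_eq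
  induction k with
  | zero => rfl
  | succ k ih => rw [pow_succ', Perm.mul_apply, hσ]; exact ih ⟨k, by simp⟩

theorem sameCycle_map {X Y : Type*} [Finite X] {σ : Perm X} {τ : Perm Y} {f : X → Y}
    (hf : ∀ x, τ.SameCycle (f x) (f (σ x))) {x y : X} (h : σ.SameCycle x y) :
    τ.SameCycle (f x) (f y) := by
  obtain ⟨k, rfl⟩ := h.exists_nat_pow_eq
  induction k with
  | zero => exact Perm.SameCycle.refl _ _
  | succ k ih =>
    rw [pow_succ', Perm.mul_apply]
    exact (ih ⟨k, by simp⟩).trans (hf _)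

theorem sameCycle_apply_self {X : Type*} (σ : Perm X) (x : X) : σ.SameCycle x (σ x) :=
  ⟨1, by simp⟩

/-- A boundary element is only inserted between `exitEdge i` and its successor, so no cycles are
merged or split. -/
theorem white_eq_iff (x y : G.edges ⊕ Fin (G.halfDegree e₀)) :
    G.white e₀ x = G.white e₀ y ↔ (G.whitePerm e₀).SameCycle x y := by
  refine ⟨fun h => ?_, class_of_sameCycle white_whitePerm⟩
  have hstep : ∀ e : G.edges,
      (G.whitePerm e₀).SameCycle (Sum.inl e) (Sum.inl (G.rotW e)) := fun e => by
    by_cases h : ∃ i, G.exitEdge e₀ i = e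
    · obtain ⟨i, rfl⟩ := h
      refine (sameCycle_apply_self _ _).trans ?_
      rw [whitePerm_exit, rotW_exitEdge, ← whitePerm_inr]
      exact sameCycle_apply_self _ _
    · rw [← whitePerm_inl h]
      exact sameCycle_apply_self _ _
  have hrep : ∀ x : G.edges ⊕ Fin (G.halfDegree e₀), ∃ e : G.edges,
      e.1.2 = G.white e₀ x ∧ (G.whitePerm e₀).SameCycle (Sum.inl e) x := by
    rintro (e | i)
    · exact ⟨e, rfl, Perm.SameCycle.refl _ _⟩
    · refine ⟨G.exitEdge e₀ i, rfl, ?_⟩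
      rw [← whitePerm_exit]
      exact sameCycle_apply_self _ _
  obtain ⟨e, he, he'⟩ := hrep x
  obtain ⟨e', hf, hf'⟩ := hrep y
  refine he'.symm.trans (Perm.SameCycle.trans ?_ hf')
  exact sameCycle_map hstep ((G.rotW_sameCycle e e').2 (by rw [he, hf, h]))

/-- Consecutive elements share a dual vertex, also across the dotted line, so differences of a
function on the dual vertices telescope around each white vertex. -/
theorem whiteTail_whitePerm (x : G.edges ⊕ Fin (G.halfDegree e₀)) :
    G.whiteTail e₀ (G.whitePerm e₀ x) = G.whiteHead e₀ x := by
  rcases x with e | i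
  · by_cases h : ∃ i, G.exitEdge e₀ i = e
    · obtain ⟨i, rfl⟩ := h
      rw [whitePerm_exit]
      exact (right_exitEdge i).symm
    · rw [whitePerm_inl h]
      have h1 : G.leftFace (G.rotB.symm e) ≠ G.leftFace e₀ := fun h' => h (exists_exitEdge h')
      have h2 : G.leftFace (G.rotW e) = G.leftFace (G.rotB.symm e) := by
        rw [← leftFace_facePerm (G.rotB.symm e), facePerm_apply, apply_symm_apply]
      change G.left e₀ (G.rotW e) = G.right e₀ e
      rw [left_interior (h2 ▸ h1), right_interior h1]
      exact congrArg Sum.inl (Subtype.ext h2)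
  · rw [whitePerm_inr]
    exact left_outerEdge i

/-! ### The cyclic order around black vertices, with the outer boundary at `b₀` included -/

variable (G e₀)

/-- The edges in counterclockwise order around the black vertices; `none` stands for the outer
boundary at `b₀`. -/
noncomputable def blackPerm : Perm (Option G.edges) :=
  optionCongr G.rotB * swap (some e₀) none

/-- The black vertex of an edge or of the boundary element. -/
def black : Option G.edges → Fin n := fun x => x.elim e₀.1.1 fun e => e.1.1

/-- The dual vertex before an edge or the boundary element. -/
noncomputable def blackTail : Option G.edges → G.DualVertex e₀ :=
  fun x => x.elim (Sum.inr (Fin.last _)) (G.right e₀)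

/-- The dual vertex after an edge or the boundary element. -/
noncomputable def blackHead : Option G.edges → G.DualVertex e₀ :=
  fun x => x.elim (Sum.inr 0) (G.left e₀)

variable {G e₀}

theorem blackPerm_none : G.blackPerm e₀ none = some (G.rotB e₀) := by
  simp [blackPerm]

theorem blackPerm_some_self : G.blackPerm e₀ (some e₀) = none := by
  simp [blackPerm]

theorem blackPerm_some {e : G.edges} (h : e ≠ e₀) : G.blackPerm e₀ (some e) = some (G.rotB e) := by
  rw [blackPerm, Perm.mul_apply, swap_apply_of_ne_of_ne (by simpa using h) (by simp)]
  simp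

theorem black_blackPerm (x : Option G.edges) : G.black e₀ (G.blackPerm e₀ x) = G.black e₀ x := by
  rcases x with _ | e
  · rw [blackPerm_none]; exact rotB_fst e₀
  · by_cases h : e = e₀
    · subst h; rw [blackPerm_some_self]; rfl
    · rw [blackPerm_some h]; exact rotB_fst e

theorem black_eq_iff (x y : Option G.edges) :
    G.black e₀ x = G.black e₀ y ↔ (G.blackPerm e₀).SameCycle x y := by
  refine ⟨fun h => ?_, class_of_sameCycle black_blackPerm⟩
  have hstep : ∀ e : G.edges, (G.blackPerm e₀).SameCycle (some e) (some (G.rotB e)) := fun e => by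
    by_cases h : e = e₀
    · subst h
      rw [← blackPerm_none, ← blackPerm_some_self]
      exact (sameCycle_apply_self _ _).trans (sameCycle_apply_self _ _)
    · rw [← blackPerm_some h]
      exact sameCycle_apply_self _ _
  have hrep : ∀ x : Option G.edges, ∃ e : G.edges,
      e.1.1 = G.black e₀ x ∧ (G.blackPerm e₀).SameCycle (some e) x := by
    rintro (_ | e)
    · refine ⟨e₀, rfl, ?_⟩
      rw [← blackPerm_some_self]
      exact sameCycle_apply_self _ _
    · exact ⟨e, rfl, Perm.SameCycle.refl _ _⟩
  obtain ⟨e, he, he'⟩ := hrep x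
  obtain ⟨e', hf, hf'⟩ := hrep y
  refine he'.symm.trans (Perm.SameCycle.trans ?_ hf')
  exact sameCycle_map hstep ((G.rotB_sameCycle e e').2 (by rw [he, hf, h]))

theorem left_self : G.left e₀ e₀ = Sum.inr (Fin.last _) := by
  have hpos := halfDegree_pos e₀
  have := left_outerEdge (G := G) (e₀ := e₀) ⟨G.halfDegree e₀ - 1, by omega⟩
  simp only [Nat.sub_add_cancel hpos, outerEdge_halfDegree] at this
  rw [this]
  congr 1
  ext
  simp; omega

theorem right_rotB_self : G.right e₀ (G.rotB e₀) = Sum.inr 0 :=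
  right_exitEdge (G := G) (e₀ := e₀) ⟨0, halfDegree_pos e₀⟩

theorem exists_outerEdge {e : G.edges} (h : G.leftFace e = G.leftFace e₀) (hne : e ≠ e₀) :
    ∃ k, 0 < k ∧ k < G.halfDegree e₀ ∧ G.outerEdge e₀ k = e := by
  obtain ⟨k, hk, rfl⟩ := exists_pow_of_leftFace_eq h
  refine ⟨k, Nat.pos_of_ne_zero ?_, hk, rfl⟩
  rintro rfl
  exact hne rfl

/-- The corner after `e₀` is excepted because the dotted line from `b₀` divides it into the last
piece and piece `0`. -/
theorem right_rotB {e : G.edges} (h : e ≠ e₀) : G.right e₀ (G.rotB e) = G.left e₀ e := by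
  by_cases hF : G.leftFace e = G.leftFace e₀
  · obtain ⟨k, hk0, hk, rfl⟩ := exists_outerEdge hF h
    obtain ⟨k, rfl⟩ := Nat.exists_eq_succ_of_ne_zero hk0.ne'
    rw [left_outerEdge ⟨k, by omega⟩]
    exact right_exitEdge (G := G) (e₀ := e₀) ⟨k + 1, hk⟩
  · have h1 : G.leftFace (G.rotB.symm (G.rotB e)) ≠ G.leftFace e₀ := by
      rwa [symm_apply_apply]
    rw [left_interior hF, right_interior h1]
    exact congrArg Sum.inl (Subtype.ext (congrArg G.leftFace (symm_apply_apply _ e)))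

theorem blackTail_blackPerm (x : Option G.edges) :
    G.blackTail e₀ (G.blackPerm e₀ x) = G.blackHead e₀ x := by
  rcases x with _ | e
  · rw [blackPerm_none]; exact right_rotB_self
  · by_cases h : e = e₀
    · subst h; rw [blackPerm_some_self]; exact left_self.symm
    · rw [blackPerm_some h]; exact right_rotB h

theorem exists_left_eq (F : {F : G.Face // F ≠ G.leftFace e₀}) :
    ∃ e : G.edges, G.leftFace e = F.1 ∧ G.left e₀ e = Sum.inl F := by
  obtain ⟨e, he⟩ := leftFace_surjective F.1
  refine ⟨e, he, ?_⟩
  rw [left_interior (he ▸ F.2)]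
  exact congrArg _ (Subtype.ext he)

theorem leftFace_of_left_eq {e : G.edges} {F : {F : G.Face // F ≠ G.leftFace e₀}}
    (h : G.left e₀ e = Sum.inl F) : G.leftFace e = F.1 := by
  by_cases hF : G.leftFace e = G.leftFace e₀
  · rw [left_boundary hF, outerPiece] at h
    cases h
  · rw [left_interior hF] at h
    rw [← Sum.inl_injective h]

end BipartiteMap

/-! ### The count around black vertices -/

namespace PlaneBipartiteGraph

open Equiv Finset BipartiteMap CyclicSign Matrix
open scoped Classical

variable {n : ℕ} {G : PlaneBipartiteGraph n} {e₀ : G.edges}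

theorem card_interior_faces :
    Fintype.card {F : G.Face // F ≠ G.leftFace e₀} + 1 = Fintype.card G.Face := by
  have hpos : 0 < Fintype.card G.Face := Fintype.card_pos_iff.2 ⟨G.leftFace e₀⟩
  rw [Fintype.card_subtype_compl, Fintype.card_subtype_eq]
  omega

theorem sum_dualVertex {M : Type*} [AddCommMonoid M] (F : G.DualVertex e₀ → M) :
    ∑ v, F v = ∑ f, F (Sum.inl f) + ∑ k, F (Sum.inr k) :=
  Fintype.sum_sum_type F

/-- The signed lengths around the black vertices, in the extended cyclic order. -/
def blackStep (r : G.edges → ℝ) : Option G.edges → ℝ := fun x => x.elim (-1) r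

/-- The conclusions of the count of sign changes around black vertices. -/
structure BlackCount (e₀ : G.edges) (r : G.edges → ℝ) : Prop where
  descent_unique : ∀ x y, G.black e₀ x = G.black e₀ y → 0 < blackStep r x →
    blackStep r (G.blackPerm e₀ x) < 0 → 0 < blackStep r y →
    blackStep r (G.blackPerm e₀ y) < 0 → x = y
  ascent_unique : ∀ x y, G.black e₀ x = G.black e₀ y → blackStep r x < 0 →
    0 < blackStep r (G.blackPerm e₀ x) → blackStep r y < 0 →
    0 < blackStep r (G.blackPerm e₀ y) → x = y
  flat_unique : ∀ e e', G.leftFace e = G.leftFace e' → e ≠ e₀ → e' ≠ e₀ →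
    0 < r e * r (G.rotB e) → 0 < r e' * r (G.rotB e') → e = e'
  flat_exists : ∀ F, F ≠ G.leftFace e₀ → ∃ e, G.leftFace e = F ∧ 0 < r e * r (G.rotB e)
  not_flat : ∀ e, e ≠ e₀ → G.leftFace e = G.leftFace e₀ → r e * r (G.rotB e) < 0
  pos_self : 0 < r e₀
  pos_rotB : 0 < r (G.rotB e₀)

/-- The row sums of the lengths vanish except at `b₀`, where the sum `1` is compensated by the step
`-1` of the boundary element. -/
theorem sum_blackStep {K : Matrix (Fin n) (Fin n) ℝ} (hK0 : ∀ b w, (b, w) ∉ G.edges → K b w = 0)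
    {f : Fin n → ℝ} (hKf : K *ᵥ f = Pi.single e₀.1.1 1) (b : Fin n) :
    ∑ x with G.black e₀ x = b, blackStep (fun e : G.edges => K e.1.1 e.1.2 * f e.1.2) x = 0 := by
  have h1 := G.sum_fst b (fun b w => K b w * f w) fun w hw => by rw [hK0 b w hw, zero_mul]
  have h2 : ∑ w, K b w * f w = (Pi.single e₀.1.1 1 : Fin n → ℝ) b := congrFun hKf b
  rw [sum_filter, Fintype.sum_option]
  rw [sum_filter] at h1
  have h3 : ∑ e : G.edges, (if G.black e₀ (some e) = b then
      blackStep (fun e : G.edges => K e.1.1 e.1.2 * f e.1.2) (some e) else 0) =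
      (Pi.single e₀.1.1 1 : Fin n → ℝ) b := h1.trans h2
  rw [h3, Pi.single_apply]
  by_cases h : b = e₀.1.1
  · simp [h, black, blackStep]
  · rw [if_neg h, if_neg (fun h' => h h'.symm), add_zero]

theorem blackCount {ν : G.edges → ℝ} {K : Matrix (Fin n) (Fin n) ℝ}
    (hK : G.IsKasteleyn e₀ ν K) (hν : ∀ e, 0 < ν e) {f : Fin n → ℝ} (hf : ∀ w, f w ≠ 0)
    (hKf : K *ᵥ f = Pi.single e₀.1.1 1) :
    BlackCount e₀ (fun e : G.edges => K e.1.1 e.1.2 * f e.1.2) := by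
  set r : G.edges → ℝ := fun e => K e.1.1 e.1.2 * f e.1.2 with hr
  have hr0 : ∀ e, r e ≠ 0 := fun e => mul_ne_zero (hK.ne_zero hν e) (hf _)
  have hs0 : ∀ x, blackStep r x ≠ 0 := by
    rintro (_ | e)
    · simp [blackStep]
    · exact hr0 e
  have hodd : ∀ F : G.Face, F ≠ G.leftFace e₀ →
      ∃ e, G.leftFace e = F ∧ 0 < r e * r (G.rotB e) := fun F hF => by
    obtain ⟨e, he⟩ := card_pos.1 (hK.odd_black hν (α := fun _ => 1) (by simp) hf (ρ := r)
      (fun e => by simp [hr]) hF).pos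
    exact ⟨e, by simpa using he⟩
  -- Parity forces a flat corner in each interior face, and nothing is asked of the outer pieces.
  -- With two sign changes per vertex this makes `2n + (F - 1) = E + 1`, which is the number of all
  -- corners.
  let low : G.DualVertex e₀ → ℕ := Sum.elim (fun _ => 1) fun _ => 0
  obtain ⟨h1, h2, h3⟩ := unique_of_card_le (σ := G.blackPerm e₀) (c := G.black e₀)
    black_eq_iff
    (fun b => by obtain ⟨e, he⟩ := G.exists_edge_fst b; exact ⟨some e, he⟩) hs0
    (sum_blackStep hK.eq_zero hKf) (G.blackHead e₀)
    low
    (by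
      rintro (F | k)
      · obtain ⟨e, he, hpos⟩ := hodd F.1 F.2
        refine card_pos.2 ⟨some e, ?_⟩
        have hne : e ≠ e₀ := fun h => F.2 (by rw [← he, h])
        simp only [flats, mem_filter, mem_univ, true_and, blackPerm_some hne]
        refine ⟨?_, hpos⟩
        change G.left e₀ e = _
        rw [left_interior (he ▸ F.2)]
        exact congrArg _ (Subtype.ext he)
      · exact Nat.zero_le _)
    (by
      rw [sum_dualVertex]
      simp only [low, Sum.elim_inl, Sum.elim_inr, sum_const, card_univ, smul_eq_mul, mul_one, mul_zero,
        Fintype.card_option, Fintype.card_fin]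
      have := G.card_edges
      have := card_interior_faces (e₀ := e₀)
      omega)
  have hout : ∀ x k, G.blackHead e₀ x = Sum.inr k →
      blackStep r x * blackStep r (G.blackPerm e₀ x) < 0 := fun x k hx => by
    have := card_eq_zero.1 (h3 (Sum.inr k))
    by_contra hcon
    have hpos := lt_of_le_of_ne (not_lt.1 hcon) (mul_ne_zero (hs0 x) (hs0 _)).symm
    have hmem : x ∈ flats (G.blackPerm e₀) (G.blackHead e₀) (blackStep r) (Sum.inr k) := by
      simp only [flats, mem_filter, mem_univ, true_and]
      exact ⟨hx, hpos⟩
    rw [this] at hmem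
    simp at hmem
  refine ⟨h1, h2, fun e e' hF he he' hpos hpos' => ?_, hodd, fun e hne hF => ?_, ?_, ?_⟩
  · by_cases hF' : G.leftFace e = G.leftFace e₀
    · exfalso
      obtain ⟨k, hk0, hk, rfl⟩ := exists_outerEdge hF' he
      obtain ⟨k, rfl⟩ := Nat.exists_eq_succ_of_ne_zero hk0.ne'
      have := hout (some _) _ (left_outerEdge (G := G.toBipartiteMap) ⟨k, by omega⟩)
      rw [blackPerm_some he] at this
      exact absurd hpos this.not_gt
    · have hc := (h3 (Sum.inl ⟨_, hF'⟩)).le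
      have := card_le_one.1 hc (some e) (by
        simp only [flats, mem_filter, mem_univ, true_and, blackPerm_some he]
        exact ⟨left_interior hF', hpos⟩) (some e') (by
        simp only [flats, mem_filter, mem_univ, true_and, blackPerm_some he']
        refine ⟨?_, hpos'⟩
        change G.left e₀ e' = _
        rw [left_interior (hF ▸ hF')]
        exact congrArg _ (Subtype.ext hF.symm))
      exact Option.some_injective _ this
  · obtain ⟨k, hk0, hk, rfl⟩ := exists_outerEdge hF hne
    obtain ⟨k, rfl⟩ := Nat.exists_eq_succ_of_ne_zero hk0.ne'
    have := hout (some _) _ (left_outerEdge (G := G.toBipartiteMap) ⟨k, by omega⟩)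
    rwa [blackPerm_some hne] at this
  -- The corners on both sides of the boundary element belong to outer pieces and are not flat. Its
  -- step is negative, so the neighbouring lengths are positive.
  · have := hout (some e₀) _ left_self
    rw [blackPerm_some_self] at this
    have h : r e₀ * (-1) < 0 := this
    linarith
  · have := hout none _ rfl
    rw [blackPerm_none] at this
    have h : (-1) * r (G.rotB e₀) < 0 := this
    linarith

end PlaneBipartiteGraph


/-! ### Convex polygons in the plane -/

namespace PlanePolygon

open Equiv Finset CyclicSign
open scoped Classical

/-- The cross product, multiplied by an orientation `s`. -/
def cr (s : ℝ) (u z : ℂ) : ℝ := s * (u.re * z.im - u.im * z.re)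

variable (s : ℝ)

@[simp] theorem cr_self (u : ℂ) : cr s u u = 0 := by simp [cr]; right; ring
@[simp] theorem cr_zero (u : ℂ) : cr s u 0 = 0 := by simp [cr]
@[simp] theorem zero_cr (u : ℂ) : cr s 0 u = 0 := by simp [cr]
theorem cr_comm (u z : ℂ) : cr s u z = - cr s z u := by simp only [cr]; ring
theorem cr_add (u z z' : ℂ) : cr s u (z + z') = cr s u z + cr s u z' := by
  simp only [cr, Complex.add_re, Complex.add_im]; ring
theorem cr_sub (u z z' : ℂ) : cr s u (z - z') = cr s u z - cr s u z' := by
  simp only [cr, Complex.sub_re, Complex.sub_im]; ring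
theorem cr_neg (u z : ℂ) : cr s u (-z) = - cr s u z := by
  simp only [cr, Complex.neg_re, Complex.neg_im]; ring
theorem cr_smul (t : ℝ) (u z : ℂ) : cr s u (t • z) = t * cr s u z := by
  simp only [cr, Complex.real_smul, Complex.re_ofReal_mul, Complex.im_ofReal_mul]; ring
theorem add_cr (u u' z : ℂ) : cr s (u + u') z = cr s u z + cr s u' z := by
  simp only [cr, Complex.add_re, Complex.add_im]; ring
theorem neg_cr (u z : ℂ) : cr s (-u) z = - cr s u z := by
  simp only [cr, Complex.neg_re, Complex.neg_im]; ring
theorem smul_cr (t : ℝ) (u z : ℂ) : cr s (t • u) z = t * cr s u z := by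
  simp only [cr, Complex.real_smul, Complex.re_ofReal_mul, Complex.im_ofReal_mul]; ring
theorem cr_sum {α : Type*} (u : ℂ) (A : Finset α) (f : α → ℂ) :
    cr s u (∑ a ∈ A, f a) = ∑ a ∈ A, cr s u (f a) := by
  induction A using Finset.induction_on with
  | empty => simp
  | insert a A ha ih => rw [sum_insert ha, sum_insert ha, cr_add, ih]
theorem cr_I_mul (u : ℂ) : cr s (Complex.I * u) u = - s * Complex.normSq u := by
  simp [cr, Complex.normSq_apply]; ring
theorem cr_mul_I (u : ℂ) : cr s u (Complex.I * u) = s * Complex.normSq u := by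
  simp [cr, Complex.normSq_apply]

@[fun_prop]
theorem continuous_cr (u : ℂ) : Continuous (cr s u) := by unfold cr; fun_prop

/-- Three vectors in the plane are linearly dependent. -/
theorem cr_relation (a b d : ℂ) : cr s a b • d + cr s b d • a + cr s d a • b = 0 := by
  apply Complex.ext <;> simp [cr] <;> ring

omit s in
theorem combination_sub {α β : ℝ} (h : α + β = 1) (x y a : ℂ) :
    α • x + β • y - a = α • (x - a) + β • (y - a) := by
  obtain rfl : β = 1 - α := by linarith
  module

theorem convex_le (h a : ℂ) : Convex ℝ {z | 0 ≤ cr s h (z - a)} := by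
  intro x hx y hy α β hα hβ hαβ
  simp only [Set.mem_ofPred_eq] at *
  rw [combination_sub hαβ, cr_add, cr_smul, cr_smul]
  positivity

theorem convex_lt (h a : ℂ) : Convex ℝ {z | 0 < cr s h (z - a)} := by
  intro x hx y hy α β hα hβ hαβ
  simp only [Set.mem_ofPred_eq] at *
  rw [combination_sub hαβ, cr_add, cr_smul, cr_smul]
  rcases hα.eq_or_lt with rfl | hα
  · have : β = 1 := by linarith
    rw [this]; linarith
  · have : 0 ≤ β * cr s h (y - a) := mul_nonneg hβ hy.le
    have : 0 < α * cr s h (x - a) := mul_pos hα hx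
    linarith

theorem isOpen_lt (h a : ℂ) : IsOpen {z | 0 < cr s h (z - a)} :=
  _root_.isOpen_lt continuous_const (by fun_prop)

theorem isClosed_le (h a : ℂ) : IsClosed {z | 0 ≤ cr s h (z - a)} :=
  _root_.isClosed_le continuous_const (by fun_prop)

variable {X ι : Type*} [DecidableEq ι] {σ : Perm X} {c : X → ι} {v : X → ℂ} {s} {i : ι}

variable (s σ c v i) in
/-- The points of a class of `σ` form a strictly convex polygon, with orientation `s`. -/
structure ConvexCycle : Prop where
  left : ∀ x y, c x = i → c y = i → y ≠ x → y ≠ σ x → 0 < cr s (v (σ x) - v x) (v y - v x)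
  ne_one : ∀ x, c x = i → σ x ≠ x
  ne_two : ∀ x, c x = i → σ (σ x) ≠ x

variable (s σ c v i) in
/-- The open region bounded by a convex polygon. -/
def openTile : Set ℂ := {z | ∀ x, c x = i → 0 < cr s (v (σ x) - v x) (z - v x)}

variable (s σ c v i) in
/-- The closed region bounded by a convex polygon. -/
def closedTile : Set ℂ := {z | ∀ x, c x = i → 0 ≤ cr s (v (σ x) - v x) (z - v x)}

omit [DecidableEq ι] in
theorem openTile_subset : openTile s σ c v i ⊆ closedTile s σ c v i :=
  fun _ hz x hx => (hz x hx).le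

omit [DecidableEq ι] in
theorem isOpen_openTile [Finite X] : IsOpen (openTile s σ c v i) := by
  have : openTile s σ c v i =
      ⋂ x, ⋂ (_ : c x = i), {z | 0 < cr s (v (σ x) - v x) (z - v x)} := by
    ext z; simp [openTile]
  rw [this]
  exact isOpen_iInter_of_finite fun x => isOpen_iInter_of_finite fun _ => isOpen_lt s _ _

omit [DecidableEq ι] in
theorem isClosed_closedTile : IsClosed (closedTile s σ c v i) := by
  have : closedTile s σ c v i =
      ⋂ x, ⋂ (_ : c x = i), {z | 0 ≤ cr s (v (σ x) - v x) (z - v x)} := by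
    ext z; simp [closedTile]
  rw [this]
  exact isClosed_iInter fun x => isClosed_iInter fun _ => isClosed_le s _ _

omit [DecidableEq ι] in
theorem convex_openTile : Convex ℝ (openTile s σ c v i) := by
  have : openTile s σ c v i =
      ⋂ x, ⋂ (_ : c x = i), {z | 0 < cr s (v (σ x) - v x) (z - v x)} := by
    ext z; simp [openTile]
  rw [this]
  exact convex_iInter fun x => convex_iInter fun _ => convex_lt s _ _

omit [DecidableEq ι] in
theorem convex_closedTile : Convex ℝ (closedTile s σ c v i) := by
  have : closedTile s σ c v i =
      ⋂ x, ⋂ (_ : c x = i), {z | 0 ≤ cr s (v (σ x) - v x) (z - v x)} := by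
    ext z; simp [closedTile]
  rw [this]
  exact convex_iInter fun x => convex_iInter fun _ => convex_le s _ _

namespace ConvexCycle

variable (H : ConvexCycle s σ c v i) (hσ : ∀ x, c (σ x) = c x)
include H hσ

omit [DecidableEq ι]

theorem ne_two' {x : X} (hx : c x = i) : σ (σ x) ≠ σ x := H.ne_one (σ x) (by rw [hσ, hx])

omit hσ in
theorem left' {x y : X} (hx : c x = i) (hy : c y = i) :
    0 ≤ cr s (v (σ x) - v x) (v y - v x) := by
  by_cases h : y = x
  · subst h; simp
  by_cases h' : y = σ x
  · subst h'; simp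
  exact (H.left x y hx hy h h').le

omit hσ in
theorem mem_closedTile {x : X} (hx : c x = i) : v x ∈ closedTile s σ c v i :=
  fun _ hy => H.left' hy hx

theorem turn {x : X} (hx : c x = i) :
    0 < cr s (v (σ x) - v x) (v (σ (σ x)) - v (σ x)) := by
  have := H.left x (σ (σ x)) hx (by rw [hσ, hσ, hx]) (H.ne_two x hx) (H.ne_two' hσ hx)
  have h2 : v (σ (σ x)) - v x = (v (σ x) - v x) + (v (σ (σ x)) - v (σ x)) := by ring
  rw [h2, cr_add, cr_self, zero_add] at this
  exact this

/-- A vertex at which a linear functional has a local maximum is a maximum on the polygon. -/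
theorem le_of_local_max {x : X} (hx : c x = i) (f : ℂ →ₗ[ℝ] ℝ) (h1 : 0 ≤ f (v (σ x) - v x))
    (h2 : f (v (σ (σ x)) - v (σ x)) ≤ 0) {z : ℂ} (hz : z ∈ closedTile s σ c v i) :
    f z ≤ f (v (σ x)) := by
  have ht := H.turn hσ hx
  have hz1 := hz x hx
  have hz2 := hz (σ x) (by rw [hσ, hx])
  have hrel := congrArg f (cr_relation s (v (σ x) - v x) (v (σ (σ x)) - v (σ x)) (z - v (σ x)))
  simp only [map_add, map_smul, map_zero, smul_eq_mul] at hrel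
  have e1 : cr s (z - v (σ x)) (v (σ x) - v x) = - cr s (v (σ x) - v x) (z - v x) := by
    rw [cr_comm, show z - v (σ x) = (z - v x) - (v (σ x) - v x) by ring, cr_sub, cr_self, sub_zero]
  rw [e1] at hrel
  have h3 : 0 ≤ f (v (σ x)) - f z := by
    rw [map_sub f z] at hrel
    by_contra hcon
    nlinarith [mul_nonneg hz2 h1, mul_nonneg hz1 (neg_nonneg.2 h2),
      mul_pos ht (neg_pos.2 (not_le.1 hcon))]
  linarith

/-- Strict version for vertices. -/
theorem lt_of_local_max {x y : X} (hx : c x = i) (hy : c y = i) (hne : y ≠ σ x) (u : ℂ)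
    (h1 : 0 < cr s u (v (σ x) - v x)) (h2 : cr s u (v (σ (σ x)) - v (σ x)) < 0) :
    cr s u (v y) < cr s u (v (σ x)) := by
  have ht := H.turn hσ hx
  have hz1 := H.left' hx hy
  have hz2 := H.left' (x := σ x) (by rw [hσ, hx]) hy
  have hrel := congrArg (cr s u) (cr_relation s (v (σ x) - v x) (v (σ (σ x)) - v (σ x))
    (v y - v (σ x)))
  simp only [cr_add, cr_smul, cr_zero] at hrel
  have e1 : cr s (v y - v (σ x)) (v (σ x) - v x) = - cr s (v (σ x) - v x) (v y - v x) := by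
    rw [cr_comm, show v y - v (σ x) = (v y - v x) - (v (σ x) - v x) by ring, cr_sub, cr_self,
      sub_zero]
  rw [e1] at hrel
  have hpos : 0 < cr s (v (σ x) - v x) (v y - v x) ∨
      0 < cr s (v (σ (σ x)) - v (σ x)) (v y - v (σ x)) := by
    by_cases hyx : y = x
    · right
      subst hyx
      exact H.left (σ y) y (by rw [hσ, hx]) hy (H.ne_one y hx).symm (H.ne_two y hx).symm
    · left
      exact H.left x y hx hy hyx hne
  have h3 : 0 < cr s (v (σ x) - v x) (v y - v x) * - cr s u (v (σ (σ x)) - v (σ x)) +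
      cr s (v (σ (σ x)) - v (σ x)) (v y - v (σ x)) * cr s u (v (σ x) - v x) := by
    rcases hpos with h | h
    · have := mul_pos h (neg_pos.2 h2)
      have := mul_nonneg hz2 h1.le
      linarith
    · have := mul_nonneg hz1 (neg_pos.2 h2).le
      have := mul_pos h h1
      linarith
  rw [cr_sub s u (v y)] at hrel
  by_contra hcon
  have := mul_nonneg ht.le (sub_nonneg.2 (not_lt.1 hcon))
  linarith

/-- A point outside the hull is separated from it by a functional. The largest vertex is a local
maximum of this functional, hence by `le_of_local_max` a maximum on the whole tile. -/
theorem closedTile_subset [Finite X] (hi : ∃ x, c x = i) :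
    closedTile s σ c v i ⊆ convexHull ℝ (v '' {x | c x = i}) := by
  intro z hz
  by_contra hcon
  have hfin : (v '' {x | c x = i}).Finite := Set.toFinite _
  obtain ⟨f, t, hf, hft⟩ := geometric_hahn_banach_closed_point (convex_convexHull ℝ _)
    (hfin.isClosed_convexHull (𝕜 := ℝ)) hcon
  have : Fintype X := Fintype.ofFinite X
  obtain ⟨y, hy, hmax⟩ := exists_max_image ({x | c x = i} : Finset X) (fun x => f (v x))
    (by obtain ⟨x, hx⟩ := hi; exact ⟨x, by simpa using hx⟩)
  simp only [mem_filter, mem_univ, true_and] at hy hmax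
  have hx : c (σ.symm y) = i := by
    rw [← hy]; conv_rhs => rw [← σ.apply_symm_apply y]
    rw [hσ]
  have h1 := hmax _ hx
  have h2 := hmax (σ y) (by rw [hσ, hy])
  have h3 := H.le_of_local_max hσ hx (f : ℂ →ₗ[ℝ] ℝ)
    (by simp only [apply_symm_apply, map_sub]; exact sub_nonneg.2 h1)
    (by simp only [apply_symm_apply, map_sub]; exact sub_nonpos.2 h2) hz
  rw [apply_symm_apply] at h3
  have h4 := hf (v y) (subset_convexHull ℝ _ ⟨y, hy, rfl⟩)
  have h5 : f z ≤ f (v y) := h3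
  linarith

/-- The barycentre of the vertices works: the vertex `σ (σ x)` lies strictly inside the side at `x`,
and no vertex lies outside. -/
theorem openTile_nonempty [Finite X] (hi : ∃ x, c x = i) : (openTile s σ c v i).Nonempty := by
  have : Fintype X := Fintype.ofFinite X
  let A : Finset X := {x | c x = i}
  have hA : A.Nonempty := by obtain ⟨x, hx⟩ := hi; exact ⟨x, by simpa [A] using hx⟩
  have hcard : (0 : ℝ) < #A := by exact_mod_cast card_pos.2 hA
  refine ⟨((#A : ℝ)⁻¹) • ∑ y ∈ A, v y, fun x hx => ?_⟩
  have e1 : ((#A : ℝ)⁻¹) • ∑ y ∈ A, v y - v x = ((#A : ℝ)⁻¹) • ∑ y ∈ A, (v y - v x) := by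
    rw [sum_sub_distrib, smul_sub, sum_const, ← Nat.cast_smul_eq_nsmul ℝ, smul_smul,
      inv_mul_cancel₀ hcard.ne', one_smul]
  rw [e1, cr_smul, cr_sum]
  refine mul_pos (inv_pos.2 hcard) (sum_pos' (fun y hy => H.left' hx (by simpa [A] using hy))
    ⟨σ (σ x), by simp [A, hσ, hx], ?_⟩)
  exact H.left x (σ (σ x)) hx (by rw [hσ, hσ, hx]) (H.ne_two x hx) (H.ne_two' hσ hx)

omit H hσ in
theorem openSegment_subset {z o : ℂ} (hz : z ∈ closedTile s σ c v i)
    (ho : o ∈ openTile s σ c v i) : openSegment ℝ z o ⊆ openTile s σ c v i := by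
  rintro _ ⟨α, β, hα, hβ, hαβ, rfl⟩ x hx
  rw [combination_sub hαβ, cr_add, cr_smul, cr_smul]
  have := mul_nonneg hα.le (hz x hx)
  have := mul_pos hβ (ho x hx)
  linarith

theorem closedTile_subset_closure [Finite X] (hi : ∃ x, c x = i) :
    closedTile s σ c v i ⊆ closure (openTile s σ c v i) := by
  intro z hz
  obtain ⟨o, ho⟩ := H.openTile_nonempty hσ hi
  exact closure_mono (openSegment_subset hz ho)
    (segment_subset_closure_openSegment (left_mem_segment ℝ z o))

/-- In the relative interior of an edge, the other inequalities are strict. -/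
theorem pos_of_mem_openSegment {x y : X} (hx : c x = i) (hy : c y = i) (hne : y ≠ x) {z : ℂ}
    (hz : z ∈ openSegment ℝ (v x) (v (σ x))) : 0 < cr s (v (σ y) - v y) (z - v y) := by
  obtain ⟨α, β, hα, hβ, hαβ, rfl⟩ := hz
  rw [combination_sub hαβ, cr_add, cr_smul, cr_smul]
  have hx' : c (σ x) = i := by rw [hσ, hx]
  have h1 := mul_nonneg hα.le (H.left' hy hx)
  have h2 := mul_nonneg hβ.le (H.left' hy hx')
  by_cases h : x = σ y
  · have := mul_pos hβ (H.left y (σ x) hy hx' (by rw [h]; exact H.ne_two y hy)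
      (by rw [h]; exact H.ne_two' hσ hy))
    linarith
  · have := mul_pos hα (H.left y x hy hx hne.symm h)
    linarith

omit H hσ in
theorem _root_.PlanePolygon.cr_eq_zero_of_mem_openSegment {a b z : ℂ}
    (hz : z ∈ openSegment ℝ a b) : cr s (b - a) (z - a) = 0 := by
  obtain ⟨α, β, hα, hβ, hαβ, rfl⟩ := hz
  rw [combination_sub hαβ, sub_self, smul_zero, zero_add, cr_smul, cr_self, mul_zero]

/-- Such a point is on the line of some side. The inequalities of the preceding and the following
side confine its parameter `τ` to the unit interval. -/
theorem mem_segment_of_notMem {z : ℂ} (hz : z ∈ closedTile s σ c v i)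
    (hz' : z ∉ openTile s σ c v i) : ∃ x, c x = i ∧ z ∈ segment ℝ (v x) (v (σ x)) := by
  simp only [openTile, Set.mem_ofPred_eq, not_forall] at hz'
  obtain ⟨x, hx, hle⟩ := hz'
  have h0 : cr s (v (σ x) - v x) (z - v x) = 0 := le_antisymm (not_lt.1 hle) (hz x hx)
  refine ⟨x, hx, ?_⟩
  have ht := H.turn hσ hx
  have hx' : c (σ.symm x) = i := by
    rw [← hx]; conv_rhs => rw [← σ.apply_symm_apply x]
    rw [hσ]
  have ht' := H.turn hσ hx'
  simp only [apply_symm_apply] at ht'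
  have hrel := cr_relation s (v (σ x) - v x) (v (σ (σ x)) - v (σ x)) (z - v x)
  rw [cr_comm s (z - v x), h0, neg_zero, zero_smul, add_zero] at hrel
  set T := cr s (v (σ x) - v x) (v (σ (σ x)) - v (σ x)) with hT
  set τ := - cr s (v (σ (σ x)) - v (σ x)) (z - v x) / T with hτ
  have hzτ : z - v x = τ • (v (σ x) - v x) := by
    have h3 : T • (z - v x) = (- cr s (v (σ (σ x)) - v (σ x)) (z - v x)) • (v (σ x) - v x) := by
      rw [neg_smul]; exact eq_neg_of_add_eq_zero_left hrel
    rw [hτ, div_eq_inv_mul, mul_smul, ← h3, smul_smul, inv_mul_cancel₀ ht.ne', one_smul]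
  have h1 := hz (σ x) (by rw [hσ, hx])
  have h2 := hz _ hx'
  rw [apply_symm_apply] at h2
  rw [show z - v (σ x) = (z - v x) - (v (σ x) - v x) by ring, hzτ, cr_sub, cr_smul,
    cr_comm s (v (σ (σ x)) - v (σ x)), ← hT] at h1
  rw [show z - v (σ.symm x) = (z - v x) + (v x - v (σ.symm x)) by ring, hzτ, cr_add, cr_smul,
    cr_self, add_zero] at h2
  have hτ0 : 0 ≤ τ := by
    by_contra h
    nlinarith
  have hτ1 : τ ≤ 1 := by
    by_contra h
    nlinarith
  refine ⟨1 - τ, τ, by linarith, hτ0, by ring, ?_⟩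
  rw [sub_eq_iff_eq_add'.1 hzτ]
  module

end ConvexCycle

/-! ### Winding numbers -/

variable (s) in
/-- The position at which the line through `z` in direction `u` meets the line through `a, b`. -/
noncomputable def crossing (u z a b : ℂ) : ℝ := cr s (b - a) (z - a) / cr s u (b - a)

variable (s) in
/-- The signed crossing of the ray from `z` in direction `u` with the segment from `a` to `b`. -/
noncomputable def wind (u z a b : ℂ) : ℝ :=
  ((if cr s u z < cr s u b then 1 else 0) - (if cr s u z < cr s u a then 1 else 0)) *
    (if 0 < crossing s u z a b then 1 else 0)

theorem crossing_spec {u z a b : ℂ} (h : cr s u (b - a) ≠ 0) :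
    z + crossing s u z a b • u = a + (cr s u (z - a) / cr s u (b - a)) • (b - a) := by
  have hrel := cr_relation s u (b - a) (z - a)
  rw [cr_comm s (z - a) u] at hrel
  have : z - a + crossing s u z a b • u = (cr s u (z - a) / cr s u (b - a)) • (b - a) := by
    rw [crossing, div_eq_inv_mul, div_eq_inv_mul, mul_smul, mul_smul]
    have h2 : cr s u (b - a) • (z - a) + cr s (b - a) (z - a) • u =
        cr s u (z - a) • (b - a) := by
      rw [neg_smul] at hrel
      exact add_neg_eq_zero.1 hrel
    rw [← h2, smul_add, smul_smul _ _ (z - a), inv_mul_cancel₀ h, one_smul, smul_smul]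
  rw [← this]; ring

theorem wind_comm (u z a b : ℂ) : wind s u z b a = - wind s u z a b := by
  have : crossing s u z b a = crossing s u z a b := by
    rw [crossing, crossing, show a - b = - (b - a) by ring, cr_neg, neg_cr, neg_div_neg_eq,
      show z - b = (z - a) - (b - a) by ring, cr_sub, cr_self, sub_zero]
  rw [wind, wind, this]
  ring

namespace ConvexCycle

variable (H : ConvexCycle s σ c v i) (hσ : ∀ x, c (σ x) = c x)
include H hσ

omit [DecidableEq ι] in
omit H hσ in
theorem crossing_mem {u z : ℂ} {y : X}
    (h : (cr s u (v y) < cr s u z ∧ cr s u z < cr s u (v (σ y))) ∨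
      (cr s u (v (σ y)) < cr s u z ∧ cr s u z < cr s u (v y))) :
    z + crossing s u z (v y) (v (σ y)) • u ∈ openSegment ℝ (v y) (v (σ y)) := by
  have hne : cr s u (v (σ y) - v y) ≠ 0 := by
    rw [cr_sub]; rcases h with h | h <;> intro h0 <;> linarith [h.1, h.2]
  rw [crossing_spec hne]
  set τ := cr s u (z - v y) / cr s u (v (σ y) - v y) with hτ
  have hτ' : 0 < τ ∧ τ < 1 := by
    rw [hτ, cr_sub, cr_sub]
    rcases h with h | h
    · exact ⟨div_pos (by linarith) (by linarith), (div_lt_one (by linarith [h.1, h.2])).2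
        (by linarith)⟩
    · exact ⟨div_pos_of_neg_of_neg (by linarith) (by linarith [h.1, h.2]),
        (div_lt_one_of_neg (by linarith [h.1, h.2])).2 (by linarith)⟩
  refine ⟨1 - τ, τ, by linarith, hτ'.1, by ring, ?_⟩
  rw [sub_smul, one_smul, smul_sub]; ring

-- The ray crosses the side `y` in its relative interior, which is strictly inside the side `x`.
-- Along the ray this orders the two crossing parameters, in a sense that depends on whether the
-- side `x` goes up or down.
omit [DecidableEq ι] in
theorem crossing_lt {u z : ℂ} {x y : X} (hx : c x = i) (hy : c y = i) (hne : y ≠ x)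
    (hxu : cr s u (v (σ x) - v x) ≠ 0)
    (h : (cr s u (v y) < cr s u z ∧ cr s u z < cr s u (v (σ y))) ∨
      (cr s u (v (σ y)) < cr s u z ∧ cr s u z < cr s u (v y))) :
    0 < (crossing s u z (v x) (v (σ x)) - crossing s u z (v y) (v (σ y))) *
      cr s u (v (σ x) - v x) := by
  have h1 := H.pos_of_mem_openSegment hσ hy hx hne.symm (crossing_mem h)
  rw [show z + crossing s u z (v y) (v (σ y)) • u - v x =
    (z - v x) + crossing s u z (v y) (v (σ y)) • u by ring, cr_add, cr_smul, cr_comm s _ u] at h1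
  have h2 : cr s (v (σ x) - v x) (z - v x) =
      crossing s u z (v x) (v (σ x)) * cr s u (v (σ x) - v x) := by
    rw [crossing, div_mul_cancel₀ _ hxu]
  rw [h2] at h1
  linarith

/-- The winding number of a convex polygon. -/
theorem sum_wind [Fintype X] (hc : ∀ x y, c x = c y ↔ σ.SameCycle x y) (hi : ∃ x, c x = i)
    {u z : ℂ}
    (hu : ∀ x, c x = i → cr s u (v (σ x) - v x) ≠ 0)
    (hz : ∀ x, c x = i → cr s u z ≠ cr s u (v x))
    (hz' : ∀ x, c x = i → cr s (v (σ x) - v x) (z - v x) ≠ 0) :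
    ∑ x with c x = i, wind s u z (v x) (v (σ x)) =
      if z ∈ openTile s σ c v i then 1 else 0 := by
  have hnocross : ∀ x, c x = i → ¬ (cr s u (v x) < cr s u z ∧ cr s u z < cr s u (v (σ x))) →
      ¬ (cr s u (v (σ x)) < cr s u z ∧ cr s u z < cr s u (v x)) →
      wind s u z (v x) (v (σ x)) = 0 := fun x hx h1 h2 => by
    rw [wind]
    have ha := lt_or_gt_of_ne (hz x hx)
    have hb := lt_or_gt_of_ne (hz (σ x) (by rw [hσ, hx]))
    rcases ha with ha | ha <;> rcases hb with hb | hb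
    · rw [if_pos ha, if_pos hb]; simp
    · exact absurd ⟨hb, ha⟩ h2
    · exact absurd ⟨ha, hb⟩ h1
    · rw [if_neg ha.not_gt, if_neg hb.not_gt]; simp
  by_cases hex : (∃ x, c x = i ∧ cr s u (v x) < cr s u z) ∧ ∃ x, c x = i ∧ cr s u z < cr s u (v x)
  · obtain ⟨⟨a, ha, ha'⟩, b, hb, hb'⟩ := hex
    obtain ⟨x, hx, hx1, hx2⟩ := exists_step hc (P := fun x => cr s u (v x) < cr s u z) ha'
      hb'.not_gt (ha.trans hb.symm)
    obtain ⟨y, hy, hy1, hy2⟩ := exists_step hc (P := fun x => cr s u z < cr s u (v x)) hb'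
      ha'.not_gt (hb.trans ha.symm)
    have hx := hx.trans ha
    have hy := hy.trans hb
    have hx2 := lt_of_le_of_ne (not_lt.1 hx2) (hz _ (by rw [hσ, hx]))
    have hy2 := lt_of_le_of_ne (not_lt.1 hy2) (hz _ (by rw [hσ, hy])).symm
    have hxup : 0 < cr s u (v (σ x) - v x) := by rw [cr_sub]; linarith
    have hydn : cr s u (v (σ y) - v y) < 0 := by rw [cr_sub]; linarith
    have hxy : x ≠ y := by rintro rfl; linarith
    -- A second upward crossing would come strictly before and strictly after the first one, by
    -- `crossing_lt` in both orders. The same holds for downward crossings.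
    have huniq : ∀ w, c w = i → w ≠ x → w ≠ y → wind s u z (v w) (v (σ w)) = 0 := by
      intro w hw hwx hwy
      refine hnocross w hw (fun h => ?_) fun h => ?_
      · have h1 := H.crossing_lt hσ hx hw hwx hxup.ne' (.inl h)
        have h2 := H.crossing_lt hσ hw hx hwx.symm (hu w hw) (.inl ⟨hx1, hx2⟩)
        have h3 : 0 < cr s u (v (σ w) - v w) := by rw [cr_sub]; linarith [h.1, h.2]
        have := (mul_pos_iff_of_pos_right hxup).1 h1
        have := (mul_pos_iff_of_pos_right h3).1 h2
        linarith
      · have h1 := H.crossing_lt hσ hy hw hwy hydn.ne (.inr h)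
        have h2 := H.crossing_lt hσ hw hy hwy.symm (hu w hw) (.inr ⟨hy2, hy1⟩)
        have h3 : cr s u (v (σ w) - v w) < 0 := by rw [cr_sub]; linarith [h.1, h.2]
        have := neg_of_mul_pos_left h1 hydn.le
        have := neg_of_mul_pos_left h2 h3.le
        linarith
    rw [sum_eq_add x y hxy (fun w hw hne => huniq w (by simpa using hw) hne.1 hne.2)
      (fun h => absurd (by simpa using hx) h) (fun h => absurd (by simpa using hy) h)]
    have hlt : crossing s u z (v y) (v (σ y)) < crossing s u z (v x) (v (σ x)) := by
      have := (mul_pos_iff_of_pos_right hxup).1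
        (H.crossing_lt hσ hx hy hxy.symm hxup.ne' (.inr ⟨hy2, hy1⟩))
      linarith
    have hmem : z ∈ openTile s σ c v i ↔
        crossing s u z (v y) (v (σ y)) < 0 ∧ 0 < crossing s u z (v x) (v (σ x)) := by
      constructor
      · intro h
        exact ⟨div_neg_of_pos_of_neg (h y hy) hydn, div_pos (h x hx) hxup⟩
      · rintro ⟨h1, h2⟩ w hw
        refine lt_of_le_of_ne ?_ (hz' w hw).symm
        have hX := crossing_mem (.inl ⟨hx1, hx2⟩)
        have hY := crossing_mem (.inr ⟨hy2, hy1⟩)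
        have hsub : ∀ x, c x = i → openSegment ℝ (v x) (v (σ x)) ⊆ closedTile s σ c v i :=
          fun x hx => (openSegment_subset_segment ℝ _ _).trans
            (convex_closedTile.segment_subset (H.mem_closedTile hx)
              (H.mem_closedTile (by rw [hσ, hx])))
        refine (convex_closedTile.segment_subset (hsub _ hx hX) (hsub _ hy hY)) ?_ w hw
        set a := crossing s u z (v x) (v (σ x))
        set b := crossing s u z (v y) (v (σ y))
        have hab : 0 < a - b := by linarith
        -- The weights that write `z`, at parameter `0`, as a convex combination of the crossing
        -- points at parameters `a > 0 > b`.
        have ht : (1 - a / (a - b)) * a + a / (a - b) * b = 0 := by field_simp; ring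
        refine ⟨1 - a / (a - b), a / (a - b), ?_, div_nonneg h2.le hab.le, by ring, ?_⟩
        · rw [sub_nonneg, div_le_one hab]; linarith
        · calc _ = z + ((1 - a / (a - b)) * a + a / (a - b) * b) • u := by module
            _ = z := by rw [ht, zero_smul, add_zero]
    have e1 : wind s u z (v x) (v (σ x)) =
        if 0 < crossing s u z (v x) (v (σ x)) then 1 else 0 := by
      rw [wind, if_pos hx2, if_neg hx1.not_gt]; simp
    have e2 : wind s u z (v y) (v (σ y)) =
        - if 0 < crossing s u z (v y) (v (σ y)) then 1 else 0 := by
      rw [wind, if_pos hy1, if_neg hy2.not_gt]; ring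
    have hY0 : crossing s u z (v y) (v (σ y)) ≠ 0 := div_ne_zero (hz' y hy) hydn.ne
    rw [e1, e2]
    simp only [hmem]
    rcases lt_or_gt_of_ne hY0 with h | h
    · rw [if_neg h.not_gt]; simp [h]
    · rw [if_pos h, if_pos (h.trans hlt)]; simp [h.not_gt]
  · have hnot : z ∉ openTile s σ c v i := by
      intro hmem
      have hhull := H.closedTile_subset hσ hi (openTile_subset hmem)
      apply hex
      constructor
      · by_contra! hall
        have hsub : convexHull ℝ (v '' {x | c x = i}) ⊆ {w | 0 < cr s u (w - z)} := by
          refine convexHull_min ?_ (convex_lt s u z)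
          rintro _ ⟨x, hx, rfl⟩
          simp only [Set.mem_ofPred_eq, cr_sub]
          exact sub_pos.2 (lt_of_le_of_ne (hall x hx) (hz x hx))
        have := hsub hhull
        simp at this
      · by_contra! hall
        have hsub : convexHull ℝ (v '' {x | c x = i}) ⊆ {w | 0 < cr s (-u) (w - z)} := by
          refine convexHull_min ?_ (convex_lt s (-u) z)
          rintro _ ⟨x, hx, rfl⟩
          simp only [Set.mem_ofPred_eq, cr_sub, neg_cr]
          linarith [lt_of_le_of_ne (hall x hx) (hz x hx).symm]
        have := hsub hhull
        simp at this
    rw [if_neg hnot]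
    refine sum_eq_zero fun x hx => hnocross x (by simpa using hx) (fun h => hex ?_)
      fun h => hex ?_
    · simp only [mem_filter, mem_univ, true_and] at hx
      exact ⟨⟨x, hx, h.1⟩, σ x, by rw [hσ, hx], h.2⟩
    · simp only [mem_filter, mem_univ, true_and] at hx
      exact ⟨⟨σ x, by rw [hσ, hx], h.1⟩, x, hx, h.2⟩

end ConvexCycle

end PlanePolygon


namespace PlanePolygon

open Equiv Finset CyclicSign Filter Topology
open scoped Classical

/-! ### Small perturbations of a direction -/

theorem eventually_pos_of_pos {s : ℝ} {u r h : ℂ} (hu : 0 < cr s u h) :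
    ∀ᶠ ε in 𝓝[>] (0 : ℝ), 0 < cr s (u + ε • r) h := by
  have hc : Continuous fun ε : ℝ => cr s (u + ε • r) h := by
    simp only [add_cr, smul_cr]; fun_prop
  have : Tendsto (fun ε : ℝ => cr s (u + ε • r) h) (𝓝[>] 0) (𝓝 (cr s u h)) := by
    have := (hc.tendsto 0).mono_left (nhdsWithin_le_nhds (s := Set.Ioi 0))
    simpa using this
  exact this.eventually (lt_mem_nhds hu)

theorem eventually_neg_of_neg {s : ℝ} {u r h : ℂ} (hu : cr s u h < 0) :
    ∀ᶠ ε in 𝓝[>] (0 : ℝ), cr s (u + ε • r) h < 0 := by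
  have := eventually_pos_of_pos (s := s) (u := u) (r := r) (h := -h) (by rw [cr_neg]; linarith)
  filter_upwards [this] with ε hε
  rw [cr_neg] at hε
  linarith

theorem eventually_pos_of_zero {s : ℝ} {u r h : ℂ} (hu : cr s u h = 0) (hr : 0 < cr s r h) :
    ∀ᶠ ε in 𝓝[>] (0 : ℝ), 0 < cr s (u + ε • r) h := by
  filter_upwards [self_mem_nhdsWithin] with ε hε
  rw [add_cr, smul_cr, hu, zero_add]
  exact mul_pos hε hr

theorem eventually_neg_of_zero {s : ℝ} {u r h : ℂ} (hu : cr s u h = 0) (hr : cr s r h < 0) :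
    ∀ᶠ ε in 𝓝[>] (0 : ℝ), cr s (u + ε • r) h < 0 := by
  filter_upwards [self_mem_nhdsWithin] with ε hε
  rw [add_cr, smul_cr, hu, zero_add]
  exact mul_neg_of_pos_of_neg hε hr

/-- If `h` is parallel to `u`, it is not parallel to `r`, and the perturbation decides the sign. -/
theorem eventually_ne {s : ℝ} {u r h : ℂ} (hur : cr s u r ≠ 0) (hh : h ≠ 0) :
    ∀ᶠ ε in 𝓝[>] (0 : ℝ), cr s (u + ε • r) h ≠ 0 := by
  rcases lt_trichotomy (cr s u h) 0 with h0 | h0 | h0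
  · exact (eventually_neg_of_neg h0).mono fun _ => ne_of_lt
  · have hr : cr s r h ≠ 0 := by
      intro hr
      have := cr_relation s u r h
      rw [hr, cr_comm s h u, h0] at this
      simp only [zero_smul, neg_zero, add_zero, smul_eq_zero] at this
      tauto
    rcases lt_or_gt_of_ne hr with hr | hr
    · exact (eventually_neg_of_zero h0 hr).mono fun _ => ne_of_lt
    · exact (eventually_pos_of_zero h0 hr).mono fun _ => ne_of_gt
  · exact (eventually_pos_of_pos h0).mono fun _ => ne_of_gt

theorem neg_orientation (s : ℝ) (u z : ℂ) : cr (-s) u z = - cr s u z := by simp only [cr]; ring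

theorem neg_orientation' (s : ℝ) (u z : ℂ) : cr (-s) u z = cr s (-u) z := by
  rw [neg_orientation, neg_cr]

/-! ### Convexity from the uniqueness of local maxima -/

section

variable {X ι : Type*} [DecidableEq ι] [Fintype X] {σ : Perm X} {c : X → ι} {v : X → ℂ}

/-- The test functional is constant on the side from `σ x` to `σ (σ x)`, and lower at the vertex
before it. Rotated slightly, it has a local maximum at `σ x`, which is the only one and therefore
global; in the limit no vertex is higher than the side. A further vertex `y` at equal height would
be a local maximum that persists under rotation both ways, and would have to beat `σ x` in both
cases. The predicate `Good` leaves room to avoid finitely many directions. -/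
theorem neg_of_unique_descent {s : ℝ} (hs : s ≠ 0) (hσ : ∀ x, c (σ x) = c x)
    {Good : ℂ → Prop} (hgood : ∀ u r, cr s u r ≠ 0 → ∀ᶠ ε in 𝓝[>] (0 : ℝ), Good (u + ε • r))
    (hgne : ∀ u, Good u → ∀ x, cr s u (v (σ x) - v x) ≠ 0)
    (huniq : ∀ u, Good u → ∀ x y, c x = c y → 0 < cr s u (v (σ x) - v x) →
      cr s u (v (σ (σ x)) - v (σ x)) < 0 → 0 < cr s u (v (σ y) - v y) →
      cr s u (v (σ (σ y)) - v (σ y)) < 0 → x = y)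
    (hv : ∀ x, v (σ x) ≠ v x)
    (hpar : ∀ x y, c x = c y → x ≠ y → cr s (v (σ x) - v x) (v (σ y) - v y) ≠ 0)
    {x : X} (hx : 0 < cr s (v (σ (σ x)) - v (σ x)) (v (σ x) - v x)) {y : X} (hy : c y = c x)
    (hne : y ≠ σ x) (hne' : y ≠ σ (σ x)) :
    cr s (v (σ (σ x)) - v (σ x)) (v y - v (σ x)) < 0 := by
  set h := v (σ (σ x)) - v (σ x) with hh
  have hh0 : h ≠ 0 := sub_ne_zero.2 (hv (σ x))
  obtain ⟨r, hr⟩ : ∃ r, cr s r h < 0 := by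
    have := Complex.normSq_pos.2 hh0
    rcases lt_or_gt_of_ne hs with hs | hs
    · refine ⟨-(Complex.I * h), ?_⟩
      rw [neg_cr, cr_I_mul]
      nlinarith
    · refine ⟨Complex.I * h, ?_⟩
      rw [cr_I_mul]
      nlinarith
  have hmax : ∀ u, Good u → ∀ x y, c y = c x → y ≠ σ x → 0 < cr s u (v (σ x) - v x) →
      cr s u (v (σ (σ x)) - v (σ x)) < 0 → 0 < cr s u (v (σ x) - v y) := by
    intro u hu x y hy hne h1 h2
    have := lt_of_unique_descent (σ := σ) (c := c) (r := fun x => cr s u (v (σ x) - v x))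
      (κ := fun x => cr s u (v x)) hσ (hgne u hu) (fun x => by simp only [cr_sub]; ring)
      (huniq u hu) h1 h2 hy hne
    rw [cr_sub]; linarith
  have hle : ∀ y, c y = c x → cr s h (v y - v (σ x)) ≤ 0 := by
    intro y hy
    by_cases hyx : y = σ x
    · simp [hyx]
    by_contra! hcon
    have hcon' : cr s h (v (σ x) - v y) < 0 := by
      rw [← neg_sub, cr_neg]; linarith
    obtain ⟨ε, hε1, hε2, hε3, hε4⟩ := ((hgood h r (by rw [cr_comm]; linarith)).and
      ((eventually_pos_of_pos (r := r) hx).and ((eventually_neg_of_zero (cr_self s h) hr).and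
      (eventually_neg_of_neg (r := r) hcon')))).exists
    have := hmax _ hε1 x y hy hyx hε2 hε3
    linarith
  refine lt_of_le_of_ne (hle y hy) fun h0 => ?_
  have hy' : c (σ.symm y) = c x := by
    rw [← hy]; conv_rhs => rw [← σ.apply_symm_apply y]
    rw [hσ]
  have hprev : 0 < cr s h (v (σ (σ.symm y)) - v (σ.symm y)) := by
    refine lt_of_le_of_ne ?_ (hpar (σ x) (σ.symm y) (by rw [hσ, hy']) ?_).symm
    · have := hle _ hy'
      rw [apply_symm_apply, show v y - v (σ.symm y) =
        (v y - v (σ x)) - (v (σ.symm y) - v (σ x)) by ring, cr_sub, h0]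
      linarith
    · intro h'
      exact hne' (by rw [h', apply_symm_apply])
  have hnext : cr s h (v (σ (σ (σ.symm y))) - v (σ (σ.symm y))) < 0 := by
    rw [apply_symm_apply]
    refine lt_of_le_of_ne ?_ (hpar (σ x) y (by rw [hσ, hy]) hne.symm)
    have := hle (σ y) (by rw [hσ, hy])
    rw [show v (σ y) - v y = (v (σ y) - v (σ x)) - (v y - v (σ x)) by ring, cr_sub, h0]
    linarith
  -- Used for `r` and `-r`, which gives opposite inequalities.
  have key : ∀ r, cr s r h ≠ 0 → 0 < cr s r (v y - v (σ x)) := by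
    intro r hr
    obtain ⟨ε, hε0, hε1, hε2, hε3⟩ := ((show ∀ᶠ ε in 𝓝[>] (0 : ℝ), 0 < ε from
      self_mem_nhdsWithin).and
      ((hgood h r (by rw [cr_comm]; exact neg_ne_zero.2 hr)).and
      ((eventually_pos_of_pos (r := r) hprev).and (eventually_neg_of_neg (r := r) hnext)))).exists
    have := hmax _ hε1 (σ.symm y) (σ x) (by rw [hσ, hy'])
      (by rw [apply_symm_apply]; exact hne.symm) hε2 hε3
    rw [apply_symm_apply, add_cr, smul_cr, h0, zero_add] at this
    exact (mul_pos_iff_of_pos_left hε0).1 this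
  have k1 := key r hr.ne
  have k2 := key (-r) (by rw [neg_cr]; exact neg_ne_zero.2 hr.ne)
  rw [neg_cr] at k2
  linarith

/-- A closed polygon on which every generic linear functional has a unique local maximum is
strictly convex. -/
theorem convexCycle_of_unique_descent {s : ℝ} (hs : s ≠ 0)
    (hc : ∀ x y, c x = c y ↔ σ.SameCycle x y)
    {Good : ℂ → Prop} (hgood : ∀ u r, cr s u r ≠ 0 → ∀ᶠ ε in 𝓝[>] (0 : ℝ), Good (u + ε • r))
    (hgneg : ∀ u, Good u → Good (-u))
    (hgne : ∀ u, Good u → ∀ x, cr s u (v (σ x) - v x) ≠ 0)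
    (huniq : ∀ u, Good u → ∀ x y, c x = c y → 0 < cr s u (v (σ x) - v x) →
      cr s u (v (σ (σ x)) - v (σ x)) < 0 → 0 < cr s u (v (σ y) - v y) →
      cr s u (v (σ (σ y)) - v (σ y)) < 0 → x = y)
    (hv : ∀ x, v (σ x) ≠ v x)
    (hpar : ∀ x y, c x = c y → x ≠ y → cr s (v (σ x) - v x) (v (σ y) - v y) ≠ 0) (i : ι) :
    ConvexCycle s σ c v i ∨ ConvexCycle (-s) σ c v i := by
  have hσ : ∀ x, c (σ x) = c x := class_apply hc
  have hone : ∀ x, σ x ≠ x := fun x h => hv x (by rw [h])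
  have htwo : ∀ x, σ (σ x) ≠ x := fun x h => by
    refine hpar x (σ x) (hσ x).symm (hone x).symm ?_
    rw [h, ← neg_sub, neg_cr, cr_self, neg_zero]
  have hA : ∀ {x y}, c y = c x → y ≠ σ x → y ≠ σ (σ x) →
      0 < cr s (v (σ (σ x)) - v (σ x)) (v (σ x) - v x) →
      cr s (v (σ (σ x)) - v (σ x)) (v y - v (σ x)) < 0 := fun hy hne hne' hx =>
    neg_of_unique_descent hs hσ hgood hgne huniq hv hpar hx hy hne hne'
  have hB : ∀ {x y}, c y = c x → y ≠ σ x → y ≠ σ (σ x) →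
      cr s (v (σ (σ x)) - v (σ x)) (v (σ x) - v x) < 0 →
      0 < cr s (v (σ (σ x)) - v (σ x)) (v y - v (σ x)) := fun {x y} hy hne hne' hx => by
    have := neg_of_unique_descent (s := -s) (c := c) (neg_ne_zero.2 hs) hσ (Good := Good)
      (fun u r h => hgood u r (by rw [neg_orientation] at h; exact neg_ne_zero.1 h))
      (fun u hu x => by rw [neg_orientation']; exact hgne _ (hgneg u hu) x)
      (fun u hu x y => by simp only [neg_orientation']; exact huniq _ (hgneg u hu) x y) hv
      (fun x y hxy hne => by rw [neg_orientation]; exact neg_ne_zero.2 (hpar x y hxy hne))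
      (x := x) (by rw [neg_orientation]; linarith) hy hne hne'
    rw [neg_orientation] at this
    linarith
  -- The vertices before and after a side lie on the same side of its line, so the turns at its two
  -- ends agree. Hence the direction of turning is constant around the polygon.
  have hstep : ∀ x, (0 < cr s (v (σ x) - v x) (v (σ (σ x)) - v (σ x))) =
      (0 < cr s (v (σ (σ x)) - v (σ x)) (v (σ (σ (σ x))) - v (σ (σ x)))) := fun x => by
    have e1 : ∀ y, v (σ (σ y)) - v y = (v (σ (σ y)) - v (σ y)) + (v (σ y) - v y) := fun y => by ring
    have hne1 : cr s (v (σ x) - v x) (v (σ (σ x)) - v (σ x)) ≠ 0 :=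
      hpar x (σ x) (hσ x).symm (hone x).symm
    have hy : c (σ (σ (σ x))) = c x := by rw [hσ, hσ, hσ]
    have h1 := hA hy (htwo (σ x)) (hone (σ (σ x)))
    have h2 := hB hy (htwo (σ x)) (hone (σ (σ x)))
    rw [e1 (σ x), cr_add, cr_self, add_zero] at h1 h2
    rw [cr_comm s (v (σ x) - v x)] at hne1 ⊢
    refine propext ⟨fun h => h2 (by linarith), fun h => ?_⟩
    by_contra hcon
    have := h1 (lt_of_le_of_ne (by linarith) (fun h => hne1 (by rw [← h]; simp)))
    linarith
  by_cases hi : ∃ x₀, c x₀ = i ∧ 0 < cr s (v (σ x₀) - v x₀) (v (σ (σ x₀)) - v (σ x₀))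
  · obtain ⟨x₀, hx₀, hpos⟩ := hi
    left
    refine ⟨fun x y hx hy hne hne' => ?_, fun x _ => hone x, fun x _ => htwo x⟩
    have hx' : c (σ.symm x) = c x := class_symm_apply hc x
    have h1 := eq_of_step_eq (F := fun x => 0 < cr s (v (σ x) - v x) (v (σ (σ x)) - v (σ x)))
      hc (fun x => (hstep x).symm) (x := x₀) (y := σ.symm x) (by rw [hx₀, hx', hx])
    have h2 := (eq_iff_iff.1 h1).1 hpos
    have := hB (x := σ.symm x) (y := y) (by rw [hx', hx, hy]) (by rwa [apply_symm_apply])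
      (by rwa [apply_symm_apply]) (by rw [cr_comm]; linarith)
    simpa using this
  · right
    push Not at hi
    refine ⟨fun x y hx hy hne hne' => ?_, fun x _ => hone x, fun x _ => htwo x⟩
    have hx' : c (σ.symm x) = c x := class_symm_apply hc x
    have h2 := hi (σ.symm x) (by rw [hx', hx])
    have h3 := hpar (σ.symm x) (σ (σ.symm x)) (by rw [hσ]) (hone _).symm
    have := hA (x := σ.symm x) (y := y) (by rw [hx', hx, hy]) (by rwa [apply_symm_apply])
      (by rwa [apply_symm_apply]) (by
        rw [cr_comm]
        exact lt_of_le_of_ne (by linarith) (fun h => h3 (by linarith)))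
    rw [neg_orientation]
    simpa using this

end

/-! ### Convex polygons with vertices in cyclic order -/

section

variable {m : ℕ}

theorem addRight_sameCycle (x y : Fin (m + 1)) : (Equiv.addRight (1 : Fin (m + 1))).SameCycle x y := by
  have h : ∀ y : Fin (m + 1), (Equiv.addRight (1 : Fin (m + 1))).SameCycle 0 y := by
    intro y
    induction y using Fin.induction with
    | zero => exact Perm.SameCycle.refl _ _
    | succ i ih =>
      refine ih.trans ⟨1, ?_⟩
      simp
  exact (h x).symm.trans (h y)

/-- A polygon with vertices `p 0, ..., p m`, seen as a cycle. -/
abbrev IsConvexCycle (s : ℝ) (p : Fin (m + 1) → ℂ) : Prop :=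
  ConvexCycle s (Equiv.addRight (1 : Fin (m + 1))) (fun _ => ()) p ()

theorem isConvexCycle_of_lt (hm : 3 ≤ m + 1) {s : ℝ} {p : Fin (m + 1) → ℂ}
    (h : ∀ i j k, i < j → j < k → 0 < cr s (p j - p i) (p k - p i)) : IsConvexCycle s p := by
  have hrot : ∀ a b d : ℂ, cr s (b - a) (d - a) = cr s (d - b) (a - b) := fun a b d => by
    simp only [cr, Complex.sub_re, Complex.sub_im]; ring
  refine ⟨fun x y _ _ hyx hyx' => ?_, fun x _ hx => ?_, fun x _ hx => ?_⟩
  · simp only [Equiv.coe_addRight] at *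
    rcases eq_or_ne x (Fin.last m) with rfl | hlast
    · rw [Fin.last_add_one] at *
      rw [hrot]
      exact h 0 y (Fin.last m) (Fin.pos_of_ne_zero hyx') (lt_of_le_of_ne (Fin.le_last y) hyx)
    · have hval : (x + 1).val = x.val + 1 := Fin.val_add_one_of_lt (lt_of_le_of_ne (Fin.le_last x) hlast)
      rcases lt_or_gt_of_ne hyx with h1 | h1
      · rw [← hrot]
        exact h y x (x + 1) h1 (by rw [Fin.lt_def, hval]; omega)
      · refine h x (x + 1) y (by rw [Fin.lt_def, hval]; omega) ?_
        rw [Fin.lt_def] at *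
        have : y.val ≠ (x + 1).val := fun h => hyx' (Fin.ext h)
        omega
  · simp only [Equiv.coe_addRight, add_eq_left] at hx
    have := congrArg Fin.val hx
    rw [Fin.val_one', Nat.mod_eq_of_lt (by omega)] at this
    simp at this
  · simp only [Equiv.coe_addRight, add_assoc, add_eq_left] at hx
    have := congrArg Fin.val hx
    rw [Fin.val_add, Fin.val_one', Nat.mod_eq_of_lt (a := 1) (by omega), Nat.mod_eq_of_lt (by omega)]
      at this
    simp at this

theorem _root_.IsConvexPolygon.exists_orientation {p : Fin (m + 1) → ℂ} (hp : IsConvexPolygon p) :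
    ∃ s : ℝ, (s = 1 ∨ s = -1) ∧ IsConvexCycle s p := by
  have hcr : ∀ a b : ℂ, (starRingEnd ℂ a * b).im = cr 1 a b := fun a b => by
    simp [cr]; ring
  rcases hp.2 with h | h
  · exact ⟨1, .inl rfl, isConvexCycle_of_lt hp.1 fun i j k hij hjk => by
      rw [← hcr]; exact h i j k hij hjk⟩
  · refine ⟨-1, .inr rfl, isConvexCycle_of_lt hp.1 fun i j k hij hjk => ?_⟩
    have := h i j k hij hjk
    rw [hcr] at this
    rw [neg_orientation]
    linarith

variable {s : ℝ} {p : Fin (m + 1) → ℂ}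

/-- All but at most two consecutive pairs of edges of a convex polygon agree in sign. -/
theorem IsConvexCycle.le_sum_flats (hp : IsConvexCycle s p) {u : ℂ}
    (hu : ∀ k, cr s u (p (k + 1) - p k) ≠ 0) :
    m + 1 ≤ 2 + ∑ k, #(flats (Equiv.addRight (1 : Fin (m + 1))) (fun k => k + 1)
      (fun k => cr s u (p (k + 1) - p k)) k) := by
  have h := card_eq_descents_add (σ := Equiv.addRight (1 : Fin (m + 1))) (c := fun _ => ())
    (r := fun k => cr s u (p (k + 1) - p k)) hu (fun k => k + 1)
  rw [Fintype.card_fin] at h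
  -- Of two different local maxima each would be strictly higher than the other. Applied to `-u`
  -- this also treats the minima.
  have hmax : ∀ w : ℂ, ∀ x y : Fin (m + 1), 0 < cr s w (p (x + 1) - p x) →
      cr s w (p (x + 1 + 1) - p (x + 1)) < 0 → 0 < cr s w (p (y + 1) - p y) →
      cr s w (p (y + 1 + 1) - p (y + 1)) < 0 → x = y := by
    intro w x y h1 h2 h3 h4
    by_contra hne
    have hne' : x + 1 ≠ y + 1 := fun h => hne (add_right_cancel h)
    have a1 := ConvexCycle.lt_of_local_max hp (fun _ => rfl) (x := x) (y := y + 1) rfl rfl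
      (by simpa using hne'.symm) w h1 h2
    have a2 := ConvexCycle.lt_of_local_max hp (fun _ => rfl) (x := y) (y := x + 1) rfl rfl
      (by simpa using hne') w h3 h4
    simp only [Equiv.coe_addRight] at a1 a2
    linarith
  have hd : #(descents (Equiv.addRight (1 : Fin (m + 1))) (fun _ => ())
      (fun k => cr s u (p (k + 1) - p k)) ()) ≤ 1 := by
    refine card_le_one.2 fun x hx y hy => ?_
    simp only [descents, mem_filter, mem_univ, true_and] at hx hy
    exact hmax u x y hx.1 hx.2 hy.1 hy.2
  have ha : #(ascents (Equiv.addRight (1 : Fin (m + 1))) (fun _ => ())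
      (fun k => cr s u (p (k + 1) - p k)) ()) ≤ 1 := by
    refine card_le_one.2 fun x hx y hy => ?_
    simp only [ascents, mem_filter, mem_univ, true_and, Equiv.coe_addRight] at hx hy
    exact hmax (-u) x y (by rw [neg_cr]; linarith [hx.1]) (by rw [neg_cr]; linarith [hx.2])
      (by rw [neg_cr]; linarith [hy.1]) (by rw [neg_cr]; linarith [hy.2])
  simp only [univ_unique, sum_singleton] at h
  have : (default : Unit) = () := rfl
  rw [this] at h
  omega

end

end PlanePolygon


theorem CyclicSign.mem_flats {X V : Type*} [Fintype X] {σ : Equiv.Perm X} {hd : X → V} {r : X → ℝ}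
    {v : V} {x : X} : x ∈ CyclicSign.flats σ hd r v ↔ hd x = v ∧ 0 < r x * r (σ x) := by
  simp only [CyclicSign.flats, Finset.mem_filter, Finset.mem_univ, true_and]

/-! ### Realized flows and the convexity of the white tiles -/

namespace PlaneBipartiteGraph

open Equiv Finset BipartiteMap CyclicSign Matrix PlanePolygon Filter Topology
open scoped Classical

variable {n : ℕ}

/-- The outer face meets each white vertex at most once. -/
theorem exit_white_injective {G : PlaneBipartiteGraph n} {e₀ : G.edges} {ν : G.edges → ℝ}
    {K : Matrix (Fin n) (Fin n) ℝ} (hK : G.IsKasteleyn e₀ ν K) (h1 : IsNonDegenerate 1 K)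
    {i j : Fin (G.halfDegree e₀)} (h : (G.exitEdge e₀ i).1.2 = (G.exitEdge e₀ j).1.2) : i = j := by
  have h2 := eq_of_leftFace_eq hK h1 (e₁ := G.rotW (G.exitEdge e₀ i))
    (e₂ := G.rotW (G.exitEdge e₀ j)) (by rw [rotW_snd, rotW_snd, h])
    (by rw [rotW_exitEdge, rotW_exitEdge, leftFace_outerEdge, leftFace_outerEdge])
  exact exitEdge_injective (G.rotW.injective h2)

/-- The data of a realized Kasteleyn flow over a convex polygon in general position. -/
structure Realization (G : PlaneBipartiteGraph n) (e₀ : G.edges) (ν : G.edges → ℝ)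
    (K : Matrix (Fin n) (Fin n) ℝ) (f : Fin n → ℝ) (g : Fin n → ℂ)
    (p : Fin (G.halfDegree e₀ + 1) → ℂ) (ψ : G.DualVertex e₀ → ℂ) (s : ℝ) : Prop where
  kasteleyn : G.IsKasteleyn e₀ ν K
  pos : ∀ e, 0 < ν e
  nondeg : IsNonDegenerate 1 K
  two_le : 2 ≤ n
  f_ne : ∀ w, f w ≠ 0
  mulVec_f : K *ᵥ f = Pi.single e₀.1.1 1
  grad : ∀ e : G.edges, ψ (G.left e₀ e) - ψ (G.right e₀ e) = (K e.1.1 e.1.2 * f e.1.2) • g e.1.1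
  outer : ∀ k, ψ (Sum.inr k) = p k
  polygon : IsConvexCycle s p
  orientation : s = 1 ∨ s = -1
  black_black : ∀ b b', b ≠ b' → cr s (g b) (g b') ≠ 0
  black_outer : ∀ b (i : Fin (G.halfDegree e₀)), cr s (g b) (p i.succ - p i.castSucc) ≠ 0

/-- The signed length of the image of a dual edge, in units of `g`. -/
def len {G : PlaneBipartiteGraph n} (K : Matrix (Fin n) (Fin n) ℝ) (f : Fin n → ℝ) (e : G.edges) : ℝ :=
  K e.1.1 e.1.2 * f e.1.2

namespace Realization

variable {G : PlaneBipartiteGraph n} {e₀ : G.edges} {ν : G.edges → ℝ}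
  {K : Matrix (Fin n) (Fin n) ℝ} {f : Fin n → ℝ} {g : Fin n → ℂ}
  {p : Fin (G.halfDegree e₀ + 1) → ℂ} {ψ : G.DualVertex e₀ → ℂ} {s : ℝ}

variable (R : Realization G e₀ ν K f g p ψ s)
include R

theorem s_ne : s ≠ 0 := by rcases R.orientation with h | h <;> rw [h] <;> norm_num

theorem len_ne (e : G.edges) : len K f e ≠ 0 :=
  mul_ne_zero (R.kasteleyn.ne_zero R.pos e) (R.f_ne _)

theorem count : BlackCount e₀ (len K f) := blackCount R.kasteleyn R.pos R.f_ne R.mulVec_f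

theorem g_ne (b : Fin n) : g b ≠ 0 := fun h =>
  R.black_outer b ⟨0, (halfDegree_pos e₀)⟩ (by rw [h, zero_cr])

theorem outer_ne (i : Fin (G.halfDegree e₀)) : p i.succ - p i.castSucc ≠ 0 := fun h =>
  R.black_outer e₀.1.1 i (by rw [h, cr_zero])

-- The differences telescope around the extended cycle, so only the jump across the dotted line at
-- `b₀` remains.
omit R in
theorem _root_.PlaneBipartiteGraph.sum_black_eq {M : Type*} [AddCommGroup M]
    (F : G.DualVertex e₀ → M) (b : Fin n) :
    ∑ e : G.edges with e.1.1 = b, (F (G.left e₀ e) - F (G.right e₀ e)) =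
      if b = e₀.1.1 then F (Sum.inr (Fin.last _)) - F (Sum.inr 0) else 0 := by
  have h := sum_class_sub (σ := G.blackPerm e₀) (c := G.black e₀) black_blackPerm b
    (fun x => F (G.blackTail e₀ x))
  simp only [blackTail_blackPerm] at h
  rw [sum_filter, Fintype.sum_option] at h
  rw [sum_filter]
  have h2 : (if G.black e₀ none = b then F (G.blackHead e₀ none) - F (G.blackTail e₀ none) else 0) =
      - if b = e₀.1.1 then F (Sum.inr (Fin.last _)) - F (Sum.inr 0) else 0 := by
    change (if e₀.1.1 = b then F (Sum.inr 0) - F (Sum.inr (Fin.last _)) else 0) = _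
    by_cases hb : b = e₀.1.1
    · rw [if_pos hb, if_pos hb.symm, neg_sub]
    · rw [if_neg hb, if_neg (fun h => hb h.symm), neg_zero]
  rw [h2] at h
  exact (neg_add_eq_zero.1 h).symm

omit R in
theorem _root_.PlaneBipartiteGraph.sum_white_eq {M : Type*} [AddCommGroup M]
    (F : G.DualVertex e₀ → M) (w : Fin n) :
    ∑ e : G.edges with e.1.2 = w, (F (G.left e₀ e) - F (G.right e₀ e)) =
      ∑ i : Fin (G.halfDegree e₀), if (G.exitEdge e₀ i).1.2 = w then
        F (Sum.inr i.succ) - F (Sum.inr i.castSucc) else 0 := by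
  have h := sum_class_sub (σ := G.whitePerm e₀) (c := G.white e₀) white_whitePerm w
    (fun x => F (G.whiteTail e₀ x))
  simp only [whiteTail_whitePerm] at h
  rw [sum_filter, Fintype.sum_sum_type] at h
  have h1 : ∑ e : G.edges, (if G.white e₀ (Sum.inl e) = w then
      F (G.whiteHead e₀ (Sum.inl e)) - F (G.whiteTail e₀ (Sum.inl e)) else 0) =
      -∑ e : G.edges with e.1.2 = w, (F (G.left e₀ e) - F (G.right e₀ e)) := by
    rw [sum_filter, ← sum_neg_distrib]
    refine sum_congr rfl fun e _ => ?_
    change (if e.1.2 = w then F (G.right e₀ e) - F (G.left e₀ e) else 0) = _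
    split_ifs <;> simp
  rw [h1] at h
  exact neg_add_eq_zero.1 h

/-- Around `b₀` the increments of `ψ` add up to `p m - p 0`, and the lengths add up to `1`. -/
theorem g_self : g e₀.1.1 = p (Fin.last _) - p 0 := by
  have h := sum_black_eq (G := G) (e₀ := e₀) ψ e₀.1.1
  rw [if_pos rfl, R.outer, R.outer] at h
  have h1 : ∑ e : G.edges with e.1.1 = e₀.1.1, (ψ (G.left e₀ e) - ψ (G.right e₀ e)) =
      (∑ e : G.edges with e.1.1 = e₀.1.1, len K f e) • g e₀.1.1 := by
    rw [sum_smul]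
    refine sum_congr rfl fun e he => ?_
    rw [R.grad, (by simpa using he : e.1.1 = e₀.1.1)]
    simp only [len]
    rw [(by simpa using he : e.1.1 = e₀.1.1)]
  have h2 := G.sum_fst e₀.1.1 (fun b w => K b w * f w)
    fun w hw => by rw [R.kasteleyn.eq_zero _ w hw, zero_mul]
  have h3 : ∑ w, K e₀.1.1 w * f w = 1 := by
    have := congrFun R.mulVec_f e₀.1.1
    rwa [Pi.single_eq_same] at this
  have h4 : ∑ e : G.edges with e.1.1 = e₀.1.1, len K f e = 1 := h2.trans h3
  rw [h1, h4, one_smul] at h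
  exact h

theorem exit_white_injective {i j : Fin (G.halfDegree e₀)}
    (h : (G.exitEdge e₀ i).1.2 = (G.exitEdge e₀ j).1.2) : i = j :=
  PlaneBipartiteGraph.exit_white_injective R.kasteleyn R.nondeg h

/-! ### The tiles of the white vertices -/

omit R in
variable (ψ) in
/-- The corner of the tile of a white vertex before an edge or boundary element. -/
noncomputable def corner : G.edges ⊕ Fin (G.halfDegree e₀) → ℂ := fun x => ψ (G.whiteTail e₀ x)

omit R in
variable (ψ) in
/-- The side of the tile of a white vertex along an edge or boundary element. -/
noncomputable def side (x : G.edges ⊕ Fin (G.halfDegree e₀)) : ℂ :=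
  corner ψ (G.whitePerm e₀ x) - corner ψ x

theorem side_inl (e : G.edges) : side ψ (Sum.inl e) = (-len K f e) • g e.1.1 := by
  have := R.grad e
  rw [side, corner, corner, whiteTail_whitePerm]
  change ψ (G.right e₀ e) - ψ (G.left e₀ e) = _
  rw [neg_smul, len, ← this, neg_sub]

theorem side_inr (i : Fin (G.halfDegree e₀)) : side ψ (Sum.inr i) = p i.succ - p i.castSucc := by
  rw [side, corner, corner, whiteTail_whitePerm]
  change ψ (Sum.inr i.succ) - ψ (Sum.inr i.castSucc) = _
  rw [R.outer, R.outer]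

theorem side_ne (x : G.edges ⊕ Fin (G.halfDegree e₀)) : side ψ x ≠ 0 := by
  rcases x with e | i
  · rw [R.side_inl]; exact smul_ne_zero (neg_ne_zero.2 (R.len_ne e)) (R.g_ne _)
  · rw [R.side_inr]; exact R.outer_ne i

/-- General position suffices here because two edges at one white vertex have different black ends,
and a white vertex carries at most one outer side. -/
theorem side_independent {x y : G.edges ⊕ Fin (G.halfDegree e₀)}
    (hxy : G.white e₀ x = G.white e₀ y) (hne : x ≠ y) : cr s (side ψ x) (side ψ y) ≠ 0 := by
  have hl := R.len_ne
  rcases x with e | i <;> rcases y with e' | j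
  · rw [R.side_inl, R.side_inl, cr_smul, smul_cr]
    refine mul_ne_zero (neg_ne_zero.2 (hl _)) (mul_ne_zero (neg_ne_zero.2 (hl _))
      (R.black_black _ _ fun h => hne ?_))
    exact congrArg Sum.inl (Subtype.ext (Prod.ext h hxy))
  · rw [R.side_inl, R.side_inr, smul_cr]
    exact mul_ne_zero (neg_ne_zero.2 (hl _)) (R.black_outer _ _)
  · rw [R.side_inl, R.side_inr, cr_comm, smul_cr]
    exact neg_ne_zero.2 (mul_ne_zero (neg_ne_zero.2 (hl _)) (R.black_outer _ _))
  · exact absurd (congrArg Sum.inr (R.exit_white_injective hxy)) hne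

omit R in
variable (g p s) in
/-- A direction in general position. -/
def Generic (u : ℂ) : Prop :=
  (∀ b, cr s u (g b) ≠ 0) ∧ ∀ k, cr s u (p (k + 1) - p k) ≠ 0

theorem polygon_side_ne (k : Fin (G.halfDegree e₀ + 1)) : p (k + 1) - p k ≠ 0 := fun h => by
  have := R.polygon.turn (fun _ => rfl) (x := k) rfl
  simp only [Equiv.coe_addRight, h, zero_cr] at this
  exact lt_irrefl _ this

theorem eventually_generic {u r : ℂ} (h : cr s u r ≠ 0) :
    ∀ᶠ ε in 𝓝[>] (0 : ℝ), Generic g p s (u + ε • r) := by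
  simp only [Generic, eventually_and, eventually_all]
  exact ⟨fun b => eventually_ne h (R.g_ne b), fun k => eventually_ne h (R.polygon_side_ne k)⟩

theorem exists_generic : ∃ u, Generic g p s u :=
  (R.eventually_generic (u := 1) (r := Complex.I) (by simp [cr, R.s_ne])).exists.imp' _
    fun _ h => h

omit R in
theorem Generic.neg {u : ℂ} (h : Generic g p s u) : Generic g p s (-u) :=
  ⟨fun b => by rw [neg_cr]; exact neg_ne_zero.2 (h.1 b),
    fun k => by rw [neg_cr]; exact neg_ne_zero.2 (h.2 k)⟩

theorem Generic.side_ne {u : ℂ} (h : Generic g p s u) (x : G.edges ⊕ Fin (G.halfDegree e₀)) :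
    cr s u (side ψ x) ≠ 0 := by
  rcases x with e | i
  · rw [R.side_inl, cr_smul]; exact mul_ne_zero (neg_ne_zero.2 (R.len_ne e)) (h.1 _)
  · have := h.2 i.castSucc
    rwa [Fin.coeSucc_eq_succ, ← R.side_inr] at this

/-- The count of sign changes around the white vertices, for a generic linear functional. -/
theorem white_count {u : ℂ} (hu : Generic g p s u) :
    (∀ x y, G.white e₀ x = G.white e₀ y → 0 < cr s u (side ψ x) →
      cr s u (side ψ (G.whitePerm e₀ x)) < 0 → 0 < cr s u (side ψ y) →
      cr s u (side ψ (G.whitePerm e₀ y)) < 0 → x = y) ∧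
    (∀ x y, G.whiteHead e₀ x = G.whiteHead e₀ y →
      0 < cr s u (side ψ x) * cr s u (side ψ (G.whitePerm e₀ x)) →
      0 < cr s u (side ψ y) * cr s u (side ψ (G.whitePerm e₀ y)) → x = y) ∧
    ∀ F : {F : G.Face // F ≠ G.leftFace e₀}, ∃ x, G.whiteHead e₀ x = Sum.inl F ∧
      0 < cr s u (side ψ x) * cr s u (side ψ (G.whitePerm e₀ x)) := by
  set S : G.edges ⊕ Fin (G.halfDegree e₀) → ℝ := fun x => cr s u (side ψ x) with hS
  have hS0 : ∀ x, S x ≠ 0 := fun x => Generic.side_ne R hu x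
  have hSl : ∀ e, S (Sum.inl e) = -cr s u (g e.1.1) * (K e.1.1 e.1.2 * f e.1.2) := fun e => by
    simp only [hS]; rw [R.side_inl, cr_smul, len]; ring
  have hSl' : ∀ e, S (Sum.inl e) = -(len K f e * cr s u (g e.1.1)) := fun e => by
    rw [hSl, len]; ring
  have hSr : ∀ i : Fin (G.halfDegree e₀), S (Sum.inr i) =
      cr s u (p (i.castSucc + 1) - p i.castSucc) := fun i => by
    simp only [hS]; rw [R.side_inr, Fin.coeSucc_eq_succ]
  have hC := R.count
  have hint : ∀ F : {F : G.Face // F ≠ G.leftFace e₀}, ∃ x, G.whiteHead e₀ x = Sum.inl F ∧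
      0 < S x * S (G.whitePerm e₀ x) := fun F => by
    obtain ⟨a, ha⟩ := card_pos.1 (R.kasteleyn.odd_white R.pos
      (α := fun b => -cr s u (g b)) (fun b => neg_ne_zero.2 (hu.1 b)) R.f_ne
      (ρ := fun e => S (Sum.inl e)) hSl F.2).pos
    simp only [mem_filter, mem_univ, true_and] at ha
    have hne : a ≠ e₀ := fun h => F.2 (by rw [← ha.1, h])
    refine ⟨Sum.inl (G.rotB a), ?_, ?_⟩
    · change G.right e₀ (G.rotB a) = _
      rw [right_rotB hne, left_interior (ha.1 ▸ F.2)]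
      exact congrArg Sum.inl (Subtype.ext ha.1)
    · rw [whitePerm_inl]
      · exact ha.2
      · rintro ⟨i, hi⟩
        refine F.2 ?_
        rw [← ha.1, ← G.rotB.injective hi, leftFace_outerEdge]
  -- An outer piece is charged a flat corner exactly when the outer polygon is flat there for `u`.
  -- At least `m - 1` of the `m + 1` polygon corners are flat, so the bounds add up to at least `2n
  -- + (F - 1) + (m - 1) = E + m`, which is the number of all white corners.
  let low : G.DualVertex e₀ → ℕ := Sum.elim (fun _ => 1) fun k =>
    #(flats (Equiv.addRight (1 : Fin (G.halfDegree e₀ + 1))) (fun k => k + 1)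
      (fun k => cr s u (p (k + 1) - p k)) k)
  have hlow1 : ∀ v, low v ≤ 1 := by
    rintro (F | k)
    · exact le_rfl
    · refine card_le_one.2 fun x hx y hy => ?_
      rw [mem_flats] at hx hy
      exact add_right_cancel (hx.1.trans hy.1.symm)
  have hlast : cr s u (p (Fin.last _ + 1) - p (Fin.last _)) = -cr s u (g e₀.1.1) := by
    rw [R.g_self, Fin.last_add_one, ← cr_neg, neg_sub]
  have hlow : ∀ v, low v ≤ #(flats (G.whitePerm e₀) (G.whiteHead e₀) S v) := by
    rintro (F | k)
    · obtain ⟨x, hx⟩ := hint F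
      exact card_pos.2 ⟨x, mem_flats.2 hx⟩
    · rcases Nat.eq_zero_or_pos (low (Sum.inr k)) with h0 | hpos
      · exact h0 ▸ Nat.zero_le _
      refine (hlow1 _).trans (card_pos.2 ?_)
      obtain ⟨x, hx⟩ := card_pos.1 hpos
      obtain ⟨rfl, hx'⟩ := mem_flats.1 hx
      replace hx : 0 < cr s u (p (x + 1) - p x) * cr s u (p (x + 1 + 1) - p (x + 1)) := hx'
      refine Exists.imp (fun _ h => mem_flats.2 h) ?_
      induction x using Fin.lastCases with
      | last =>
        refine ⟨Sum.inl (G.exitEdge e₀ ⟨0, (halfDegree_pos e₀)⟩), ?_, ?_⟩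
        · change G.right e₀ _ = _
          rw [right_exitEdge, Fin.last_add_one]; rfl
        -- The closing side of the polygon is `-g b₀`, and the side of the tile at the exit edge is
        -- a positive multiple of it. So the corner of this tile at `p 0` is as flat as that of the
        -- polygon.
        · have hb : (G.exitEdge e₀ ⟨0, (halfDegree_pos e₀)⟩).1.1 = e₀.1.1 := rotB_fst e₀
          rw [whitePerm_exit, hSl', hSr, hb]
          rw [hlast, Fin.last_add_one] at hx
          have h1 := hC.pos_rotB
          have h2 := mul_pos h1 hx
          have h3 : len K f (G.exitEdge e₀ ⟨0, (halfDegree_pos e₀)⟩) = len K f (G.rotB e₀) := rfl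
          have h4 : (⟨0, (halfDegree_pos e₀)⟩ : Fin (G.halfDegree e₀)).castSucc = 0 := rfl
          rw [h3, h4]
          linarith
      | cast i =>
        by_cases hi : i.val + 1 = G.halfDegree e₀
        · refine ⟨Sum.inr i, ?_, ?_⟩
          · rw [Fin.coeSucc_eq_succ]; rfl
          · have hk : i.castSucc + 1 = Fin.last _ := by
              rw [Fin.coeSucc_eq_succ]; exact Fin.ext hi
            rw [whitePerm_inr, hi, outerEdge_halfDegree, hSl', hSr]
            rw [hk, hlast] at hx
            rw [hk]
            have := mul_pos hC.pos_self hx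
            linarith
        · have hi' : i.val + 1 < G.halfDegree e₀ := by omega
          have hk : i.castSucc + 1 = (⟨i.val + 1, hi'⟩ : Fin (G.halfDegree e₀)).castSucc := by
            rw [Fin.coeSucc_eq_succ]; rfl
          have hne : G.outerEdge e₀ (i.val + 1) ≠ e₀ := fun h => by
            have := facePerm_pow_injOn e₀ hi' (halfDegree_pos e₀) h
            omega
          have hneg := hC.not_flat _ hne (leftFace_outerEdge _)
          have ha := hSl' (G.outerEdge e₀ (i.val + 1))
          have hb := hSl' (G.exitEdge e₀ ⟨i.val + 1, hi'⟩)
          have hb' : (G.exitEdge e₀ ⟨i.val + 1, hi'⟩).1.1 = (G.outerEdge e₀ (i.val + 1)).1.1 :=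
            rotB_fst _
          have hl : len K f (G.exitEdge e₀ ⟨i.val + 1, hi'⟩) =
            len K f (G.rotB (G.outerEdge e₀ (i.val + 1))) := rfl
          rw [hb', hl] at hb
          -- The values around this piece are `q, A, B, q'` in order. Here `A` and `B` belong to
          -- consecutive edges at one black vertex and have opposite signs, as this black corner is
          -- not flat. Since `q` and `q'` agree in sign, so do `q, A` or `B, q'`.
          by_cases hcase : 0 < S (Sum.inr i) * S (Sum.inl (G.outerEdge e₀ (i.val + 1)))
          · refine ⟨Sum.inr i, ?_, ?_⟩
            · rw [Fin.coeSucc_eq_succ]; rfl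
            · rwa [whitePerm_inr]
          · refine ⟨Sum.inl (G.exitEdge e₀ ⟨i.val + 1, hi'⟩), ?_, ?_⟩
            · rw [hk]; exact right_exitEdge _
            · rw [whitePerm_exit, hSr, ← hk]
              have hcase' := lt_of_le_of_ne (not_lt.1 hcase)
                (mul_ne_zero (hS0 _) (hS0 _))
              rw [hSr] at hcase'
              have h1 := mul_pos_of_neg_of_neg hcase' (neg_neg_of_pos hx)
              have hg := sq_nonneg (cr s u (g (G.outerEdge e₀ (i.val + 1)).1.1))
              have hg2 : 0 < cr s u (g (G.outerEdge e₀ (i.val + 1)).1.1) ^ 2 := by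
                have := hu.1 (G.outerEdge e₀ (i.val + 1)).1.1
                positivity
              have hab : S (Sum.inl (G.outerEdge e₀ (i.val + 1))) *
                  S (Sum.inl (G.exitEdge e₀ ⟨i.val + 1, hi'⟩)) < 0 := by
                rw [ha, hb]; nlinarith
              set A := S (Sum.inl (G.outerEdge e₀ (i.val + 1)))
              set B := S (Sum.inl (G.exitEdge e₀ ⟨i.val + 1, hi'⟩))
              set q := cr s u (p (i.castSucc + 1) - p i.castSucc)
              set q' := cr s u (p (i.castSucc + 1 + 1) - p (i.castSucc + 1))
              have e : (q * A) * (A * B) * (q * q') = (B * q') * (q * A) ^ 2 := by ring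
              have h5 : 0 < (q * A) * (A * B) * (q * q') :=
                mul_pos (mul_pos_of_neg_of_neg hcase' hab) hx
              rw [e] at h5
              exact (mul_pos_iff_of_pos_right (by have := hcase'.ne; positivity)).1 h5
  obtain ⟨h1, -, h3⟩ := unique_of_card_le (σ := G.whitePerm e₀) (c := G.white e₀) white_eq_iff
    (fun w => by obtain ⟨e, he⟩ := G.exists_edge_snd w; exact ⟨Sum.inl e, he⟩) hS0
    (fun w => by
      have := sum_class_sub (σ := G.whitePerm e₀) (c := G.white e₀) white_whitePerm w (corner ψ)
      rw [← cr_sum, show ∑ x with G.white e₀ x = w, side ψ x = 0 from this, cr_zero])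
    (G.whiteHead e₀) low hlow
    (by
      rw [sum_dualVertex]
      have hsum := IsConvexCycle.le_sum_flats R.polygon hu.2
      simp only [low, Sum.elim_inl, Sum.elim_inr, sum_const, card_univ, smul_eq_mul, mul_one,
        Fintype.card_sum, Fintype.card_fin] at hsum ⊢
      have := G.card_edges
      have := card_interior_faces (e₀ := e₀)
      omega)
  refine ⟨h1, fun x y hxy hx hy => ?_, hint⟩
  exact card_le_one.1 ((h3 (G.whiteHead e₀ x)).le.trans (hlow1 _)) x
    (mem_flats.2 ⟨rfl, hx⟩) y
    (mem_flats.2 ⟨hxy.symm, hy⟩)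

/-- The count gives a unique local maximum for every generic functional. The orientation is still
open, since nothing so far compares different tiles. -/
theorem convex_or (w : Fin n) :
    ConvexCycle s (G.whitePerm e₀) (G.white e₀) (corner ψ) w ∨
      ConvexCycle (-s) (G.whitePerm e₀) (G.white e₀) (corner ψ) w :=
  convexCycle_of_unique_descent R.s_ne white_eq_iff (Good := Generic g p s)
    (fun _ _ h => R.eventually_generic h) (fun _ h => h.neg)
    (fun _ h x => Generic.side_ne R h x) (fun _ h => (R.white_count h).1)
    (fun x => sub_ne_zero.1 (R.side_ne x)) (fun _ _ hxy hne => R.side_independent hxy hne) w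

/-- The two tiles have corners at the common dual vertex `left e`, each with one side along `g b`.
If they turned in opposite ways, both corners would be flat for a direction close to `g b`, suitably
chosen on one side of it. But a dual vertex has at most one flat white corner. -/
theorem turn_mul_pos {e : G.edges} (he : e ≠ e₀) :
    0 < cr s (side ψ ((G.whitePerm e₀).symm (Sum.inl e))) (side ψ (Sum.inl e)) *
      cr s (side ψ (Sum.inl (G.rotB e))) (side ψ (G.whitePerm e₀ (Sum.inl (G.rotB e)))) := by
  have hσ := white_whitePerm (G := G.toBipartiteMap) (e₀ := e₀)
  set x₁ := (G.whitePerm e₀).symm (Sum.inl e) with hx₁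
  have hx₁' : G.whitePerm e₀ x₁ = Sum.inl e := apply_symm_apply _ _
  set x₂ : G.edges ⊕ Fin (G.halfDegree e₀) := Sum.inl (G.rotB e) with hx₂
  have hrot := rotB_ne R.kasteleyn R.nondeg R.two_le
  have hself : ∀ x, G.whitePerm e₀ x ≠ x := fun x h => R.side_ne x (by rw [side, h, sub_self])
  have hT1 : cr s (side ψ x₁) (side ψ (Sum.inl e)) ≠ 0 :=
    R.side_independent (by rw [← hx₁', hσ]) (by rw [← hx₁']; exact (hself _).symm)
  have hT2 : cr s (side ψ x₂) (side ψ (G.whitePerm e₀ x₂)) ≠ 0 :=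
    R.side_independent (hσ _).symm (hself _).symm
  have hhead : G.whiteHead e₀ x₁ = G.whiteHead e₀ x₂ := by
    rw [← whiteTail_whitePerm, hx₁']
    exact (right_rotB he).symm
  have hne : x₁ ≠ x₂ := fun h => by
    have h1 := hσ x₂
    rw [← h, hx₁', h] at h1
    have h2 : e = G.rotB e := Subtype.ext (Prod.ext (rotB_fst e).symm h1)
    exact hrot e h2.symm
  by_contra hcon
  have hneg := lt_of_le_of_ne (not_lt.1 hcon) (mul_ne_zero hT1 hT2)
  set b := e.1.1
  have hg : side ψ (Sum.inl e) = (-len K f e) • g b := R.side_inl e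
  have hg' : side ψ x₂ = (-len K f (G.rotB e)) • g b := by
    rw [hx₂, R.side_inl, rotB_fst]
  have hl := R.len_ne e
  have hl' := R.len_ne (G.rotB e)
  set r := len K f e
  set r' := len K f (G.rotB e)
  set c₁ := cr s (g b) (side ψ x₁) with hc₁
  set c₂ := cr s (g b) (side ψ (G.whitePerm e₀ x₂)) with hc₂
  have e1 : cr s (side ψ x₁) (side ψ (Sum.inl e)) = r * c₁ := by
    rw [hg, cr_smul, cr_comm]; ring
  have e2 : cr s (side ψ x₂) (side ψ (G.whitePerm e₀ x₂)) = -r' * c₂ := by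
    rw [hg', smul_cr]
  rw [e1] at hneg hT1
  rw [e2] at hneg hT2
  -- The sign of the perturbation is chosen so that the corner after `x₂` becomes flat. Opposite
  -- turning then makes the corner after `x₁` flat as well.
  obtain ⟨t, ht⟩ : ∃ t, 0 < cr s t (g b) * (-r' * c₂) := by
    have hnorm := Complex.normSq_pos.2 (R.g_ne b)
    have h0 : cr s (Complex.I * g b) (g b) ≠ 0 := by
      rw [cr_I_mul]; exact mul_ne_zero (neg_ne_zero.2 R.s_ne) hnorm.ne'
    rcases lt_or_gt_of_ne (mul_ne_zero h0 hT2) with h | h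
    · exact ⟨-(Complex.I * g b), by rw [neg_cr]; linarith⟩
    · exact ⟨_, h⟩
  set d := cr s t (g b)
  have hd : d ≠ 0 := fun h => by rw [h, zero_mul] at ht; exact lt_irrefl _ ht
  have hev : ∀ h : ℂ, cr s (g b) h ≠ 0 →
      ∀ᶠ ε in 𝓝[>] (0 : ℝ), 0 < cr s (g b + ε • t) h * cr s (g b) h := fun h hh => by
    rcases lt_or_gt_of_ne hh with hh | hh
    · exact (eventually_neg_of_neg hh).mono fun _ h => mul_pos_of_neg_of_neg h hh
    · exact (eventually_pos_of_pos hh).mono fun _ h => mul_pos h hh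
  have hc₁0 : c₁ ≠ 0 := right_ne_zero_of_mul hT1
  have hc₂0 : c₂ ≠ 0 := right_ne_zero_of_mul hT2
  obtain ⟨ε, hε, hgen, h1, h2⟩ := ((show ∀ᶠ ε in 𝓝[>] (0 : ℝ), 0 < ε from
    self_mem_nhdsWithin).and ((R.eventually_generic (u := g b) (r := t)
      (by rw [cr_comm]; exact neg_ne_zero.2 hd)).and ((hev _ hc₁0).and (hev _ hc₂0)))).exists
  have hgb : cr s (g b + ε • t) (g b) = ε * d := by
    rw [add_cr, cr_self, zero_add, smul_cr]
  refine hne ((R.white_count hgen).2.1 x₁ x₂ hhead ?_ ?_)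
  · rw [hx₁', hg, cr_smul, hgb]
    set A := cr s (g b + ε • t) (side ψ x₁)
    have h3 : 0 < -(r * c₁) * d := by
      have : 0 < (-(r * c₁) * d) * (-r' * c₂) ^ 2 := by
        have := mul_pos ht (neg_pos.2 hneg)
        nlinarith
      exact (mul_pos_iff_of_pos_right (by positivity)).1 this
    have h4 : 0 < (A * c₁) * (-(r * c₁) * d) * ε := mul_pos (mul_pos h1 h3) hε
    have h5 : (A * c₁) * (-(r * c₁) * d) * ε = (A * (-r * (ε * d))) * c₁ ^ 2 := by ring
    rw [h5] at h4
    exact (mul_pos_iff_of_pos_right (by positivity)).1 h4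
  · rw [hg', cr_smul, hgb]
    set B := cr s (g b + ε • t) (side ψ (G.whitePerm e₀ x₂))
    have h4 : 0 < (B * c₂) * (d * (-r' * c₂)) * ε := mul_pos (mul_pos h2 ht) hε
    have h5 : (B * c₂) * (d * (-r' * c₂)) * ε = ((-r' * (ε * d)) * B) * c₂ ^ 2 := by ring
    rw [h5] at h4
    exact (mul_pos_iff_of_pos_right (by positivity)).1 h4

/-- The tiles of the white vertices are strictly convex polygons with the orientation of the
outer polygon. -/
theorem convex (w : Fin n) : ConvexCycle s (G.whitePerm e₀) (G.white e₀) (corner ψ) w := by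
  have hσ := white_whitePerm (G := G.toBipartiteMap) (e₀ := e₀)
  have hturn : ∀ s', ∀ x, ConvexCycle s' (G.whitePerm e₀) (G.white e₀) (corner ψ) (G.white e₀ x) →
      0 < cr s' (side ψ x) (side ψ (G.whitePerm e₀ x)) := fun s' x h => h.turn hσ rfl
  have hiff : ∀ x, ConvexCycle s (G.whitePerm e₀) (G.white e₀) (corner ψ) (G.white e₀ x) ↔
      0 < cr s (side ψ x) (side ψ (G.whitePerm e₀ x)) := fun x => by
    refine ⟨hturn s x, fun h => (R.convex_or _).resolve_right fun h' => ?_⟩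
    have := hturn _ x h'
    rw [neg_orientation] at this
    linarith
  let P : G.edges → Prop := fun e =>
    ConvexCycle s (G.whitePerm e₀) (G.white e₀) (corner ψ) e.1.2
  have hP : ∀ e : G.edges, e ≠ e₀ → (P (G.rotB e) ↔ P e) := fun e he => by
    have h := R.turn_mul_pos he
    have h1 := hiff (Sum.inl (G.rotB e))
    have h2 := hiff ((G.whitePerm e₀).symm (Sum.inl e))
    rw [apply_symm_apply] at h2
    have h3 : G.white e₀ ((G.whitePerm e₀).symm (Sum.inl e)) = e.1.2 := by
      rw [class_symm_apply white_eq_iff]; rfl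
    rw [h3] at h2
    refine h1.trans (Iff.trans ?_ h2.symm)
    exact ⟨fun h' => (mul_pos_iff_of_pos_right h').1 h, fun h' => (mul_pos_iff_of_pos_left h').1 h⟩
  have hstep : ∀ e : G.edges, (if P (G.rotB e) then (1 : ℝ) else 0) = if P e then 1 else 0 := by
    intro e
    -- The step at `e₀` crosses the dotted line and is not covered. A function on a cycle cannot
    -- change at exactly one step.
    by_cases he : e = e₀
    · subst he
      exact eq_of_forall_ne_step (σ := G.rotB) (c := fun e : G.edges => e.1.1) rotB_fst
        (fun e => if P e then (1 : ℝ) else 0) e fun x _ hx => by simp only [hP x hx]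
    · simp only [hP e he]
  have hstep' : ∀ e : G.edges, P (G.rotB e) = P e := fun e => by
    have := hstep e
    by_cases h1 : P (G.rotB e) <;> by_cases h2 : P e <;> simp_all
  choose eB heB using G.exists_edge_fst
  have hconst := G.const_of_edges (F := Sum.elim (fun b => P (eB b))
    (fun w => ConvexCycle s (G.whitePerm e₀) (G.white e₀) (corner ψ) w)) (fun e =>
      eq_of_step_eq (σ := G.rotB) (c := fun e : G.edges => e.1.1)
        (fun x y => (G.rotB_sameCycle x y).symm) (F := P) hstep' (heB e.1.1))
  let i₀ : Fin (G.halfDegree e₀) := ⟨0, (halfDegree_pos e₀)⟩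
  -- Base case: this tile has the corner `p 0`, between a positive multiple of the closing side of
  -- the polygon and its first side, so it turns like the polygon.
  have h0 : ConvexCycle s (G.whitePerm e₀) (G.white e₀) (corner ψ)
      (G.white e₀ (Sum.inl (G.exitEdge e₀ i₀))) := by
    rw [hiff, whitePerm_exit, R.side_inl, R.side_inr, smul_cr]
    have hb : (G.exitEdge e₀ i₀).1.1 = e₀.1.1 := rotB_fst e₀
    have hl : len K f (G.exitEdge e₀ i₀) = len K f (G.rotB e₀) := rfl
    rw [hb, hl, R.g_self]
    have ht := R.polygon.turn (fun _ => rfl) (x := Fin.last _) rfl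
    simp only [Equiv.coe_addRight, Fin.last_add_one] at ht
    have e1 : (0 : Fin (G.halfDegree e₀ + 1)) + 1 = i₀.succ := by
      rw [← Fin.coeSucc_eq_succ]; rfl
    have e2 : (0 : Fin (G.halfDegree e₀ + 1)) = i₀.castSucc := rfl
    rw [e1] at ht
    rw [← e2, ← neg_sub (p 0), neg_cr, neg_mul_neg]
    exact mul_pos R.count.pos_rotB ht
  have := hconst (Sum.inr w) (Sum.inr (G.white e₀ (Sum.inl (G.exitEdge e₀ i₀))))
  simp only [Sum.elim_inr] at this
  rw [this]
  exact h0

end Realization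

end PlaneBipartiteGraph


/-! ### The tiling of the outer polygon -/

namespace PlanePolygon

open Equiv Finset CyclicSign Filter Topology

/-- A line is closed and nowhere dense. Residual sets allow finitely many lines to be discarded
while keeping a dense set of points. -/
theorem eventually_residual_cr_ne {s : ℝ} (hs : s ≠ 0) {h : ℂ} (hh : h ≠ 0) (c : ℝ) :
    ∀ᶠ z in residual ℂ, cr s h z ≠ c := by
  refine residual_of_dense_open (s := {z | cr s h z ≠ c})
    (isOpen_ne_fun (continuous_cr s h) continuous_const) ?_
  intro z
  by_cases hz : cr s h z = c
  swap
  · exact subset_closure hz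
  have hnorm := Complex.normSq_pos.2 hh
  have ht : Tendsto (fun ε : ℝ => z + ε • (Complex.I * h)) (𝓝[>] 0) (𝓝 z) := by
    have : Tendsto (fun ε : ℝ => z + ε • (Complex.I * h)) (𝓝 0) (𝓝 (z + (0 : ℝ) • (Complex.I * h))) :=
      Continuous.tendsto (by fun_prop) 0
    rw [zero_smul, add_zero] at this
    exact this.mono_left nhdsWithin_le_nhds
  refine mem_closure_of_tendsto ht ?_
  filter_upwards [self_mem_nhdsWithin] with ε hε
  have : (ε : ℝ) ≠ 0 := (Set.mem_Ioi.1 hε).ne'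
  change cr s h _ ≠ c
  rw [cr_add, cr_smul, cr_mul_I, hz]
  intro h'
  have h'' : ε * (s * Complex.normSq h) = 0 := by linarith
  simp_all

theorem crossing_of_smul {s : ℝ} {u z a b g : ℂ} {r : ℝ} (hr : r ≠ 0) (h : b - a = r • g) :
    crossing s u z a b = cr s g (z - a) / cr s u g := by
  rw [crossing, h, smul_cr, cr_smul, mul_div_mul_left _ _ hr]

variable {X ι : Type*} {σ : Perm X} {c : X → ι} {v : X → ℂ} {s : ℝ} {i : ι}

theorem interior_closedTile_subset (hs : s ≠ 0) (hv : ∀ x, v (σ x) - v x ≠ 0) :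
    interior (closedTile s σ c v i) ⊆ openTile s σ c v i := by
  intro z hz x hx
  refine lt_of_le_of_ne (interior_subset hz x hx) fun h0 => ?_
  set h := v (σ x) - v x
  have hnorm := Complex.normSq_pos.2 (hv x)
  have ht : Tendsto (fun ε : ℝ => z + ε • (-(s : ℂ) * (Complex.I * h))) (𝓝[>] 0) (𝓝 z) := by
    have : Tendsto (fun ε : ℝ => z + ε • (-(s : ℂ) * (Complex.I * h))) (𝓝 0)
        (𝓝 (z + (0 : ℝ) • (-(s : ℂ) * (Complex.I * h)))) :=
      Continuous.tendsto (by fun_prop) 0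
    rw [zero_smul, add_zero] at this
    exact this.mono_left nhdsWithin_le_nhds
  obtain ⟨ε, hε, hε'⟩ := ((ht.eventually (isOpen_interior.mem_nhds hz)).and
    (self_mem_nhdsWithin : Set.Ioi (0 : ℝ) ∈ 𝓝[>] 0)).exists
  have h1 := interior_subset hε x hx
  have e : z + ε • (-(s : ℂ) * (Complex.I * h)) - v x = (z - v x) + (-(ε * s)) • (Complex.I * h) := by
    simp only [Complex.real_smul]; push_cast; ring
  rw [e, cr_add, ← h0, cr_smul, cr_mul_I] at h1
  have : 0 < ε * s ^ 2 * Complex.normSq h := by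
    have : 0 < ε := hε'
    positivity
  nlinarith

end PlanePolygon

namespace PlaneBipartiteGraph.Realization

open Equiv Finset BipartiteMap CyclicSign Matrix PlanePolygon Filter Topology
open scoped Classical

variable {n : ℕ} {G : PlaneBipartiteGraph n} {e₀ : G.edges} {ν : G.edges → ℝ}
  {K : Matrix (Fin n) (Fin n) ℝ} {f : Fin n → ℝ} {g : Fin n → ℂ}
  {p : Fin (G.halfDegree e₀ + 1) → ℂ} {ψ : G.DualVertex e₀ → ℂ} {s : ℝ}

variable (ψ s) in
/-- The open tile of a white vertex. -/
abbrev tile (w : Fin n) : Set ℂ := openTile s (G.whitePerm e₀) (G.white e₀) (corner ψ) w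

variable (ψ s) in
/-- The closed tile of a white vertex. -/
abbrev ctile (w : Fin n) : Set ℂ := closedTile s (G.whitePerm e₀) (G.white e₀) (corner ψ) w

variable (p s) in
/-- The interior of the outer polygon. -/
abbrev disc : Set ℂ :=
  openTile s (Equiv.addRight (1 : Fin (G.halfDegree e₀ + 1))) (fun _ => ()) p ()

variable (p s) in
/-- The outer polygon, with its interior. -/
abbrev cdisc : Set ℂ :=
  closedTile s (Equiv.addRight (1 : Fin (G.halfDegree e₀ + 1))) (fun _ => ()) p ()

variable (R : Realization G e₀ ν K f g p ψ s)
include R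

theorem blackStep_ne (x : Option G.edges) : blackStep (len K f) x ≠ 0 := by
  rcases x with _ | e
  · change (-1 : ℝ) ≠ 0; norm_num
  · exact R.len_ne e

theorem blackHead_sub (x : Option G.edges) : ψ (G.blackHead e₀ x) - ψ (G.blackTail e₀ x) =
    blackStep (len K f) x • g (G.black e₀ x) := by
  rcases x with _ | e
  · change ψ (Sum.inr 0) - ψ (Sum.inr (Fin.last _)) = (-1 : ℝ) • g e₀.1.1
    rw [R.g_self, R.outer, R.outer]; simp
  · exact R.grad e

/-- The dual vertices around a black vertex have images on a common line of direction `g b`. -/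
theorem cr_blackTail {x y : Option G.edges} (h : G.black e₀ x = G.black e₀ y) :
    cr s (g (G.black e₀ x)) (ψ (G.blackTail e₀ x)) =
      cr s (g (G.black e₀ x)) (ψ (G.blackTail e₀ y)) := by
  have := eq_of_step_eq black_eq_iff
    (F := fun y => cr s (g (G.black e₀ y)) (ψ (G.blackTail e₀ y))) (fun y => by
      rw [black_blackPerm, blackTail_blackPerm, ← sub_eq_zero, ← cr_sub, R.blackHead_sub,
        cr_smul, cr_self, mul_zero]) h
  rw [this, h]

/-- Almost every point of the plane lies in as many tiles as in the outer polygon. -/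
theorem eventually_sum_tile : ∀ᶠ z in residual ℂ,
    ∑ w, (if z ∈ tile ψ s w then (1 : ℝ) else 0) = if z ∈ disc p s then 1 else 0 := by
  obtain ⟨u, hu⟩ := R.exists_generic
  have hu0 : u ≠ 0 := fun h => hu.1 e₀.1.1 (by rw [h, zero_cr])
  have h1 : ∀ᶠ z in residual ℂ, ∀ x, cr s u z ≠ cr s u (corner ψ x) :=
    eventually_all.2 fun x => eventually_residual_cr_ne R.s_ne hu0 _
  have h2 : ∀ᶠ z in residual ℂ, ∀ x, cr s (side ψ x) z ≠ cr s (side ψ x) (corner ψ x) :=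
    eventually_all.2 fun x => eventually_residual_cr_ne R.s_ne (R.side_ne x) _
  have h3 : ∀ᶠ z in residual ℂ, ∀ k, cr s u z ≠ cr s u (p k) :=
    eventually_all.2 fun x => eventually_residual_cr_ne R.s_ne hu0 _
  have h4 : ∀ᶠ z in residual ℂ, ∀ k, cr s (p (k + 1) - p k) z ≠ cr s (p (k + 1) - p k) (p k) :=
    eventually_all.2 fun x => eventually_residual_cr_ne R.s_ne (R.polygon_side_ne x) _
  filter_upwards [h1, h2, h3, h4] with z h1 h2 h3 h4
  have hw : ∀ w, (if z ∈ tile ψ s w then (1 : ℝ) else 0) =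
      ∑ x with G.white e₀ x = w, wind s u z (corner ψ x) (corner ψ (G.whitePerm e₀ x)) := fun w => by
    obtain ⟨e, he⟩ := G.exists_edge_snd w
    rw [(R.convex w).sum_wind white_whitePerm white_eq_iff ⟨Sum.inl e, he⟩
      (fun x _ => Generic.side_ne R hu x) (fun x _ => h1 x)
      (fun x _ => by rw [cr_sub]; exact sub_ne_zero.2 (h2 x))]
  rw [sum_congr rfl fun w _ => hw w, Finset.sum_fiberwise, Fintype.sum_sum_type]
  have hQ := R.polygon.sum_wind (fun _ => rfl) (fun x y => by simp [addRight_sameCycle x y])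
    ⟨0, rfl⟩ (u := u) (z := z)
    (fun k _ => hu.2 k) (fun k _ => h3 k) (fun k _ => by rw [cr_sub]; exact sub_ne_zero.2 (h4 k))
  rw [← hQ]
  have hfilter : ∀ F : Fin (G.halfDegree e₀ + 1) → ℝ,
      ∑ k with (fun _ : Fin (G.halfDegree e₀ + 1) => ()) k = (), F k = ∑ k, F k := fun F => by
    simp
  rw [hfilter, Fin.sum_univ_castSucc, add_comm]
  congr 1
  · refine sum_congr rfl fun i _ => ?_
    simp only [corner, whiteTail_whitePerm]
    change wind s u z (ψ (Sum.inr i.castSucc)) (ψ (Sum.inr i.succ)) =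
      wind s u z (p i.castSucc) (p (i.castSucc + 1))
    rw [R.outer, R.outer, Fin.coeSucc_eq_succ]
  let S : G.DualVertex e₀ → ℝ := fun v => if cr s u z < cr s u (ψ v) then 1 else 0
  choose eB heB using G.exists_edge_fst
  -- This records whether the line of `b` is met ahead of `z`. It depends on `b` alone, as all dual
  -- edges of `b` lie on this line, so their signed crossings telescope.
  let χ : Fin n → ℝ := fun b =>
    if 0 < cr s (g b) (z - ψ (G.right e₀ (eB b))) / cr s u (g b) then 1 else 0
  have hχ : ∀ (x : Option G.edges), wind s u z (ψ (G.blackTail e₀ x)) (ψ (G.blackHead e₀ x)) =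
      (S (G.blackHead e₀ x) - S (G.blackTail e₀ x)) * χ (G.black e₀ x) := fun x => by
    have h5 : cr s (g (G.black e₀ x)) (z - ψ (G.blackTail e₀ x)) =
        cr s (g (G.black e₀ x)) (z - ψ (G.right e₀ (eB (G.black e₀ x)))) := by
      rw [cr_sub, cr_sub, R.cr_blackTail (x := x) (y := some (eB (G.black e₀ x)))
        (heB _).symm]
      rfl
    simp only [wind, crossing_of_smul (R.blackStep_ne x) (R.blackHead_sub x), h5, S, χ]
  have hsum : ∀ e : G.edges, wind s u z (corner ψ (Sum.inl e))
      (corner ψ (G.whitePerm e₀ (Sum.inl e))) =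
      - ((S (G.left e₀ e) - S (G.right e₀ e)) * χ e.1.1) := fun e => by
    simp only [corner, whiteTail_whitePerm]
    rw [wind_comm]
    exact congrArg _ (hχ (some e))
  rw [sum_congr rfl fun e _ => hsum e, sum_neg_distrib,
    ← Finset.sum_fiberwise (s := univ) (g := fun e : G.edges => e.1.1)]
  -- Only `b₀` leaves a remainder, namely the closing side of the outer polygon.
  have hb : ∀ b, ∑ e : G.edges with e.1.1 = b, (S (G.left e₀ e) - S (G.right e₀ e)) * χ e.1.1 =
      if b = e₀.1.1 then (S (Sum.inr (Fin.last _)) - S (Sum.inr 0)) * χ b else 0 := fun b => by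
    rw [sum_congr rfl fun e he => by rw [(mem_filter.1 he).2], ← sum_mul, sum_black_eq, ite_mul,
      zero_mul]
  rw [sum_congr rfl fun b _ => hb b, Finset.sum_ite_eq' univ, if_pos (mem_univ _)]
  have h6 := hχ none
  change wind s u z (ψ (Sum.inr (Fin.last _))) (ψ (Sum.inr 0)) =
    (S (Sum.inr 0) - S (Sum.inr (Fin.last _))) * χ e₀.1.1 at h6
  rw [R.outer, R.outer] at h6
  have h7 : p (Equiv.addRight (1 : Fin (G.halfDegree e₀ + 1)) (Fin.last _)) = p 0 :=
    congrArg p (Fin.last_add_one _)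
  rw [h7, h6]
  ring

/-- Residual sets are dense, so any failure of the tiling on an open set can be tested at a point
where the identity holds. -/
theorem exists_mem_sum_tile {U : Set ℂ} (hU : IsOpen U) (hne : U.Nonempty) : ∃ z ∈ U,
    ∑ w, (if z ∈ tile ψ s w then (1 : ℝ) else 0) = if z ∈ disc p s then 1 else 0 :=
  (dense_of_mem_residual R.eventually_sum_tile).exists_mem_open hU hne |>.imp
    fun _ h => ⟨h.2, h.1⟩

/-- The tiles do not overlap. -/
theorem disjoint_tile {w w' : Fin n} (h : w ≠ w') : Disjoint (tile ψ s w) (tile ψ s w') := by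
  rw [Set.disjoint_iff_inter_eq_empty, ← Set.not_nonempty_iff_eq_empty]
  intro hne
  obtain ⟨z, ⟨hz, hz'⟩, hsum⟩ :=
    R.exists_mem_sum_tile (isOpen_openTile.inter isOpen_openTile) hne
  have h2 : (2 : ℝ) ≤ ∑ w, (if z ∈ tile ψ s w then (1 : ℝ) else 0) := by
    calc (2 : ℝ) = ∑ v ∈ {w, w'}, (if z ∈ tile ψ s v then (1 : ℝ) else 0) := by
          rw [sum_pair h, if_pos hz, if_pos hz']; norm_num
      _ ≤ _ := sum_le_sum_of_subset_of_nonneg (subset_univ _) fun v _ _ => by positivity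
  rw [hsum] at h2
  split_ifs at h2 <;> norm_num at h2

omit R in
theorem exists_white (w : Fin n) : ∃ x, G.white e₀ x = w := by
  obtain ⟨e, he⟩ := G.exists_edge_snd w
  exact ⟨Sum.inl e, he⟩

theorem ctile_subset_closure (w : Fin n) : ctile ψ s w ⊆ closure (tile ψ s w) :=
  (R.convex w).closedTile_subset_closure white_whitePerm (exists_white w)

theorem tile_subset_cdisc (w : Fin n) : tile ψ s w ⊆ cdisc p s := by
  intro z hz
  by_contra hcon
  obtain ⟨z', ⟨h1, h2⟩, hsum⟩ := R.exists_mem_sum_tile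
    (isOpen_openTile.inter (isClosed_closedTile (s := s)
      (σ := Equiv.addRight (1 : Fin (G.halfDegree e₀ + 1))) (c := fun _ => ()) (v := p)
      (i := ())).isOpen_compl) ⟨z, hz, hcon⟩
  rw [if_neg (fun h => h2 (openTile_subset h))] at hsum
  have := (sum_eq_zero_iff_of_nonneg fun v _ => by positivity).1 hsum w (mem_univ _)
  rw [if_pos h1] at this
  exact one_ne_zero this

theorem ctile_subset_cdisc (w : Fin n) : ctile ψ s w ⊆ cdisc p s :=
  (R.ctile_subset_closure w).trans (closure_minimal (R.tile_subset_cdisc w) isClosed_closedTile)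

theorem tile_subset_disc (w : Fin n) : tile ψ s w ⊆ disc p s :=
  (interior_maximal (R.tile_subset_cdisc w) isOpen_openTile).trans
    (interior_closedTile_subset R.s_ne R.polygon_side_ne)

/-- The closed tiles cover the outer polygon. -/
theorem exists_mem_ctile {z : ℂ} (hz : z ∈ cdisc p s) : ∃ w, z ∈ ctile ψ s w := by
  have hclosed : IsClosed (⋃ w, ctile ψ s w) := isClosed_iUnion_of_finite fun w => isClosed_closedTile
  have h1 : disc p s ⊆ ⋃ w, ctile ψ s w := by
    intro z hz
    by_contra hcon
    obtain ⟨z', ⟨h1, h2⟩, hsum⟩ := R.exists_mem_sum_tile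
      (isOpen_openTile.inter hclosed.isOpen_compl) ⟨z, hz, hcon⟩
    rw [if_pos h1, sum_eq_zero] at hsum
    · exact zero_ne_one hsum
    · exact fun w _ => if_neg fun h => h2 (Set.mem_iUnion.2 ⟨w, openTile_subset h⟩)
  have h2 := closure_minimal h1 hclosed
    (R.polygon.closedTile_subset_closure (fun _ => rfl) ⟨0, rfl⟩ hz)
  exact Set.mem_iUnion.1 h2

end PlaneBipartiteGraph.Realization


/-! ### The segments of the black vertices -/

namespace PlanePolygon

theorem mem_openSegment_line {o h z : ℂ} {a b : ℝ} :
    z ∈ openSegment ℝ (o + a • h) (o + b • h) ↔ ∃ t ∈ openSegment ℝ a b, z = o + t • h := by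
  constructor
  · rintro ⟨α, β, hα, hβ, h1, rfl⟩
    refine ⟨α * a + β * b, ⟨α, β, hα, hβ, h1, rfl⟩, ?_⟩
    obtain rfl : α = 1 - β := by linarith
    module
  · rintro ⟨_, ⟨α, β, hα, hβ, h1, rfl⟩, rfl⟩
    refine ⟨α, β, hα, hβ, h1, ?_⟩
    obtain rfl : α = 1 - β := by linarith
    simp only [smul_eq_mul]
    module

theorem mem_segment_line {o h z : ℂ} {a b : ℝ} :
    z ∈ segment ℝ (o + a • h) (o + b • h) ↔ ∃ t ∈ segment ℝ a b, z = o + t • h := by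
  constructor
  · rintro ⟨α, β, hα, hβ, h1, rfl⟩
    refine ⟨α * a + β * b, ⟨α, β, hα, hβ, h1, rfl⟩, ?_⟩
    obtain rfl : α = 1 - β := by linarith
    module
  · rintro ⟨_, ⟨α, β, hα, hβ, h1, rfl⟩, rfl⟩
    refine ⟨α, β, hα, hβ, h1, ?_⟩
    obtain rfl : α = 1 - β := by linarith
    simp only [smul_eq_mul]
    module

end PlanePolygon

namespace PlaneBipartiteGraph.Realization

open Equiv Finset BipartiteMap CyclicSign Matrix PlanePolygon Filter Topology
open scoped Classical

variable {n : ℕ} {G : PlaneBipartiteGraph n} {e₀ : G.edges} {ν : G.edges → ℝ}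
  {K : Matrix (Fin n) (Fin n) ℝ} {f : Fin n → ℝ} {g : Fin n → ℂ}
  {p : Fin (G.halfDegree e₀ + 1) → ℂ} {ψ : G.DualVertex e₀ → ℂ} {s : ℝ}

variable (g ψ) in
/-- The coordinate, in units of `g`, of a dual vertex on the line of a black vertex. -/
noncomputable def coord (x : Option G.edges) : ℝ :=
  (starRingEnd ℂ (g (G.black e₀ x)) * ψ (G.blackTail e₀ x)).re / Complex.normSq (g (G.black e₀ x))

variable (g ψ) in
/-- The point with coordinate zero on the line of a black vertex. -/
noncomputable def origin (b : Fin n) : ℂ :=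
  ψ (G.blackTail e₀ (some (G.exists_edge_fst b).choose)) -
    coord g ψ (some (G.exists_edge_fst b).choose) • g b

variable (R : Realization G e₀ ν K f g p ψ s)
include R

theorem coord_blackPerm (x : Option G.edges) :
    coord g ψ (G.blackPerm e₀ x) = coord g ψ x + blackStep (len K f) x := by
  have h := R.blackHead_sub x
  have hn := (Complex.normSq_pos.2 (R.g_ne (G.black e₀ x))).ne'
  rw [coord, coord, black_blackPerm, blackTail_blackPerm, sub_eq_iff_eq_add.1 h, mul_add,
    Complex.add_re, add_div, add_comm]
  congr 1
  rw [div_eq_iff hn]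
  simp only [Complex.mul_re, Complex.conj_re, Complex.conj_im, Complex.real_smul,
    Complex.normSq_apply, Complex.ofReal_re, Complex.ofReal_im, Complex.mul_im]
  ring

theorem blackTail_eq (x : Option G.edges) :
    ψ (G.blackTail e₀ x) = origin g ψ (G.black e₀ x) + coord g ψ x • g (G.black e₀ x) := by
  have h := eq_of_step_eq black_eq_iff
    (F := fun y => ψ (G.blackTail e₀ y) - coord g ψ y • g (G.black e₀ y)) (fun y => by
      rw [black_blackPerm, blackTail_blackPerm, R.coord_blackPerm,
        sub_eq_iff_eq_add.1 (R.blackHead_sub y)]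
      module)
    (x := x) (y := some (G.exists_edge_fst (G.black e₀ x)).choose)
    (G.exists_edge_fst (G.black e₀ x)).choose_spec.symm
  have h' : g (G.black e₀ (some (G.exists_edge_fst (G.black e₀ x)).choose)) =
    g (G.black e₀ x) := congrArg g (G.exists_edge_fst (G.black e₀ x)).choose_spec
  rw [h'] at h
  exact sub_eq_iff_eq_add.1 h

theorem blackHead_eq (x : Option G.edges) :
    ψ (G.blackHead e₀ x) = origin g ψ (G.black e₀ x) +
      coord g ψ (G.blackPerm e₀ x) • g (G.black e₀ x) := by
  rw [← blackTail_blackPerm, R.blackTail_eq, black_blackPerm]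

theorem sum_blackStep_eq (b : Fin n) :
    ∑ x with G.black e₀ x = b, blackStep (len K f) x = 0 :=
  sum_blackStep R.kasteleyn.eq_zero R.mulVec_f b

theorem exists_top (b : Fin n) : ∃ x, G.black e₀ x = b ∧ 0 < blackStep (len K f) x ∧
    blackStep (len K f) (G.blackPerm e₀ x) < 0 := by
  obtain ⟨e, he⟩ := G.exists_edge_fst b
  obtain ⟨x, hx⟩ := card_pos.1 (one_le_card_descents black_eq_iff R.blackStep_ne ⟨some e, he⟩
    (R.sum_blackStep_eq b)).1
  simp only [descents, mem_filter, mem_univ, true_and] at hx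
  exact ⟨x, hx⟩

theorem exists_bot (b : Fin n) : ∃ x, G.black e₀ x = b ∧ blackStep (len K f) x < 0 ∧
    0 < blackStep (len K f) (G.blackPerm e₀ x) := by
  obtain ⟨e, he⟩ := G.exists_edge_fst b
  obtain ⟨x, hx⟩ := card_pos.1 (one_le_card_descents black_eq_iff R.blackStep_ne ⟨some e, he⟩
    (R.sum_blackStep_eq b)).2
  simp only [ascents, mem_filter, mem_univ, true_and] at hx
  exact ⟨x, hx⟩

/-- The fold at the upper end of the segment of a black vertex. -/
noncomputable def top (b : Fin n) : Option G.edges := (R.exists_top b).choose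

/-- The fold at the lower end of the segment of a black vertex. -/
noncomputable def bot (b : Fin n) : Option G.edges := (R.exists_bot b).choose

/-- The upper end of the coordinate range. -/
noncomputable def hi (b : Fin n) : ℝ := coord g ψ (G.blackPerm e₀ (R.top b))

/-- The lower end of the coordinate range. -/
noncomputable def lo (b : Fin n) : ℝ := coord g ψ (G.blackPerm e₀ (R.bot b))

theorem le_hi (x : Option G.edges) : coord g ψ x ≤ R.hi (G.black e₀ x) := by
  obtain ⟨h1, h2, h3⟩ := (R.exists_top (G.black e₀ x)).choose_spec
  exact le_of_unique_descent black_blackPerm R.blackStep_ne R.coord_blackPerm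
    R.count.descent_unique h2 h3 h1.symm

theorem lo_le (x : Option G.edges) : R.lo (G.black e₀ x) ≤ coord g ψ x := by
  obtain ⟨h1, h2, h3⟩ := (R.exists_bot (G.black e₀ x)).choose_spec
  exact ge_of_unique_ascent black_blackPerm R.blackStep_ne R.coord_blackPerm
    R.count.ascent_unique h2 h3 h1.symm

theorem eq_hi {x : Option G.edges} (hx : 0 < blackStep (len K f) x)
    (hx' : blackStep (len K f) (G.blackPerm e₀ x) < 0) :
    coord g ψ (G.blackPerm e₀ x) = R.hi (G.black e₀ x) := by
  obtain ⟨h1, h2, h3⟩ := (R.exists_top (G.black e₀ x)).choose_spec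
  exact congrArg (fun y => coord g ψ (G.blackPerm e₀ y))
    (R.count.descent_unique _ _ h1.symm hx hx' h2 h3)

theorem eq_lo {x : Option G.edges} (hx : blackStep (len K f) x < 0)
    (hx' : 0 < blackStep (len K f) (G.blackPerm e₀ x)) :
    coord g ψ (G.blackPerm e₀ x) = R.lo (G.black e₀ x) := by
  obtain ⟨h1, h2, h3⟩ := (R.exists_bot (G.black e₀ x)).choose_spec
  exact congrArg (fun y => coord g ψ (G.blackPerm e₀ y))
    (R.count.ascent_unique _ _ h1.symm hx hx' h2 h3)

theorem lo_lt_hi (b : Fin n) : R.lo b < R.hi b := by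
  obtain ⟨h1, h2, -⟩ := (R.exists_top b).choose_spec
  have h3 := R.lo_le (R.top b)
  have h4 := R.coord_blackPerm (R.top b)
  rw [top, h1] at h3
  rw [hi]
  rw [top] at *
  linarith

/-- The lower end of the segment of a black vertex. -/
noncomputable def start (b : Fin n) : ℂ := origin g ψ b + R.lo b • g b

/-- The upper end of the segment of a black vertex. -/
noncomputable def finish (b : Fin n) : ℂ := origin g ψ b + R.hi b • g b

/-- The open segment of a black vertex. -/
abbrev seg (b : Fin n) : Set ℂ := openSegment ℝ (R.start b) (R.finish b)

theorem mem_seg {b : Fin n} {z : ℂ} :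
    z ∈ R.seg b ↔ ∃ t, R.lo b < t ∧ t < R.hi b ∧ z = origin g ψ b + t • g b := by
  rw [seg, start, finish, mem_openSegment_line, openSegment_eq_Ioo (R.lo_lt_hi b)]
  simp only [Set.mem_Ioo, and_assoc]

theorem mem_segment {b : Fin n} {z : ℂ} : z ∈ segment ℝ (R.start b) (R.finish b) ↔
    ∃ t, R.lo b ≤ t ∧ t ≤ R.hi b ∧ z = origin g ψ b + t • g b := by
  rw [start, finish, mem_segment_line, segment_eq_Icc (R.lo_lt_hi b).le]
  simp only [Set.mem_Icc, and_assoc]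

theorem start_ne (b : Fin n) : R.start b ≠ R.finish b := fun h => by
  have h1 : (R.hi b - R.lo b) • g b = 0 := by
    rw [sub_smul, sub_eq_zero]; exact (add_left_cancel h).symm
  rcases smul_eq_zero.1 h1 with h2 | h2
  · exact (R.lo_lt_hi b).ne (sub_eq_zero.1 h2).symm
  · exact R.g_ne b h2

theorem blackTail_mem (x : Option G.edges) :
    ψ (G.blackTail e₀ x) ∈ segment ℝ (R.start (G.black e₀ x)) (R.finish (G.black e₀ x)) :=
  R.mem_segment.2 ⟨_, R.lo_le x, R.le_hi x, R.blackTail_eq x⟩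

theorem blackHead_mem (x : Option G.edges) :
    ψ (G.blackHead e₀ x) ∈ segment ℝ (R.start (G.black e₀ x)) (R.finish (G.black e₀ x)) := by
  have := R.blackTail_mem (G.blackPerm e₀ x)
  rwa [blackTail_blackPerm, black_blackPerm] at this

theorem right_mem (e : G.edges) :
    ψ (G.right e₀ e) ∈ segment ℝ (R.start e.1.1) (R.finish e.1.1) := R.blackTail_mem (some e)

theorem left_mem (e : G.edges) :
    ψ (G.left e₀ e) ∈ segment ℝ (R.start e.1.1) (R.finish e.1.1) := R.blackHead_mem (some e)

/-- Every level is passed by an increasing edge. -/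
theorem exists_increasing {b : Fin n} {t : ℝ} (h1 : R.lo b ≤ t) (h2 : t ≤ R.hi b) :
    ∃ e : G.edges, e.1.1 = b ∧ coord g ψ (some e) ≤ t ∧ t ≤ coord g ψ (some e) + len K f e := by
  have key : ∃ x, G.black e₀ x = b ∧ 0 < blackStep (len K f) x ∧ coord g ψ x ≤ t ∧
      t ≤ coord g ψ (G.blackPerm e₀ x) := by
    obtain ⟨b1, b2, b3⟩ := (R.exists_bot b).choose_spec
    obtain ⟨t1, t2, t3⟩ := (R.exists_top b).choose_spec
    -- At the top level nothing lies strictly above, so the step into the upper fold is taken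
    -- instead of an upward passage.
    rcases h2.lt_or_eq with h2 | rfl
    · obtain ⟨x, hx, hx1, hx2⟩ := exists_step (P := fun x => coord g ψ x ≤ t) black_eq_iff
        (x := G.blackPerm e₀ (R.bot b)) (y := G.blackPerm e₀ (R.top b)) h1 (not_le.2 h2)
        (by rw [black_blackPerm, black_blackPerm]; exact b1.trans t1.symm)
      have h3 := R.coord_blackPerm x
      rw [not_le] at hx2
      exact ⟨x, by rw [hx, black_blackPerm]; exact b1, by linarith, hx1, hx2.le⟩
    · refine ⟨R.top b, t1, t2, ?_, le_rfl⟩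
      have := R.coord_blackPerm (R.top b)
      rw [hi, this]
      exact (le_add_iff_nonneg_right _).2 t2.le
  obtain ⟨x, hx, h3, h4, h5⟩ := key
  rcases x with _ | e
  · change (0 : ℝ) < -1 at h3; norm_num at h3
  · rw [R.coord_blackPerm] at h5
    exact ⟨e, hx, h4, h5⟩

theorem exists_edge_segment {b : Fin n} {z : ℂ} (hz : z ∈ segment ℝ (R.start b) (R.finish b)) :
    ∃ e : G.edges, e.1.1 = b ∧ z ∈ segment ℝ (ψ (G.right e₀ e)) (ψ (G.left e₀ e)) := by
  obtain ⟨t, h1, h2, rfl⟩ := R.mem_segment.1 hz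
  obtain ⟨e, rfl, h3, h4⟩ := R.exists_increasing h1 h2
  refine ⟨e, rfl, ?_⟩
  have e1 : ψ (G.right e₀ e) = _ := R.blackTail_eq (some e)
  have e2 : ψ (G.left e₀ e) = _ := R.blackHead_eq (some e)
  rw [e1, e2]
  refine mem_segment_line.2 ⟨t, ?_, rfl⟩
  rw [R.coord_blackPerm]
  exact Icc_subset_segment ⟨h3, h4⟩

theorem blackImage_eq (b : Fin n) :
    G.blackImage e₀ ψ b = segment ℝ (R.start b) (R.finish b) := by
  refine Set.Subset.antisymm (Set.iUnion_subset ?_) fun z hz => ?_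
  · rintro ⟨e, rfl⟩
    exact (convex_segment _ _).segment_subset (R.right_mem e) (R.left_mem e)
  · obtain ⟨e, he, hz⟩ := R.exists_edge_segment hz
    exact Set.mem_iUnion.2 ⟨⟨e, he⟩, hz⟩

/-- The segments do not meet the open tiles. -/
theorem disjoint_segment_tile (b w : Fin n) :
    Disjoint (segment ℝ (R.start b) (R.finish b)) (tile ψ s w) := by
  rw [Set.disjoint_left]
  intro z hz hzw
  obtain ⟨e, -, hz⟩ := R.exists_edge_segment hz
  have hc : ∀ x : G.edges ⊕ Fin (G.halfDegree e₀), corner ψ x ∈ ctile ψ s (G.white e₀ x) :=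
    fun x => (R.convex _).mem_closedTile rfl
  have h1 : ψ (G.left e₀ e) = corner ψ (Sum.inl e) := rfl
  have h2 : ψ (G.right e₀ e) = corner ψ (G.whitePerm e₀ (Sum.inl e)) := by
    rw [corner, whiteTail_whitePerm]; rfl
  have h3 : z ∈ ctile ψ s e.1.2 := by
    refine convex_closedTile.segment_subset ?_ ?_ hz
    · rw [h2]; have := hc (G.whitePerm e₀ (Sum.inl e)); rwa [white_whitePerm] at this
    · exact hc (Sum.inl e)
  rcases eq_or_ne e.1.2 w with rfl | hw
  · have h4 := hzw (Sum.inl e) rfl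
    rw [segment_symm, h1, h2] at hz
    obtain ⟨α, β, -, -, hαβ, rfl⟩ := hz
    rw [combination_sub hαβ, sub_self, smul_zero, zero_add, cr_smul, cr_self, mul_zero] at h4
    exact lt_irrefl _ h4
  -- The point is in the closure of the tile of `e`, so an open tile of another white vertex around
  -- it would overlap that tile.
  · obtain ⟨y, hy1, hy2⟩ := mem_closure_iff.1 (R.ctile_subset_closure _ h3) _ isOpen_openTile hzw
    exact Set.disjoint_left.1 (R.disjoint_tile hw) hy2 hy1

/-! ### Folds and flat corners -/

theorem fold_eq {x : Option G.edges}
    (h : blackStep (len K f) x * blackStep (len K f) (G.blackPerm e₀ x) < 0) :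
    ψ (G.blackHead e₀ x) = R.start (G.black e₀ x) ∨ ψ (G.blackHead e₀ x) = R.finish (G.black e₀ x) := by
  rw [R.blackHead_eq, start, finish]
  rcases mul_neg_iff.1 h with ⟨h1, h2⟩ | ⟨h1, h2⟩
  · right; rw [R.eq_hi h1 h2]
  · left; rw [R.eq_lo h1 h2]

theorem flat_mem {x : Option G.edges}
    (h : 0 < blackStep (len K f) x * blackStep (len K f) (G.blackPerm e₀ x)) :
    ψ (G.blackHead e₀ x) ∈ R.seg (G.black e₀ x) := by
  rw [R.blackHead_eq, R.mem_seg]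
  have h1 := R.lo_le x
  have h2 := R.le_hi x
  have h3 := R.lo_le (G.blackPerm e₀ (G.blackPerm e₀ x))
  have h4 := R.le_hi (G.blackPerm e₀ (G.blackPerm e₀ x))
  rw [black_blackPerm, black_blackPerm] at h3 h4
  have h5 := R.coord_blackPerm x
  have h6 := R.coord_blackPerm (G.blackPerm e₀ x)
  rcases pos_and_pos_or_neg_and_neg_of_mul_pos h with ⟨h7, h8⟩ | ⟨h7, h8⟩ <;>
  exact ⟨_, by linarith, by linarith, rfl⟩

/-- The flat black corner forced by parity: the path on the line of its black vertex passes straight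
through the image of the face. Hence no interior face is a root. -/
theorem inl_mem_seg (F : {F : G.Face // F ≠ G.leftFace e₀}) : ∃ b, ψ (Sum.inl F) ∈ R.seg b := by
  obtain ⟨e, he, hflat⟩ := R.count.flat_exists F.1 F.2
  have hne : e ≠ e₀ := fun h => F.2 (by rw [← he, h])
  have hl : G.left e₀ e = Sum.inl F := by
    rw [left_interior (he ▸ F.2)]; exact congrArg Sum.inl (Subtype.ext he)
  have := R.flat_mem (x := some e) (by rw [blackPerm_some hne]; exact hflat)
  change ψ (G.left e₀ e) ∈ _ at this
  rw [hl] at this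
  exact ⟨_, this⟩

/-- Every dual vertex is at a fold. -/
theorem exists_fold (v : G.DualVertex e₀) : ∃ x, G.blackHead e₀ x = v ∧
    blackStep (len K f) x * blackStep (len K f) (G.blackPerm e₀ x) < 0 := by
  rcases v with F | k
  · obtain ⟨e, he, hleft⟩ := exists_left_eq F
    have hne : ∀ e, G.leftFace e = F.1 → e ≠ e₀ := fun e he h => F.2 (by rw [← he, h])
    have hl : ∀ e, G.leftFace e = F.1 → G.left e₀ e = Sum.inl F := fun e he => by
      rw [left_interior (he ▸ F.2)]; exact congrArg Sum.inl (Subtype.ext he)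
    have he' : G.leftFace (G.facePerm e) = F.1 := (leftFace_facePerm e).trans he
    have hee : G.facePerm e ≠ e := fun h => by
      refine rotB_ne R.kasteleyn R.nondeg R.two_le e (Subtype.ext (Prod.ext (rotB_fst e) ?_))
      rw [← facePerm_snd, h]
    -- The face has at least two black corners, of which only one is flat.
    have key : ∃ a, G.leftFace a = F.1 ∧ ¬ 0 < len K f a * len K f (G.rotB a) := by
      by_contra! hcon
      exact hee (R.count.flat_unique _ _ (he'.trans he.symm) (hne _ he') (hne _ he)
        (hcon _ he') (hcon _ he))
    obtain ⟨a, ha, hflat⟩ := key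
    refine ⟨some a, hl a ha, ?_⟩
    rw [blackPerm_some (hne a ha)]
    exact lt_of_le_of_ne (not_lt.1 hflat) (mul_ne_zero (R.len_ne _) (R.len_ne _))
  · induction k using Fin.cases with
    | zero =>
      refine ⟨none, rfl, ?_⟩
      rw [blackPerm_none]
      change (-1) * len K f (G.rotB e₀) < 0
      have := R.count.pos_rotB
      linarith
    | succ i =>
      refine ⟨some (G.outerEdge e₀ (i + 1)), left_outerEdge i, ?_⟩
      by_cases h : G.outerEdge e₀ (i + 1) = e₀
      · rw [h, blackPerm_some_self]
        change len K f e₀ * (-1) < 0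
        have := R.count.pos_self
        linarith
      · rw [blackPerm_some h]
        exact R.count.not_flat _ h (leftFace_outerEdge _)

theorem endpoint (v : G.DualVertex e₀) : ∃ b, ψ v = R.start b ∨ ψ v = R.finish b := by
  obtain ⟨x, rfl, hx⟩ := R.exists_fold v
  exact ⟨_, R.fold_eq hx⟩

theorem exists_start (b : Fin n) : ∃ v, ψ v = R.start b := by
  obtain ⟨h1, h2, h3⟩ := (R.exists_bot b).choose_spec
  refine ⟨G.blackHead e₀ (R.bot b), ?_⟩
  rw [R.blackHead_eq, start, lo, bot, h1]

theorem exists_finish (b : Fin n) : ∃ v, ψ v = R.finish b := by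
  obtain ⟨h1, h2, h3⟩ := (R.exists_top b).choose_spec
  refine ⟨G.blackHead e₀ (R.top b), ?_⟩
  rw [R.blackHead_eq, finish, hi, top, h1]

/-! ### Position relative to the outer polygon -/

theorem mem_cdisc (v : G.DualVertex e₀) : ψ v ∈ cdisc p s := by
  rcases v with F | k
  · obtain ⟨e, -, he⟩ := exists_left_eq F
    rw [← he]
    exact R.ctile_subset_cdisc e.1.2 ((R.convex _).mem_closedTile (x := Sum.inl e) rfl)
  · rw [R.outer]; exact R.polygon.mem_closedTile rfl

theorem segment_subset_cdisc (b : Fin n) : segment ℝ (R.start b) (R.finish b) ⊆ cdisc p s := by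
  obtain ⟨v, hv⟩ := R.exists_start b
  obtain ⟨v', hv'⟩ := R.exists_finish b
  exact convex_closedTile.segment_subset (hv ▸ R.mem_cdisc v) (hv' ▸ R.mem_cdisc v')

/-- The open segments lie strictly inside all sides of the polygon but the last. -/
theorem seg_pos {b : Fin n} {z : ℂ} (hz : z ∈ R.seg b) (i : Fin (G.halfDegree e₀)) :
    0 < cr s (p i.succ - p i.castSucc) (z - p i.castSucc) := by
  have hp : ∀ z ∈ cdisc p s, 0 ≤ cr s (p i.succ - p i.castSucc) (z - p i.castSucc) := fun z hz => by
    have : 0 ≤ cr s (p (i.castSucc + 1) - p i.castSucc) (z - p i.castSucc) := hz i.castSucc rfl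
    rwa [Fin.coeSucc_eq_succ] at this
  have h1 := hp _ (R.segment_subset_cdisc b (left_mem_segment ℝ _ _))
  have h2 := hp _ (R.segment_subset_cdisc b (right_mem_segment ℝ _ _))
  have h3 : cr s (p i.succ - p i.castSucc) (R.finish b - p i.castSucc) -
      cr s (p i.succ - p i.castSucc) (R.start b - p i.castSucc) =
      (R.hi b - R.lo b) * cr s (p i.succ - p i.castSucc) (g b) := by
    rw [← cr_sub, ← cr_smul]; congr 1; rw [finish, start]; module
  -- The two ends cannot both lie on the line of this side, since `g b` is not parallel to it. The
  -- closing side is different: it is parallel to `g b₀`.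
  have h4 : (R.hi b - R.lo b) * cr s (p i.succ - p i.castSucc) (g b) ≠ 0 := by
    refine mul_ne_zero (sub_pos.2 (R.lo_lt_hi b)).ne' ?_
    rw [cr_comm]; exact neg_ne_zero.2 (R.black_outer b i)
  obtain ⟨α, β, hα, hβ, hαβ, rfl⟩ := hz
  rw [combination_sub hαβ, cr_add, cr_smul, cr_smul]
  rcases h1.lt_or_eq with h1 | h1
  · nlinarith [mul_pos hα h1, mul_nonneg hβ.le h2]
  · rcases h2.lt_or_eq with h2 | h2
    · nlinarith [mul_pos hβ h2, mul_nonneg hα.le h1.le]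
    · rw [← h1, ← h2] at h3; simp only [sub_zero] at h3; exact absurd h3.symm h4

theorem polygon_notMem_seg (k : Fin (G.halfDegree e₀ + 1)) (b : Fin n) : p k ∉ R.seg b := by
  intro h
  induction k using Fin.cases with
  | zero => simpa using R.seg_pos h ⟨0, halfDegree_pos e₀⟩
  | succ i => simpa using R.seg_pos h i

end PlaneBipartiteGraph.Realization


/-! ### Disjointness of the segments -/

namespace PlanePolygon

open Equiv Filter Topology

variable {X ι : Type*} {σ : Perm X} {c : X → ι} {v : X → ℂ} {s : ℝ} {i : ι}

theorem eventually_mem_openTile [Finite X] {z d : ℂ} (hz : z ∈ closedTile s σ c v i)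
    (hd : ∀ x, c x = i → cr s (v (σ x) - v x) (z - v x) = 0 → 0 < cr s (v (σ x) - v x) d) :
    ∀ᶠ ε in 𝓝[>] (0 : ℝ), z + ε • d ∈ openTile s σ c v i := by
  simp only [openTile, Set.mem_ofPred_eq]
  refine eventually_all.2 fun x => ?_
  by_cases hx : c x = i
  swap
  · exact Eventually.of_forall fun _ h => absurd h hx
  have e : ∀ ε : ℝ, cr s (v (σ x) - v x) (z + ε • d - v x) =
      cr s (v (σ x) - v x) (z - v x) + ε * cr s (v (σ x) - v x) d := fun ε => by
    rw [← cr_smul, ← cr_add]; congr 1; ring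
  simp only [e]
  rcases (hz x hx).lt_or_eq with h | h
  · have : Tendsto (fun ε : ℝ => cr s (v (σ x) - v x) (z - v x) + ε * cr s (v (σ x) - v x) d)
        (𝓝[>] 0) (𝓝 (cr s (v (σ x) - v x) (z - v x) + 0 * cr s (v (σ x) - v x) d)) :=
      (Continuous.tendsto (by fun_prop) 0).mono_left nhdsWithin_le_nhds
    rw [zero_mul, add_zero] at this
    exact (this.eventually_const_lt h).mono fun _ h _ => h
  · filter_upwards [self_mem_nhdsWithin] with ε hε _
    rw [← h, zero_add]
    exact mul_pos hε (hd x hx h.symm)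

end PlanePolygon

namespace PlaneBipartiteGraph.Realization

open Equiv Finset BipartiteMap CyclicSign Matrix PlanePolygon Filter Topology
open scoped Classical

variable {n : ℕ} {G : PlaneBipartiteGraph n} {e₀ : G.edges} {ν : G.edges → ℝ}
  {K : Matrix (Fin n) (Fin n) ℝ} {f : Fin n → ℝ} {g : Fin n → ℂ}
  {p : Fin (G.halfDegree e₀ + 1) → ℂ} {ψ : G.DualVertex e₀ → ℂ} {s : ℝ}

variable (K f ψ) in
/-- The point `z` lies on the segment of `b`, at an edge of direction `τ` or between two such edges,
and at the side or corner of the tile of `w` there. -/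
def Touches (z : ℂ) (b : Fin n) (τ : ℝ) (w : Fin n) : Prop :=
  (∃ e : G.edges, e.1.1 = b ∧ 0 < τ * len K f e ∧ e.1.2 = w ∧
    z ∈ openSegment ℝ (corner ψ (Sum.inl e)) (corner ψ (G.whitePerm e₀ (Sum.inl e)))) ∨
  ∃ e : G.edges, e.1.1 = b ∧ 0 < τ * len K f e ∧ 0 < len K f e * len K f (G.rotB e) ∧ e ≠ e₀ ∧
    (∃ F, G.left e₀ e = Sum.inl F) ∧ ∃ x, G.white e₀ x = w ∧
      G.whiteTail e₀ (G.whitePerm e₀ x) = G.left e₀ e ∧ z = corner ψ (G.whitePerm e₀ x)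

variable (R : Realization G e₀ ν K f g p ψ s)
include R

theorem fold_extreme {x y : Option G.edges} (hxy : G.black e₀ y = G.black e₀ x) {τ : ℝ}
    (h1 : 0 < τ * blackStep (len K f) x)
    (h2 : τ * blackStep (len K f) (G.blackPerm e₀ x) < 0) :
    τ * coord g ψ y ≤ τ * coord g ψ (G.blackPerm e₀ x) := by
  rcases pos_and_pos_or_neg_and_neg_of_mul_pos h1 with ⟨hτ, h3⟩ | ⟨hτ, h3⟩
  · have h4 : blackStep (len K f) (G.blackPerm e₀ x) < 0 := by nlinarith
    rw [R.eq_hi h3 h4, ← hxy]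
    exact mul_le_mul_of_nonneg_left (R.le_hi y) hτ.le
  · have h4 : 0 < blackStep (len K f) (G.blackPerm e₀ x) := by nlinarith
    rw [R.eq_lo h3 h4, ← hxy]
    exact mul_le_mul_of_nonpos_left (R.lo_le y) hτ.le

/-- The image path of `b` runs over its segment once upwards and once downwards. Each run passes
`z`, either inside a dual edge, where `z` is on a side of a tile, or at a flat corner, where another
tile has a suitable corner. At `b₀` the downward run includes the boundary element, which has no
tile, hence the hypothesis `hb`. -/
theorem exists_touches {u : ℂ} (hu : Generic g p s u) {z : ℂ} {b : Fin n} (hz : z ∈ R.seg b)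
    {τ : ℝ} (hτ : τ = 1 ∨ τ = -1) (hb : τ = 1 ∨ b ≠ e₀.1.1) :
    ∃ w, Touches K f ψ z b τ w ∧ ∃ d, (d = u ∨ d = -u) ∧
      ∀ᶠ ε in 𝓝[>] (0 : ℝ), z + ε • d ∈ tile ψ s w := by
  have hdir : ∀ h : ℂ, cr s u h ≠ 0 → ∃ d, (d = u ∨ d = -u) ∧ 0 < cr s h d := fun h hh => by
    rcases lt_or_gt_of_ne hh with hh | hh
    · exact ⟨u, Or.inl rfl, by rw [cr_comm]; linarith⟩
    · exact ⟨-u, Or.inr rfl, by rw [cr_neg, cr_comm]; linarith⟩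
  obtain ⟨t, ht1, ht2, rfl⟩ := R.mem_seg.1 hz
  obtain ⟨b1, b2, b3⟩ := (R.exists_bot b).choose_spec
  obtain ⟨t1, t2, t3⟩ := (R.exists_top b).choose_spec
  have hends : ∃ x y, G.black e₀ x = b ∧ G.black e₀ y = b ∧ τ * coord g ψ x < τ * t ∧
      τ * t < τ * coord g ψ y := by
    have h1 : G.black e₀ (G.blackPerm e₀ (R.bot b)) = b := (black_blackPerm _).trans b1
    have h2 : G.black e₀ (G.blackPerm e₀ (R.top b)) = b := (black_blackPerm _).trans t1
    rcases hτ with rfl | rfl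
    · refine ⟨_, _, h1, h2, ?_, ?_⟩
      · rw [one_mul, one_mul]; exact ht1
      · rw [one_mul, one_mul]; exact ht2
    · refine ⟨_, _, h2, h1, ?_, ?_⟩
      · rw [neg_one_mul, neg_one_mul, neg_lt_neg_iff]; exact ht2
      · rw [neg_one_mul, neg_one_mul, neg_lt_neg_iff]; exact ht1
  obtain ⟨x₀, y₀, hx₀, hy₀, hx₀', hy₀'⟩ := hends
  obtain ⟨x, hx, hx1, hx2⟩ := exists_step (P := fun x => τ * coord g ψ x < τ * t) black_eq_iff
    hx₀' (not_lt.2 hy₀'.le) (hx₀.trans hy₀.symm)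
  rw [not_lt] at hx2
  have hxb := hx.trans hx₀
  have hcoord := R.coord_blackPerm x
  have hstep : 0 < τ * blackStep (len K f) x := by
    have : τ * coord g ψ (G.blackPerm e₀ x) = τ * coord g ψ x + τ * blackStep (len K f) x := by
      rw [hcoord]; ring
    linarith
  rcases x with _ | e
  · exfalso
    change 0 < τ * (-1 : ℝ) at hstep
    rcases hb with rfl | hb
    · norm_num at hstep
    · exact hb hxb.symm
  replace hxb : e.1.1 = b := hxb
  have hright : corner ψ (G.whitePerm e₀ (Sum.inl e)) = origin g ψ b + coord g ψ (some e) • g b := by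
    rw [corner, whiteTail_whitePerm]
    exact (R.blackTail_eq (some e)).trans (by rw [← hxb]; rfl)
  have hleft : corner ψ (Sum.inl e) =
      origin g ψ b + coord g ψ (G.blackPerm e₀ (some e)) • g b :=
    (R.blackHead_eq (some e)).trans (by rw [← hxb]; rfl)
  rcases hx2.lt_or_eq with hx2 | hx2
  · have hmem : origin g ψ b + t • g b ∈
        openSegment ℝ (corner ψ (Sum.inl e)) (corner ψ (G.whitePerm e₀ (Sum.inl e))) := by
      rw [hright, hleft]
      refine mem_openSegment_line.2 ⟨t, ?_, rfl⟩
      rcases hτ with rfl | rfl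
      · rw [openSegment_symm, openSegment_eq_Ioo (by linarith)]
        constructor <;> linarith
      · rw [openSegment_eq_Ioo (by linarith)]
        constructor <;> linarith
    refine ⟨e.1.2, Or.inl ⟨e, hxb, hstep, rfl, hmem⟩, ?_⟩
    obtain ⟨d, hd, hd'⟩ := hdir _ (Generic.side_ne R hu (Sum.inl e))
    refine ⟨d, hd, eventually_mem_openTile ?_ fun y hy hy0 => ?_⟩
    · refine convex_closedTile.openSegment_subset ((R.convex _).mem_closedTile rfl)
        ((R.convex _).mem_closedTile ?_) hmem
      rw [white_whitePerm]
    · rcases eq_or_ne y (Sum.inl e) with rfl | hne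
      · exact hd'
      · exact absurd hy0 ((R.convex _).pos_of_mem_openSegment white_whitePerm
          (x := Sum.inl e) rfl hy hne hmem).ne'
  · have hteq : coord g ψ (G.blackPerm e₀ (some e)) = t := by
      rcases hτ with rfl | rfl <;> linarith
    have hstep2 : 0 < τ * blackStep (len K f) (G.blackPerm e₀ (some e)) := by
      by_contra hcon
      have h3 : τ * blackStep (len K f) (G.blackPerm e₀ (some e)) < 0 :=
        lt_of_le_of_ne (not_lt.1 hcon) (mul_ne_zero (by rcases hτ with rfl | rfl <;> norm_num)
          (R.blackStep_ne _))
      have := R.fold_extreme (x := some e) (y := y₀) (hy₀.trans hxb.symm) hstep h3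
      rw [hteq] at this
      linarith
    have hne : e ≠ e₀ := by
      rintro rfl
      rw [blackPerm_some_self] at hstep2
      change 0 < τ * (-1 : ℝ) at hstep2
      rcases hb with rfl | hb
      · norm_num at hstep2
      · exact hb hxb.symm
    rw [blackPerm_some hne] at hstep2
    have hflat : 0 < len K f e * len K f (G.rotB e) := by
      have := mul_pos hstep hstep2
      change 0 < τ * len K f e * (τ * len K f (G.rotB e)) at this
      rcases hτ with rfl | rfl <;> linarith
    have hF : G.leftFace e ≠ G.leftFace e₀ := fun h => by
      have := R.count.not_flat e hne h
      linarith
    have hz0 : origin g ψ b + t • g b = ψ (G.left e₀ e) := by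
      rw [← hteq, ← hleft]; rfl
    -- The flat white corner of the face for the functional `u`. Both its sides have the same sign,
    -- so one of `u` and `-u` points into the tile.
    obtain ⟨x, hx, hxf⟩ := (R.white_count hu).2.2 ⟨_, hF⟩
    rw [← left_interior hF] at hx
    have hz1 : origin g ψ b + t • g b = corner ψ (G.whitePerm e₀ x) := by
      rw [hz0, corner, whiteTail_whitePerm, hx]
    refine ⟨G.white e₀ x, Or.inr ⟨e, hxb, hstep, hflat, hne, ⟨_, left_interior hF⟩, x, rfl,
      by rw [whiteTail_whitePerm, hx], hz1⟩, ?_⟩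
    obtain ⟨d, hd, hd'⟩ := hdir _ (Generic.side_ne R hu x)
    have hd'' : 0 < cr s (side ψ (G.whitePerm e₀ x)) d := by
      rw [cr_comm] at hd' ⊢
      rcases hd with rfl | rfl
      · rcases pos_and_pos_or_neg_and_neg_of_mul_pos hxf with ⟨h3, h4⟩ | ⟨h3, h4⟩ <;> linarith
      · rw [neg_cr] at hd' ⊢
        rcases pos_and_pos_or_neg_and_neg_of_mul_pos hxf with ⟨h3, h4⟩ | ⟨h3, h4⟩ <;> linarith
    refine ⟨d, hd, ?_⟩
    rw [hz1]
    refine eventually_mem_openTile ((R.convex _).mem_closedTile (white_whitePerm x))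
      fun y hy hy0 => ?_
    rcases eq_or_ne y x with rfl | hne1
    · exact hd'
    rcases eq_or_ne y (G.whitePerm e₀ x) with rfl | hne2
    · exact hd''
    · exact absurd hy0 ((R.convex _).left y _ hy (white_whitePerm x) hne2.symm
        fun h => hne1 ((G.whitePerm e₀).injective h).symm).ne'

theorem corner_injective {x y : G.edges ⊕ Fin (G.halfDegree e₀)} (h : G.white e₀ x = G.white e₀ y)
    (h' : corner ψ x = corner ψ y) : x = y := by
  by_contra hne
  have H := R.convex (G.white e₀ x)
  have hs : ∀ y, G.white e₀ y = G.white e₀ x → y ≠ x → y = G.whitePerm e₀ x ∨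
      corner ψ y ≠ corner ψ x := fun y hy hyx => by
    by_contra! hcon
    have := H.left x y rfl hy hyx hcon.1
    rw [hcon.2, sub_self, cr_zero] at this
    exact lt_irrefl _ this
  rcases hs y h.symm (Ne.symm hne) with h1 | h1
  · exact R.side_ne x (by rw [side, ← h1, h', sub_self])
  · exact h1 h'.symm

/-- A point on the boundary of a strictly convex tile determines the side or the corner there. A
side determines its edge, and a corner its face and thereby the only flat black corner of this face.
Either way `b` and the direction are known. -/
theorem Touches.unique {z : ℂ} {b b' w : Fin n} {τ τ' : ℝ} (h : Touches K f ψ z b τ w)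
    (h' : Touches K f ψ z b' τ' w) : b = b' ∧ 0 < τ * τ' := by
  have H := R.convex w
  have hσ := white_whitePerm (G := G.toBipartiteMap) (e₀ := e₀)
  have hsign : ∀ r : ℝ, 0 < τ * r → 0 < τ' * r → 0 < τ * τ' := fun r h1 h2 => by
    have h3 := mul_pos h1 h2
    have h4 : τ * r * (τ' * r) = (τ * τ') * r ^ 2 := by ring
    rw [h4] at h3
    exact pos_of_mul_pos_left h3 (sq_nonneg r)
  have hmixed : ∀ e : G.edges, ∀ x, e.1.2 = w → G.white e₀ x = w →
      z ∈ openSegment ℝ (corner ψ (Sum.inl e)) (corner ψ (G.whitePerm e₀ (Sum.inl e))) →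
      z = corner ψ (G.whitePerm e₀ x) → False := fun e x he hx hz hzx => by
    have h1 : x = Sum.inl e := by
      by_contra hne
      have := H.pos_of_mem_openSegment hσ (x := Sum.inl e) he hx hne hz
      rw [hzx, cr_self] at this
      exact lt_irrefl _ this
    have h2 : G.whitePerm e₀ x = Sum.inl e := by
      by_contra hne
      have := H.pos_of_mem_openSegment hσ (x := Sum.inl e) he ((hσ x).trans hx) hne hz
      rw [hzx, sub_self, cr_zero] at this
      exact lt_irrefl _ this
    exact H.ne_one x hx (h2.trans h1.symm)
  rcases h with ⟨e, rfl, h1, h2, h3⟩ | ⟨e, rfl, h1, h2, h3, ⟨F, hF⟩, x, h5, h6, h7⟩ <;>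
  rcases h' with ⟨e', rfl, h1', h2', h3'⟩ | ⟨e', rfl, h1', h2', h3', ⟨F', hF'⟩, x', h5', h6', h7'⟩
  · have : e' = e := by
      by_contra hne
      have := H.pos_of_mem_openSegment hσ (x := Sum.inl e) (y := Sum.inl e') h2 h2'
        (fun h => hne (Sum.inl_injective h)) h3
      rw [cr_eq_zero_of_mem_openSegment h3'] at this
      exact lt_irrefl _ this
    subst this
    exact ⟨rfl, hsign _ h1 h1'⟩
  · exact (hmixed e x' h2 h5' h3 h7').elim
  · exact (hmixed e' x h2' h5 h3' h7).elim
  · have hy := R.corner_injective (x := G.whitePerm e₀ x) (y := G.whitePerm e₀ x')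
      (by rw [hσ, hσ, h5, h5']) (by rw [← h7, ← h7'])
    have h8 : (Sum.inl F : G.DualVertex e₀) = Sum.inl F' := by
      rw [← hF, ← hF', ← h6, ← h6', hy]
    have h9 : F = F' := Sum.inl_injective h8
    have h10 : G.leftFace e = G.leftFace e' := by
      rw [leftFace_of_left_eq hF, leftFace_of_left_eq hF', h9]
    have := R.count.flat_unique e e' h10 h3 h3' h2 h2'
    subst this
    exact ⟨rfl, hsign _ h1 h1'⟩

/-- The segments of distinct black vertices are disjoint. -/
theorem disjoint_seg {b b' : Fin n} (hbb : b ≠ b') : Disjoint (R.seg b) (R.seg b') := by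
  wlog hb : b ≠ e₀.1.1 generalizing b b'
  · refine (this hbb.symm fun h => hbb ?_).symm
    rw [h]; exact not_not.1 hb
  rw [Set.disjoint_left]
  intro z hz hz'
  obtain ⟨u, hu⟩ := R.exists_generic
  -- Two runs of `b` and one of `b'` give three tiles at `z`, each containing a germ in one of the
  -- directions `u` and `-u`. Two of them share a direction, hence the tile, against
  -- `Touches.unique`. Both runs are available because `b` is not `b₀`.
  obtain ⟨w₁, t₁, d₁, hd₁, h₁⟩ := R.exists_touches hu hz (Or.inl rfl) (Or.inl rfl)
  obtain ⟨w₂, t₂, d₂, hd₂, h₂⟩ := R.exists_touches hu hz (Or.inr rfl) (Or.inr hb)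
  obtain ⟨w₃, t₃, d₃, hd₃, h₃⟩ := R.exists_touches hu hz' (Or.inl rfl) (Or.inl rfl)
  have key : ∀ {w w' d}, (∀ᶠ ε in 𝓝[>] (0 : ℝ), z + ε • d ∈ tile ψ s w) →
      (∀ᶠ ε in 𝓝[>] (0 : ℝ), z + ε • d ∈ tile ψ s w') → w = w' := fun {w w' d} h h' => by
    by_contra hne
    obtain ⟨ε, hε, hε'⟩ := (h.and h').exists
    exact Set.disjoint_left.1 (R.disjoint_tile hne) hε hε'
  have h12 : d₁ ≠ d₂ := by
    rintro rfl
    obtain rfl := key h₁ h₂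
    have := (Touches.unique R t₁ t₂).2
    norm_num at this
  have h13 : d₁ ≠ d₃ := by
    rintro rfl
    obtain rfl := key h₁ h₃
    exact hbb (Touches.unique R t₁ t₃).1
  have h23 : d₂ ≠ d₃ := by
    rintro rfl
    obtain rfl := key h₂ h₃
    exact hbb (Touches.unique R t₂ t₃).1
  rcases hd₁ with rfl | rfl <;> rcases hd₂ with rfl | rfl <;> rcases hd₃ with rfl | rfl <;> simp_all

end PlaneBipartiteGraph.Realization


/-! ### Roots, the unbounded component, and connectedness of the T-graph -/

namespace PlanePolygon

open Equiv

theorem not_isBounded_ray (z : ℂ) {d : ℂ} (hd : d ≠ 0) :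
    ¬ Bornology.IsBounded ((fun t : ℝ => z + t • d) '' Set.Ici 0) := by
  intro hb
  obtain ⟨M, hM⟩ := hb.exists_norm_le
  have hpos := norm_pos_iff.2 hd
  have ht : 0 ≤ (|M| + ‖z‖ + 1) / ‖d‖ := by positivity
  have h1 : ‖((|M| + ‖z‖ + 1) / ‖d‖) • d‖ = |M| + ‖z‖ + 1 := by
    rw [norm_smul, Real.norm_of_nonneg ht]
    field_simp
  have h2 := norm_sub_norm_le (((|M| + ‖z‖ + 1) / ‖d‖) • d) (-z)
  rw [h1, norm_neg, sub_neg_eq_add, add_comm _ z] at h2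
  have h3 := hM _ ⟨_, ht, rfl⟩
  have := le_abs_self M
  linarith

theorem isPreconnected_ray (z d : ℂ) :
    IsPreconnected ((fun t : ℝ => z + t • d) '' Set.Ici 0) :=
  isPreconnected_Ici.image _ (by fun_prop)

theorem cr_ray (s : ℝ) (h a z : ℂ) (t : ℝ) : cr s h (z + t • (-(s • (Complex.I * h))) - a) =
    cr s h (z - a) - t * (s ^ 2 * Complex.normSq h) := by
  have e : z + t • (-(s • (Complex.I * h))) - a = (z - a) + (-(t * s)) • (Complex.I * h) := by
    module
  rw [e, cr_add, cr_smul, cr_mul_I]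
  ring

theorem not_isBounded_halfPlane {s : ℝ} (hs : s ≠ 0) {h a : ℂ} (hh : h ≠ 0) :
    ¬ Bornology.IsBounded {z : ℂ | cr s h (z - a) < 0} := by
  have hd : -(s • (Complex.I * h)) ≠ 0 :=
    neg_ne_zero.2 (smul_ne_zero hs (mul_ne_zero Complex.I_ne_zero hh))
  have hn := Complex.normSq_pos.2 hh
  refine fun hb => not_isBounded_ray (a + (1 : ℝ) • -(s • (Complex.I * h))) hd (hb.subset ?_)
  rintro _ ⟨t, ht, rfl⟩
  change cr s h _ < 0
  rw [cr_ray, cr_ray, sub_self, cr_zero]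
  have ht' : 0 ≤ t := ht
  have : 0 < s ^ 2 * Complex.normSq h := by positivity
  nlinarith

theorem convex_neg (s : ℝ) (h a : ℂ) : Convex ℝ {z : ℂ | cr s h (z - a) < 0} := by
  have := convex_lt s (-h) a
  simpa only [neg_cr, Left.neg_pos_iff] using this

/-- A half-plane in the complement of a set lies in its unbounded part. -/
theorem halfPlane_subset_unboundedPart {s : ℝ} (hs : s ≠ 0) {h a : ℂ} (hh : h ≠ 0) {S : Set ℂ}
    (hS : ∀ z ∈ S, 0 ≤ cr s h (z - a)) : {z : ℂ | cr s h (z - a) < 0} ⊆ unboundedPart S := by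
  have h1 : {z : ℂ | cr s h (z - a) < 0} ⊆ Sᶜ := fun z hz hzS => not_le.2 hz (hS z hzS)
  refine fun z hz => ⟨h1 hz, fun hb => not_isBounded_halfPlane (a := a) hs hh (hb.subset ?_)⟩
  exact (convex_neg s h a).isPreconnected.subset_connectedComponentIn hz h1

theorem mem_closure_halfPlane {s : ℝ} (hs : s ≠ 0) {h : ℂ} (a : ℂ) (hh : h ≠ 0) :
    a ∈ closure {z : ℂ | cr s h (z - a) < 0} := by
  have hn := Complex.normSq_pos.2 hh
  rw [mem_closure_iff_seq_limit]
  refine ⟨fun k => a + (-(s * (1 / ((k : ℝ) + 1)))) • (Complex.I * h), fun k => ?_, ?_⟩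
  · change cr s h _ < 0
    rw [add_sub_cancel_left, cr_smul, cr_mul_I]
    have : 0 < s ^ 2 * (1 / ((k : ℝ) + 1)) * Complex.normSq h := by positivity
    nlinarith
  · have h1 := (tendsto_one_div_add_atTop_nhds_zero_nat (𝕜 := ℝ))
    have h2 : Filter.Tendsto (fun t : ℝ => a + (-(s * t)) • (Complex.I * h)) (nhds 0)
        (nhds (a + (-(s * 0)) • (Complex.I * h))) := Continuous.tendsto (by fun_prop) 0
    simp only [mul_zero, neg_zero, zero_smul, add_zero] at h2
    exact h2.comp h1

end PlanePolygon

namespace PlaneBipartiteGraph.Realization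

open Equiv Finset BipartiteMap CyclicSign Matrix PlanePolygon Filter Topology
open scoped Classical

variable {n : ℕ} {G : PlaneBipartiteGraph n} {e₀ : G.edges} {ν : G.edges → ℝ}
  {K : Matrix (Fin n) (Fin n) ℝ} {f : Fin n → ℝ} {g : Fin n → ℂ}
  {p : Fin (G.halfDegree e₀ + 1) → ℂ} {ψ : G.DualVertex e₀ → ℂ} {s : ℝ}

variable (R : Realization G e₀ ν K f g p ψ s)
include R

/-- The union of the segments. -/
abbrev union : Set ℂ := ⋃ b, R.seg b

theorem closure_union : closure R.union = ⋃ b, segment ℝ (R.start b) (R.finish b) := by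
  rw [union, closure_iUnion_of_finite]
  simp only [seg, closure_openSegment]

theorem closure_union_subset : closure R.union ⊆ cdisc p s := by
  rw [R.closure_union]
  exact Set.iUnion_subset R.segment_subset_cdisc

theorem polygon_mem_closure (k : Fin (G.halfDegree e₀ + 1)) : p k ∈ closure R.union := by
  obtain ⟨b, hb⟩ := R.endpoint (Sum.inr k)
  rw [R.outer] at hb
  rw [R.closure_union]
  refine Set.mem_iUnion.2 ⟨b, ?_⟩
  rcases hb with hb | hb <;> rw [hb]
  · exact left_mem_segment ℝ _ _
  · exact right_mem_segment ℝ _ _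

theorem polygon_notMem (k : Fin (G.halfDegree e₀ + 1)) : p k ∉ R.union := fun h => by
  obtain ⟨b, hb⟩ := Set.mem_iUnion.1 h
  exact R.polygon_notMem_seg k b hb

theorem closure_diff : closure R.union \ R.union = Set.range p := by
  refine Set.Subset.antisymm ?_ ?_
  · rintro z ⟨hz, hz'⟩
    rw [R.closure_union] at hz
    obtain ⟨b, hb⟩ := Set.mem_iUnion.1 hz
    have hends : ∃ v, ψ v = z := by
      rcases eq_or_ne z (R.start b) with rfl | h1
      · exact R.exists_start b
      rcases eq_or_ne z (R.finish b) with rfl | h2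
      · exact R.exists_finish b
      · have : z ∈ R.seg b := mem_openSegment_of_ne_left_right h1.symm h2.symm hb
        exact absurd (Set.mem_iUnion.2 ⟨b, this⟩) hz'
    obtain ⟨v, rfl⟩ := hends
    rcases v with F | k
    · obtain ⟨b', hb'⟩ := R.inl_mem_seg F
      exact absurd (Set.mem_iUnion.2 ⟨b', hb'⟩) hz'
    · exact ⟨k, (R.outer k).symm⟩
  · rintro _ ⟨k, rfl⟩
    exact ⟨R.polygon_mem_closure k, R.polygon_notMem k⟩

theorem range_subset_frontier : Set.range p ⊆ frontier (unboundedPart (closure R.union)) := by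
  rintro _ ⟨k, rfl⟩
  have h1 := halfPlane_subset_unboundedPart R.s_ne (a := p k) (R.polygon_side_ne k)
    (S := closure R.union) fun z hz => R.closure_union_subset hz k rfl
  refine ⟨closure_mono h1 (mem_closure_halfPlane R.s_ne _ (R.polygon_side_ne k)), fun h => ?_⟩
  exact (interior_subset h).1 (R.polygon_mem_closure k)

theorem seg_nonempty (b : Fin n) : (R.seg b).Nonempty := by
  rw [seg, openSegment_eq_image]
  exact Set.Nonempty.image _ ⟨1 / 2, by norm_num, by norm_num⟩

/-- The segment of a black vertex lies in the component of the image of any adjacent face. -/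
theorem seg_subset_component {b : Fin n} {z : ℂ} (hz : z ∈ R.union)
    (hb : z ∈ segment ℝ (R.start b) (R.finish b)) :
    R.seg b ⊆ connectedComponentIn R.union z := by
  have h1 : IsPreconnected (insert z (R.seg b)) := by
    refine (convex_openSegment (R.start b) (R.finish b)).isPreconnected.subset_closure
      (Set.subset_insert _ _) (Set.insert_subset ?_ subset_closure)
    rwa [closure_openSegment]
  exact (Set.subset_insert _ _).trans (h1.subset_connectedComponentIn (Set.mem_insert _ _)
    (Set.insert_subset hz (Set.subset_iUnion R.seg b)))

theorem component_iff {b b' : Fin n} {z y : ℂ} (hz : z ∈ R.union)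
    (hb : z ∈ segment ℝ (R.start b) (R.finish b)) (hb' : z ∈ segment ℝ (R.start b') (R.finish b'))
    (h : R.seg b ⊆ connectedComponentIn R.union y) : R.seg b' ⊆ connectedComponentIn R.union y := by
  obtain ⟨x, hx⟩ := R.seg_nonempty b
  rw [connectedComponentIn_eq (h hx),
    ← connectedComponentIn_eq (R.seg_subset_component hz hb hx)]
  exact R.seg_subset_component hz hb'

theorem isConnected_union : IsConnected R.union := by
  obtain ⟨y, hy⟩ := R.seg_nonempty e₀.1.1
  have hyU : y ∈ R.union := Set.mem_iUnion.2 ⟨_, hy⟩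
  let Q : Fin n → Prop := fun b => R.seg b ⊆ connectedComponentIn R.union y
  -- Consecutive edges at a white vertex share an interior face. Its image lies on both closed
  -- segments and, by `inl_mem_seg`, in the union.
  have hstep : ∀ e : G.edges, (¬ ∃ i, G.exitEdge e₀ i = e) → (Q (G.rotW e).1.1 ↔ Q e.1.1) :=
    fun e he => by
      have hF : G.leftFace (G.rotB.symm e) ≠ G.leftFace e₀ := fun h => he (exists_exitEdge h)
      have h1 := R.right_mem e
      have h2 := R.left_mem (G.rotW e)
      have h3 : G.left e₀ (G.rotW e) = G.right e₀ e := by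
        have := whiteTail_whitePerm (G := G.toBipartiteMap) (e₀ := e₀) (Sum.inl e)
        rwa [whitePerm_inl he] at this
      rw [h3] at h2
      have hU : ψ (G.right e₀ e) ∈ R.union := by
        rw [right_interior hF]
        exact Set.mem_iUnion.2 (R.inl_mem_seg _)
      exact ⟨R.component_iff hU h2 h1, R.component_iff hU h1 h2⟩
  have hstep' : ∀ e : G.edges, (if Q (G.rotW e).1.1 then (1 : ℝ) else 0) =
      if Q e.1.1 then 1 else 0 := fun e => by
    -- Across the outer face the common point may be a root outside the union. This happens at most
    -- once around each white vertex, so the other steps of the cycle imply this one.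
    by_cases he : ∃ i, G.exitEdge e₀ i = e
    · obtain ⟨i, rfl⟩ := he
      refine eq_of_forall_ne_step (σ := G.rotW) (c := fun e : G.edges => e.1.2) rotW_snd
        (fun e => if Q e.1.1 then (1 : ℝ) else 0) _ fun x hx hx' => ?_
      simp only [hstep x fun ⟨j, hj⟩ => hx' (by
        rw [← hj, R.exit_white_injective (i := j) (j := i) (by rw [hj]; exact hx)])]
    · simp only [hstep e he]
  have hQ : ∀ e : G.edges, Q (G.rotW e).1.1 = Q e.1.1 := fun e => by
    have := hstep' e
    by_cases h1 : Q (G.rotW e).1.1 <;> by_cases h2 : Q e.1.1 <;> simp_all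
  choose eW heW using G.exists_edge_snd
  have hconst := G.const_of_edges (F := Sum.elim Q (fun w => Q (eW w).1.1)) (fun e =>
      eq_of_step_eq (σ := G.rotW) (c := fun e : G.edges => e.1.2)
        (fun x y => (G.rotW_sameCycle x y).symm) (F := fun e => Q e.1.1) hQ (heW e.1.2).symm)
  have h0 : Q e₀.1.1 := (convex_openSegment _ _).isPreconnected.subset_connectedComponentIn hy
    (Set.subset_iUnion R.seg _)
  have hall : ∀ b, Q b := fun b => by
    have := hconst (Sum.inl b) (Sum.inl e₀.1.1)
    simp only [Sum.elim_inl] at this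
    rw [this]; exact h0
  have : R.union = connectedComponentIn R.union y :=
    Set.Subset.antisymm (Set.iUnion_subset hall) (connectedComponentIn_subset _ _)
  rw [this]
  exact isConnected_connectedComponentIn_iff.2 hyU

theorem isTGraph : IsTGraph R.seg (Set.range p) where
  isSegment b := ⟨_, _, R.start_ne b, rfl⟩
  disjoint _ _ h := R.disjoint_seg h
  connected := R.isConnected_union
  roots := R.closure_diff
  finite := Set.finite_range p
  outer := R.range_subset_frontier

end PlaneBipartiteGraph.Realization


/-! ### An enclosing curve with convex interior -/

namespace PlanePolygon

open Set Metric Bornology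

theorem ray_subset_compl {D : Set ℂ} (hD : Convex ℝ D) {o z : ℂ} (ho : o ∈ D) (hz : z ∉ D) :
    (fun t : ℝ => z + t • (z - o)) '' Ici 0 ⊆ Dᶜ := by
  rintro _ ⟨t, ht, rfl⟩ hy
  have ht' : (0 : ℝ) ≤ t := ht
  refine hz ?_
  have := hD hy ho (a := 1 / (1 + t)) (b := t / (1 + t)) (by positivity) (by positivity)
    (by field_simp)
  convert this using 1
  have h1 : (1 + t : ℝ) ≠ 0 := by positivity
  rw [smul_add, smul_smul, add_assoc]
  have e : z = (1 / (1 + t)) • z + ((t / (1 + t)) • z) := by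
    rw [← add_smul, ← add_div, div_self h1, one_smul]
  conv_lhs => rw [e]
  rw [smul_sub, show 1 / (1 + t) * t = t / (1 + t) by ring]
  abel

theorem boundedPart_frontier {D : Set ℂ} (hD : Convex ℝ D) (hc : IsClosed D) (hb : IsBounded D)
    (hne : (interior D).Nonempty) : boundedPart (frontier D) = interior D := by
  have hsub : (frontier D)ᶜ ⊆ interior D ∪ Dᶜ := fun z hz => by
    by_cases h : z ∈ interior D
    · exact Or.inl h
    · exact Or.inr fun h' => hz ⟨subset_closure h', h⟩
  have hd : Disjoint (interior D) Dᶜ := disjoint_compl_right.mono_left interior_subset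
  refine Subset.antisymm ?_ fun z hz => ?_
  · rintro z ⟨hz, hzb⟩
    by_contra hzi
    have hzD : z ∉ D := (hsub hz).resolve_left hzi
    obtain ⟨o, ho⟩ := hne
    have h1 : Dᶜ ⊆ (frontier D)ᶜ := compl_subset_compl.2 hc.frontier_subset
    have hne' : z - o ≠ 0 := fun h => hzD (by rw [sub_eq_zero.1 h]; exact interior_subset ho)
    refine not_isBounded_ray z hne' (hzb.subset ?_)
    exact (isPreconnected_ray z (z - o)).subset_connectedComponentIn ⟨0, self_mem_Ici, by simp⟩
      ((ray_subset_compl hD (interior_subset ho) hzD).trans h1)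
  · have hz' : z ∈ (frontier D)ᶜ := fun h => h.2 hz
    refine ⟨hz', (hb.subset interior_subset).subset ?_⟩
    exact isPreconnected_connectedComponentIn.subset_left_of_subset_union isOpen_interior
      hc.isOpen_compl hd ((connectedComponentIn_subset _ _).trans hsub)
      ⟨z, mem_connectedComponentIn hz', hz⟩

/-- The boundary of a convex body in the plane is a simple closed curve. -/
theorem exists_simpleClosed_frontier {D : Set ℂ} (hD : Convex ℝ D) (hb : IsBounded D)
    (hne : (interior D).Nonempty) :
    ∃ γ : Circle → ℂ, Continuous γ ∧ Function.Injective γ ∧ range γ = frontier D := by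
  obtain ⟨h, -, -, h3⟩ := exists_homeomorph_image_interior_closure_frontier_eq_unitBall hD hne hb
  refine ⟨fun t => h.symm t, by fun_prop, fun x y hxy => Subtype.ext (h.symm.injective hxy), ?_⟩
  have h4 : range (fun t : Circle => (t : ℂ)) = sphere 0 1 := by
    ext z
    simp only [mem_range, mem_sphere_iff_norm, sub_zero]
    exact ⟨by rintro ⟨t, rfl⟩; exact t.norm_coe, fun hz => ⟨⟨z, mem_sphere_zero_iff_norm.2 hz⟩, rfl⟩⟩
  rw [show (fun t : Circle => h.symm (t : ℂ)) = h.symm ∘ fun t : Circle => (t : ℂ) from rfl,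
    range_comp, h4, ← h3, ← image_comp, h.symm_comp_self, image_id]

end PlanePolygon

namespace PlaneBipartiteGraph.Realization

open Equiv Finset BipartiteMap CyclicSign Matrix PlanePolygon Filter Topology
open scoped Classical

variable {n : ℕ} {G : PlaneBipartiteGraph n} {e₀ : G.edges} {ν : G.edges → ℝ}
  {K : Matrix (Fin n) (Fin n) ℝ} {f : Fin n → ℝ} {g : Fin n → ℂ}
  {p : Fin (G.halfDegree e₀ + 1) → ℂ} {ψ : G.DualVertex e₀ → ℂ} {s : ℝ}

variable (R : Realization G e₀ ν K f g p ψ s)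
include R

theorem isCompact_closure_union : IsCompact (closure R.union) := by
  rw [R.closure_union]
  refine isCompact_iUnion fun b => ?_
  rw [segment_eq_image_lineMap]
  exact isCompact_Icc.image (by fun_prop)

/-- There is an enclosing curve with convex interior. -/
theorem exists_enclosingCurve :
    ∃ C, IsEnclosingCurve R.seg (Set.range p) C ∧ Convex ℝ (boundedPart C) := by
  obtain ⟨r, hr⟩ := R.isCompact_closure_union.isBounded.subset_ball 0
  -- The supporting line at `p (k + 1)` is taken parallel to the diagonal between its neighbours, so
  -- that it touches the polygon only in that vertex. The disc makes the domain bounded.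
  let h : Fin (G.halfDegree e₀ + 1) → ℂ := fun k => p (k + 1 + 1) - p k
  let D : Set ℂ := {z | ∀ k, 0 ≤ cr s (h k) (z - p (k + 1))} ∩ Metric.closedBall 0 r
  let E : Set ℂ := {z | ∀ k, 0 < cr s (h k) (z - p (k + 1))} ∩ Metric.ball 0 r
  have hsplit : ∀ k z, cr s (h k) (z - p (k + 1)) = cr s (p (k + 1) - p k) (z - p k) +
      cr s (p (k + 1 + 1) - p (k + 1)) (z - p (k + 1)) := fun k z => by
    have e1 : h k = (p (k + 1) - p k) + (p (k + 1 + 1) - p (k + 1)) := by simp only [h]; ring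
    rw [e1, add_cr, show z - p (k + 1) = (z - p k) + -(p (k + 1) - p k) by ring, cr_add s (p (k + 1) - p k),
      cr_neg, cr_self]
    ring
  have hh : ∀ k, h k ≠ 0 := fun k => by
    intro h0
    have h1 := R.polygon.turn (fun _ => rfl) (x := k) rfl
    change 0 < cr s (p (k + 1) - p k) (p (k + 1 + 1) - p (k + 1)) at h1
    rw [sub_eq_zero.1 h0, ← neg_sub, neg_cr, cr_self, neg_zero] at h1
    exact lt_irrefl _ h1
  have hE : IsOpen E := by
    refine IsOpen.inter ?_ Metric.isOpen_ball
    have : {z | ∀ k, 0 < cr s (h k) (z - p (k + 1))} =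
      ⋂ k, {z | 0 < cr s (h k) (z - p (k + 1))} := by ext; simp
    rw [this]
    exact isOpen_iInter_of_finite fun k => PlanePolygon.isOpen_lt s _ _
  have hED : E ⊆ D := fun z hz => ⟨fun k => (hz.1 k).le, Metric.ball_subset_closedBall hz.2⟩
  have hD : Convex ℝ D := by
    refine Convex.inter ?_ (convex_closedBall _ _)
    have : {z | ∀ k, 0 ≤ cr s (h k) (z - p (k + 1))} =
      ⋂ k, {z | 0 ≤ cr s (h k) (z - p (k + 1))} := by ext; simp
    rw [this]
    exact convex_iInter fun k => convex_le s _ _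
  have hDc : IsClosed D := by
    refine IsClosed.inter ?_ Metric.isClosed_closedBall
    have : {z | ∀ k, 0 ≤ cr s (h k) (z - p (k + 1))} =
      ⋂ k, {z | 0 ≤ cr s (h k) (z - p (k + 1))} := by ext; simp
    rw [this]
    exact isClosed_iInter fun k => PlanePolygon.isClosed_le s _ _
  have hDb : Bornology.IsBounded D := Metric.isBounded_closedBall.subset Set.inter_subset_right
  have hU : R.union ⊆ E := by
    intro z hz
    refine ⟨fun k => ?_, hr (subset_closure hz)⟩
    obtain ⟨b, hb⟩ := Set.mem_iUnion.1 hz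
    have h0 : ∀ k, 0 ≤ cr s (p (k + 1) - p k) (z - p k) := fun k =>
      R.closure_union_subset (subset_closure hz) k rfl
    have h1 : ∀ k, k ≠ Fin.last _ → 0 < cr s (p (k + 1) - p k) (z - p k) := fun k hk => by
      induction k using Fin.lastCases with
      | last => exact absurd rfl hk
      | cast i => rw [Fin.coeSucc_eq_succ]; exact R.seg_pos hb i
    rw [hsplit]
    -- The inequality at a vertex is the sum of those of its two sides. Only the closing side can be
    -- met by the segments, and it is at most one of the two.
    by_cases hk : k = Fin.last _
    · refine add_pos_of_nonneg_of_pos (h0 k) (h1 _ fun h => ?_)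
      exact R.polygon.ne_one k rfl (h.trans hk.symm)
    · exact add_pos_of_pos_of_nonneg (h1 k hk) (h0 _)
  have hEi : E ⊆ interior D := interior_maximal hED hE
  have hne : (interior D).Nonempty := by
    obtain ⟨z, hz⟩ := R.seg_nonempty e₀.1.1
    exact ⟨z, hEi (hU (Set.mem_iUnion.2 ⟨_, hz⟩))⟩
  have hbp := boundedPart_frontier hD hDc hDb hne
  refine ⟨frontier D, ⟨exists_simpleClosed_frontier hD hDb hne, ?_, ?_⟩, ?_⟩
  · rw [hbp]; exact hU.trans hEi
  · rintro _ ⟨k, rfl⟩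
    refine ⟨subset_closure ⟨fun j => ?_, Metric.ball_subset_closedBall (hr (R.polygon_mem_closure k))⟩,
      fun hk => ?_⟩
    · rw [hsplit]
      have h0 : ∀ j, 0 ≤ cr s (p (j + 1) - p j) (p k - p j) := fun j =>
        R.closure_union_subset (R.polygon_mem_closure k) j rfl
      exact add_nonneg (h0 _) (h0 _)
    · obtain ⟨j, rfl⟩ : ∃ j, j + 1 = k := ⟨k - 1, sub_add_cancel _ _⟩
      obtain ⟨y, hy, hy'⟩ := mem_closure_iff.1 (mem_closure_halfPlane R.s_ne (p (j + 1)) (hh j))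
        _ isOpen_interior hk
      exact absurd ((interior_subset hy).1 j) (not_le.2 hy')
  · rw [hbp]; exact hD.interior

end PlaneBipartiteGraph.Realization


/-! ### The faces cut out by an enclosing curve -/

namespace PlanePolygon

open Set Bornology

variable {C : Set ℂ}

theorem isOpen_boundedPart (hC : IsClosed C) : IsOpen (boundedPart C) := by
  refine isOpen_iff_forall_mem_open.2 fun z hz =>
    ⟨connectedComponentIn Cᶜ z, fun y hy => ?_, hC.isOpen_compl.connectedComponentIn,
      mem_connectedComponentIn hz.1⟩
  exact ⟨connectedComponentIn_subset _ _ hy, connectedComponentIn_eq hy ▸ hz.2⟩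

theorem closure_boundedPart_subset (hC : IsClosed C) :
    closure (boundedPart C) ⊆ boundedPart C ∪ C := by
  intro z hz
  by_cases hzC : z ∈ C
  · exact Or.inr hzC
  obtain ⟨y, hy, hyB⟩ := mem_closure_iff.1 hz _ hC.isOpen_compl.connectedComponentIn
    (mem_connectedComponentIn hzC)
  exact Or.inl ⟨hzC, connectedComponentIn_eq hy ▸ hyB.2⟩

theorem isBounded_boundedPart (h : IsPreconnected (boundedPart C)) : IsBounded (boundedPart C) := by
  rcases (boundedPart C).eq_empty_or_nonempty with h0 | ⟨z, hz⟩
  · rw [h0]; exact isBounded_empty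
  · exact hz.2.subset (h.subset_connectedComponentIn hz fun y hy => hy.1)

theorem component_subset_boundedPart {V : Set ℂ} (hV : C ⊆ V) {z : ℂ} (hz : z ∈ boundedPart C) :
    connectedComponentIn Vᶜ z ⊆ boundedPart C := fun y hy => by
  have h := connectedComponentIn_mono z (compl_subset_compl.2 hV) hy
  exact ⟨connectedComponentIn_subset _ _ h, connectedComponentIn_eq h ▸ hz.2⟩

/-- Outside the curve the set `U` is not seen, so removing it in addition to `C` does not change the
component. -/
theorem mem_boundedPart_of_isBounded {U : Set ℂ} (hU : U ⊆ boundedPart C) {z : ℂ} (hz : z ∉ C)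
    (hb : IsBounded (connectedComponentIn (U ∪ C)ᶜ z)) : z ∈ boundedPart C := by
  by_contra hzB
  refine hzB ⟨hz, hb.subset (isPreconnected_connectedComponentIn.subset_connectedComponentIn
    (mem_connectedComponentIn hz) fun y hy => ?_)⟩
  rintro (hyU | hyC)
  · exact hzB ⟨hz, connectedComponentIn_eq hy ▸ (hU hyU).2⟩
  · exact connectedComponentIn_subset _ _ hy hyC

theorem component_eq_of_cover {V A A' : Set ℂ} (hA : IsOpen A) (hA' : IsOpen A')
    (hd : Disjoint A A') (hpre : IsPreconnected A) (hAV : A ⊆ Vᶜ) {z : ℂ} (hz : z ∈ A)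
    (hcov : connectedComponentIn Vᶜ z ⊆ A ∪ A') : A = connectedComponentIn Vᶜ z :=
  Subset.antisymm (hpre.subset_connectedComponentIn hz hAV)
    (isPreconnected_connectedComponentIn.subset_left_of_subset_union hA hA' hd hcov
      ⟨z, mem_connectedComponentIn (hAV hz), hz⟩)

theorem exists_smul_of_cr_eq_zero {s : ℝ} (hs : s ≠ 0) {h d : ℂ} (hh : h ≠ 0)
    (hd : cr s h d = 0) : ∃ t : ℝ, d = t • h := by
  have h0 : h.re * d.im - h.im * d.re = 0 := (mul_eq_zero.1 hd).resolve_left hs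
  have hn := (Complex.normSq_pos.2 hh).ne'
  refine ⟨(h.re * d.re + h.im * d.im) / Complex.normSq h, ?_⟩
  rw [Complex.normSq_apply] at *
  apply Complex.ext
  · rw [Complex.real_smul, Complex.re_ofReal_mul, div_mul_eq_mul_div, eq_div_iff hn]
    linear_combination -h.im * h0
  · rw [Complex.real_smul, Complex.im_ofReal_mul, div_mul_eq_mul_div, eq_div_iff hn]
    linear_combination h.re * h0

end PlanePolygon

namespace PlaneBipartiteGraph.Realization

open Equiv Finset BipartiteMap CyclicSign Matrix PlanePolygon Filter Topology
open scoped Classical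

variable {n : ℕ} {G : PlaneBipartiteGraph n} {e₀ : G.edges} {ν : G.edges → ℝ}
  {K : Matrix (Fin n) (Fin n) ℝ} {f : Fin n → ℝ} {g : Fin n → ℂ}
  {p : Fin (G.halfDegree e₀ + 1) → ℂ} {ψ : G.DualVertex e₀ → ℂ} {s : ℝ}

variable (p s) in
/-- The signed distance (up to a factor) from the `k`-th side of the outer polygon. -/
noncomputable def ell (k : Fin (G.halfDegree e₀ + 1)) (z : ℂ) : ℝ := cr s (p (k + 1) - p k) (z - p k)

@[fun_prop]
theorem continuous_ell (k : Fin (G.halfDegree e₀ + 1)) : Continuous (ell p s k) := by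
  unfold ell; fun_prop

theorem ell_combination (k : Fin (G.halfDegree e₀ + 1)) {α β : ℝ} (h : α + β = 1) (x y : ℂ) :
    ell p s k (α • x + β • y) = α * ell p s k x + β * ell p s k y := by
  rw [ell, combination_sub h, cr_add, cr_smul, cr_smul]; rfl

theorem convex_ell_nonpos (k : Fin (G.halfDegree e₀ + 1)) : Convex ℝ {z | ell p s k z ≤ 0} := by
  intro x hx y hy α β hα hβ hαβ
  change ell p s k _ ≤ 0
  rw [ell_combination k hαβ]
  exact add_nonpos (mul_nonpos_of_nonneg_of_nonpos hα hx) (mul_nonpos_of_nonneg_of_nonpos hβ hy)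

variable (R : Realization G e₀ ν K f g p ψ s)

/-- A convex domain containing the segments, but not the vertices of the outer polygon. -/
structure Domain (B : Set ℂ) : Prop where
  convex : Convex ℝ B
  isOpen : IsOpen B
  union_subset : R.union ⊆ B
  notMem : ∀ k, p k ∉ B

variable (p ψ s) in
/-- The part of the domain assigned to a white vertex. -/
def region (B : Set ℂ) (w : Fin n) : Set ℂ :=
  {z | z ∈ B ∧ (z ∈ tile ψ s w ∨
    ∃ i : Fin (G.halfDegree e₀), (G.exitEdge e₀ i).1.2 = w ∧ ell p s i.castSucc z ≤ 0)}

variable (p s) in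
/-- The part of the domain assigned to the dual root. -/
def rootRegion (B : Set ℂ) : Set ℂ :=
  {z | z ∈ B ∧ ell p s (Fin.last (G.halfDegree e₀)) z < 0}

section

include R

theorem ell_pos {z : ℂ} (hz : z ∈ R.union) (i : Fin (G.halfDegree e₀)) :
    0 < ell p s i.castSucc z := by
  obtain ⟨b, hb⟩ := Set.mem_iUnion.1 hz
  rw [ell, Fin.coeSucc_eq_succ]; exact R.seg_pos hb i

theorem ell_nonneg {z : ℂ} (hz : z ∈ R.union) (k : Fin (G.halfDegree e₀ + 1)) :
    0 ≤ ell p s k z := R.closure_union_subset (subset_closure hz) k rfl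

theorem ell_pos_of_mem_tile {w : Fin n} {z : ℂ} (hz : z ∈ tile ψ s w)
    (k : Fin (G.halfDegree e₀ + 1)) : 0 < ell p s k z := R.tile_subset_disc w hz k rfl

theorem corner_inr (i : Fin (G.halfDegree e₀)) : corner ψ (Sum.inr i) = p i.castSucc := R.outer _

theorem corner_whitePerm_inr (i : Fin (G.halfDegree e₀)) :
    corner ψ (G.whitePerm e₀ (Sum.inr i)) = p (i.castSucc + 1) := by
  rw [corner, whiteTail_whitePerm, Fin.coeSucc_eq_succ]; exact R.outer _

theorem tile_nonempty (w : Fin n) : (tile ψ s w).Nonempty :=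
  (R.convex w).openTile_nonempty white_whitePerm (exists_white w)

end

namespace Domain

variable {R} {B : Set ℂ} (D : R.Domain B)
include D

theorem cdisc_subset : cdisc p s ⊆ closure B := by
  refine (R.polygon.closedTile_subset (fun _ => rfl) ⟨0, rfl⟩).trans
    (convexHull_min ?_ D.convex.closure)
  rintro _ ⟨k, -, rfl⟩
  exact closure_mono D.union_subset (R.polygon_mem_closure k)

theorem disc_subset : disc p s ⊆ B := by
  obtain ⟨z, hz⟩ := R.isConnected_union.nonempty
  have hne : (interior B).Nonempty := ⟨z, by rw [D.isOpen.interior_eq]; exact D.union_subset hz⟩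
  have := interior_maximal (openTile_subset.trans D.cdisc_subset)
    (isOpen_openTile (s := s) (σ := Equiv.addRight (1 : Fin (G.halfDegree e₀ + 1)))
      (c := fun _ => ()) (v := p) (i := ()))
  rwa [D.convex.interior_closure_eq_interior_of_nonempty_interior hne, D.isOpen.interior_eq] at this

theorem tile_subset (w : Fin n) : tile ψ s w ⊆ B := (R.tile_subset_disc w).trans D.disc_subset

/-- The domain meets the line of a side of the polygon inside this side. -/
theorem mem_openSegment {z : ℂ} (hz : z ∈ B) {k : Fin (G.halfDegree e₀ + 1)}
    (hk : ell p s k z = 0) : z ∈ openSegment ℝ (p k) (p (k + 1)) := by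
  obtain ⟨t, ht⟩ := exists_smul_of_cr_eq_zero R.s_ne (R.polygon_side_ne k) hk
  set h := p (k + 1) - p k with hh
  have hzt : z = p k + t • h := by rw [← ht]; ring
  have h0 : p k = p k + (0 : ℝ) • h := by simp
  have h1 : p (k + 1) = p k + (1 : ℝ) • h := by simp [hh]
  have hcl : ∀ j, p j ∈ closure B := fun j =>
    closure_mono D.union_subset (R.polygon_mem_closure j)
  have hopen : ∀ j, openSegment ℝ z (p j) ⊆ B := fun j => by
    have := D.convex.openSegment_interior_closure_subset_interior
      (by rwa [D.isOpen.interior_eq]) (hcl j)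
    rwa [D.isOpen.interior_eq] at this
  -- Otherwise `p k` would be `z` itself or lie strictly between `z` and `p (k + 1)`, a point of the
  -- closure of `B`, and so belong to `B`.
  have ht0 : 0 < t := by
    by_contra hcon
    rcases (not_lt.1 hcon).lt_or_eq with hlt | rfl
    · refine D.notMem k (hopen (k + 1) ?_)
      rw [hzt, h1]
      refine mem_openSegment_line.2 ⟨0, ?_, h0⟩
      rw [openSegment_eq_Ioo (by linarith)]
      exact ⟨hlt, one_pos⟩
    · exact D.notMem k (by rwa [hzt, zero_smul, add_zero] at hz)
  have ht1 : t < 1 := by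
    by_contra hcon
    rcases (not_lt.1 hcon).lt_or_eq with hlt | rfl
    · refine D.notMem (k + 1) (hopen k ?_)
      rw [hzt]
      nth_rewrite 2 [h0]
      refine mem_openSegment_line.2 ⟨1, ?_, h1⟩
      rw [openSegment_symm, openSegment_eq_Ioo (by linarith)]
      exact ⟨one_pos, hlt⟩
    · exact D.notMem (k + 1) (by rwa [hzt, ← h1] at hz)
  rw [hzt, h1]
  nth_rewrite 1 [h0]
  refine mem_openSegment_line.2 ⟨t, ?_, rfl⟩
  rw [openSegment_eq_Ioo one_pos]
  exact ⟨ht0, ht1⟩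

/-- On the segment to an inner point, a point outside of a side passes through this side. -/
theorem exists_crossing {z : ℂ} (hz : z ∈ B) {k : Fin (G.halfDegree e₀ + 1)}
    (hk : ell p s k z ≤ 0) {o : ℂ} (ho : o ∈ disc p s) : ∃ y ∈ B, ell p s k y = 0 ∧
      ∀ j ≠ k, 0 < ell p s j z * ell p s k o - ell p s k z * ell p s j o := by
  have hko : 0 < ell p s k o := ho k rfl
  set d := ell p s k o - ell p s k z with hd
  have hd0 : 0 < d := by linarith
  have hsum : ell p s k o / d + -ell p s k z / d = 1 := by
    rw [← add_div, ← sub_eq_add_neg, ← hd, div_self hd0.ne']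
  have hy : (ell p s k o / d) • z + (-ell p s k z / d) • o ∈ B :=
    D.convex hz (D.disc_subset ho) (by positivity) (div_nonneg (by linarith) hd0.le) hsum
  have h0 : ell p s k ((ell p s k o / d) • z + (-ell p s k z / d) • o) = 0 := by
    rw [ell_combination k hsum]; ring
  refine ⟨_, hy, h0, fun j hj => ?_⟩
  have h1 : 0 < ell p s j _ := R.polygon.pos_of_mem_openSegment (fun _ => rfl) (x := k) rfl rfl hj
    (D.mem_openSegment hy h0)
  rw [ell_combination j hsum] at h1
  have h2 := mul_pos h1 hd0
  have e : (ell p s k o / d * ell p s j z + -ell p s k z / d * ell p s j o) * d =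
      ell p s j z * ell p s k o - ell p s k z * ell p s j o := by
    field_simp
    ring
  rwa [e] at h2

/-- For a point on or beyond two sides, the strict inequalities of `exists_crossing` for these sides
contradict each other. -/
theorem ell_pos_of_nonpos {z : ℂ} (hz : z ∈ B) {k j : Fin (G.halfDegree e₀ + 1)}
    (hk : ell p s k z ≤ 0) (hj : j ≠ k) : 0 < ell p s j z := by
  by_contra hcon
  obtain ⟨o, ho⟩ := R.polygon.openTile_nonempty (fun _ => rfl) ⟨0, rfl⟩
  obtain ⟨-, -, -, h1⟩ := D.exists_crossing hz hk ho
  obtain ⟨-, -, -, h2⟩ := D.exists_crossing hz (not_lt.1 hcon) ho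
  have := h1 j hj
  have := h2 k hj.symm
  linarith

theorem mem_openSegment_corner {z : ℂ} (hz : z ∈ B) {i : Fin (G.halfDegree e₀)}
    (hi : ell p s i.castSucc z = 0) :
    z ∈ openSegment ℝ (corner ψ (Sum.inr i)) (corner ψ (G.whitePerm e₀ (Sum.inr i))) := by
  rw [R.corner_inr, R.corner_whitePerm_inr]
  exact D.mem_openSegment hz hi

theorem isOpen_region (w : Fin n) : IsOpen (region p ψ s B w) := by
  refine isOpen_iff_mem_nhds.2 ?_
  rintro z ⟨hz, h | ⟨i, rfl, hi⟩⟩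
  · exact mem_of_superset ((D.isOpen.inter isOpen_openTile).mem_nhds ⟨hz, h⟩)
      fun y hy => ⟨hy.1, Or.inl hy.2⟩
  rcases hi.lt_or_eq with hi | hi
  · have : IsOpen (B ∩ {y | ell p s i.castSucc y < 0}) :=
      D.isOpen.inter (_root_.isOpen_lt (continuous_ell _) continuous_const)
    exact mem_of_superset (this.mem_nhds ⟨hz, hi⟩)
      fun y hy => ⟨hy.1, Or.inr ⟨i, rfl, le_of_lt hy.2⟩⟩
  -- On the side itself all other inequalities of the tile are strict. Nearby points therefore lie
  -- in the tile or in the part beyond the side.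
  · have hseg := D.mem_openSegment_corner hz hi
    have hpos : ∀ x, ∀ᶠ y in 𝓝 z, G.white e₀ x = (G.exitEdge e₀ i).1.2 → x ≠ Sum.inr i →
        0 < cr s (side ψ x) (y - corner ψ x) := fun x => by
      by_cases hx : G.white e₀ x = (G.exitEdge e₀ i).1.2 ∧ x ≠ Sum.inr i
      · have h0 : z ∈ {y | 0 < cr s (side ψ x) (y - corner ψ x)} :=
          (R.convex _).pos_of_mem_openSegment white_whitePerm (x := Sum.inr i) rfl hx.1 hx.2 hseg
        filter_upwards [(PlanePolygon.isOpen_lt s _ _).mem_nhds h0] with y hy _ _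
        exact hy
      · exact Eventually.of_forall fun y h1 h2 => absurd ⟨h1, h2⟩ hx
    filter_upwards [D.isOpen.mem_nhds hz, eventually_all.2 hpos] with y hyB hy
    refine ⟨hyB, or_iff_not_imp_right.2 fun hcon x hx => ?_⟩
    push Not at hcon
    rcases eq_or_ne x (Sum.inr i) with rfl | hne
    · rw [R.corner_inr, R.corner_whitePerm_inr]
      exact hcon i rfl
    · exact hy x hx hne

theorem isPreconnected_region (w : Fin n) : IsPreconnected (region p ψ s B w) := by
  by_cases h : ∃ i : Fin (G.halfDegree e₀), (G.exitEdge e₀ i).1.2 = w ∧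
    ∃ z ∈ B, ell p s i.castSucc z ≤ 0
  · obtain ⟨i, rfl, z, hz, hzi⟩ := h
    obtain ⟨o, ho⟩ := R.polygon.openTile_nonempty (fun _ => rfl) ⟨0, rfl⟩
    obtain ⟨y, hy, hy0, -⟩ := D.exists_crossing hz hzi ho
    -- The tile and the part beyond its outer side are convex. They are joined at a point `y` of
    -- that side.
    have e : region p ψ s B (G.exitEdge e₀ i).1.2 =
        insert y (tile ψ s (G.exitEdge e₀ i).1.2) ∪ (B ∩ {z | ell p s i.castSucc z ≤ 0}) := by
      ext x
      constructor
      · rintro ⟨hx, h | ⟨j, hj, hxj⟩⟩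
        · exact Or.inl (Or.inr h)
        · rw [R.exit_white_injective hj] at hxj
          exact Or.inr ⟨hx, hxj⟩
      · rintro ((rfl | h) | ⟨h, h'⟩)
        · exact ⟨hy, Or.inr ⟨i, rfl, hy0.le⟩⟩
        · exact ⟨D.tile_subset _ h, Or.inl h⟩
        · exact ⟨h, Or.inr ⟨i, rfl, h'⟩⟩
    rw [e]
    refine IsPreconnected.union y (Set.mem_insert _ _) ⟨hy, hy0.le⟩ ?_
      (D.convex.inter (convex_ell_nonpos _)).isPreconnected
    refine convex_openTile.isPreconnected.subset_closure (Set.subset_insert _ _)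
      (Set.insert_subset (R.ctile_subset_closure _ ?_) subset_closure)
    exact convex_closedTile.openSegment_subset ((R.convex _).mem_closedTile rfl)
      ((R.convex _).mem_closedTile (white_whitePerm _)) (D.mem_openSegment_corner hy hy0)
  · have e : region p ψ s B w = tile ψ s w := by
      ext x
      refine ⟨?_, fun hx => ⟨D.tile_subset w hx, Or.inl hx⟩⟩
      rintro ⟨hx, h' | ⟨j, hj, hxj⟩⟩
      · exact h'
      · exact absurd ⟨j, hj, x, hx, hxj⟩ h
    rw [e]
    exact convex_openTile.isPreconnected

theorem disjoint_region {w w' : Fin n} (h : w ≠ w') :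
    Disjoint (region p ψ s B w) (region p ψ s B w') := by
  rw [Set.disjoint_left]
  rintro z ⟨hz, h1 | ⟨i, rfl, h1⟩⟩ ⟨-, h2 | ⟨j, rfl, h2⟩⟩
  · exact Set.disjoint_left.1 (R.disjoint_tile h) h1 h2
  · exact not_lt.2 h2 (R.ell_pos_of_mem_tile h1 _)
  · exact not_lt.2 h1 (R.ell_pos_of_mem_tile h2 _)
  · refine not_lt.2 h1 (D.ell_pos_of_nonpos hz h2 fun hij => h ?_)
    rw [Fin.castSucc_injective _ hij]

theorem disjoint_rootRegion (w : Fin n) : Disjoint (region p ψ s B w) (rootRegion p s B) := by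
  rw [Set.disjoint_left]
  rintro z ⟨hz, h1 | ⟨i, rfl, h1⟩⟩ ⟨-, h2⟩
  · exact lt_asymm h2 (R.ell_pos_of_mem_tile h1 _)
  · exact lt_asymm h2 (D.ell_pos_of_nonpos hz h1 (Fin.castSucc_lt_last i).ne')

omit D in
theorem disjoint_union_region (w : Fin n) : Disjoint R.union (region p ψ s B w) := by
  rw [Set.disjoint_left]
  rintro z hz ⟨-, h | ⟨i, -, hi⟩⟩
  · obtain ⟨b, hb⟩ := Set.mem_iUnion.1 hz
    exact Set.disjoint_left.1 (R.disjoint_segment_tile b w) (openSegment_subset_segment ℝ _ _ hb) h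
  · exact not_lt.2 hi (R.ell_pos hz i)

omit D in
theorem disjoint_union_rootRegion : Disjoint R.union (rootRegion p s B) := by
  rw [Set.disjoint_left]
  rintro z hz ⟨-, h⟩
  exact not_lt.2 (R.ell_nonneg hz _) h

theorem isOpen_rootRegion : IsOpen (rootRegion p s B) :=
  D.isOpen.inter (_root_.isOpen_lt (continuous_ell _) continuous_const)

theorem isPreconnected_rootRegion : IsPreconnected (rootRegion p s B) :=
  (D.convex.inter (convex_neg s _ _)).isPreconnected

theorem rootRegion_nonempty : (rootRegion p s B).Nonempty := by
  obtain ⟨z, hz⟩ := R.seg_nonempty e₀.1.1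
  obtain ⟨t, -, -, hzt⟩ := R.mem_seg.1 hz
  have hzB := D.union_subset (Set.mem_iUnion.2 ⟨_, hz⟩)
  -- The segment of `b₀` lies on the line of the closing side. As `B` is open, it contains points on
  -- the far side.
  have h0 : ell p s (Fin.last _) z = 0 := by
    have h1 := R.blackTail_eq none
    change ψ (Sum.inr (Fin.last _)) = origin g ψ e₀.1.1 + coord g ψ none • g e₀.1.1 at h1
    rw [R.outer] at h1
    rw [ell, Fin.last_add_one, ← neg_sub, ← R.g_self, hzt, h1,
      show origin g ψ e₀.1.1 + t • g e₀.1.1 - (origin g ψ e₀.1.1 + coord g ψ none • g e₀.1.1) =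
        (t - coord g ψ none) • g e₀.1.1 by module, cr_smul, neg_cr, cr_self, neg_zero, mul_zero]
  obtain ⟨y, hy, hy'⟩ := mem_closure_iff.1
    (mem_closure_halfPlane R.s_ne z (R.polygon_side_ne (Fin.last _))) _ D.isOpen hzB
  refine ⟨y, hy, ?_⟩
  have e : ell p s (Fin.last _) y = cr s (p (Fin.last _ + 1) - p (Fin.last _)) (y - z) +
      ell p s (Fin.last _) z := by
    rw [ell, ell, ← cr_add]; congr 1; ring
  rw [e, h0, add_zero]
  exact hy'

/-- Inside the polygon the closed tiles cover, and a boundary point of a tile lies on a closed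
segment or on an outer side. The closed segments add only polygon vertices to the union, which are
not in `B`. Outside the polygon some side is violated, and it determines the region. -/
theorem cover {z : ℂ} (hz : z ∈ B) (hzU : z ∉ R.union) :
    (∃ w, z ∈ region p ψ s B w) ∨ z ∈ rootRegion p s B := by
  by_cases hzc : z ∈ cdisc p s
  · left
    obtain ⟨w, hw⟩ := R.exists_mem_ctile hzc
    by_cases hw' : z ∈ tile ψ s w
    · exact ⟨w, hz, Or.inl hw'⟩
    obtain ⟨x, hx, hzx⟩ := (R.convex w).mem_segment_of_notMem white_whitePerm hw hw'
    rcases x with e | i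
    · exfalso
      have h1 : z ∈ segment ℝ (R.start e.1.1) (R.finish e.1.1) := by
        refine (convex_segment _ _).segment_subset (R.left_mem e) (R.right_mem e) ?_
        rwa [corner, corner, whiteTail_whitePerm] at hzx
      have h2 : z ∈ closure R.union \ R.union := by
        refine ⟨?_, hzU⟩
        rw [R.closure_union]; exact Set.mem_iUnion.2 ⟨_, h1⟩
      rw [R.closure_diff] at h2
      obtain ⟨k, rfl⟩ := h2
      exact D.notMem k hz
    · refine ⟨w, hz, Or.inr ⟨i, hx, le_of_eq ?_⟩⟩
      rw [R.corner_inr, R.corner_whitePerm_inr] at hzx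
      obtain ⟨α, β, -, -, hαβ, rfl⟩ := hzx
      rw [ell, combination_sub hαβ, sub_self, smul_zero, zero_add, cr_smul, cr_self, mul_zero]
  · have : ∃ k, ell p s k z < 0 := by
      by_contra! hcon
      exact hzc fun k _ => hcon k
    obtain ⟨k, hk⟩ := this
    induction k using Fin.lastCases with
    | last => exact Or.inr ⟨hz, hk⟩
    | cast i => exact Or.inl ⟨_, hz, Or.inr ⟨i, rfl, hk.le⟩⟩

/-- The segments have positive distance functions `ell` from all sides but the closing one, so near
them the region is just the tile. -/
theorem frontier_region (b w : Fin n) :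
    frontier (region p ψ s B w) ∩ R.seg b = R.seg b ∩ ctile ψ s w := by
  ext z
  constructor
  · rintro ⟨hz, hzb⟩
    refine ⟨hzb, ?_⟩
    have hzU : z ∈ R.union := Set.mem_iUnion.2 ⟨b, hzb⟩
    have hO : ∀ᶠ y in 𝓝 z, ∀ i : Fin (G.halfDegree e₀), 0 < ell p s i.castSucc y :=
      eventually_all.2 fun i => (_root_.isOpen_lt continuous_const
        (continuous_ell (p := p) (s := s) i.castSucc)).mem_nhds (R.ell_pos hzU i)
    have : z ∈ closure (tile ψ s w) := by
      refine mem_closure_iff_frequently.2 (((mem_closure_iff_frequently.1 hz.1).and_eventually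
        hO).mono ?_)
      rintro y ⟨⟨-, hy | ⟨i, -, hi⟩⟩, hy'⟩
      · exact hy
      · exact absurd (hy' i) (not_lt.2 hi)
    exact closure_minimal openTile_subset isClosed_closedTile this
  · rintro ⟨hzb, hz⟩
    have hsub : tile ψ s w ⊆ region p ψ s B w := fun y hy => ⟨D.tile_subset w hy, Or.inl hy⟩
    refine ⟨⟨closure_mono hsub (R.ctile_subset_closure w hz), fun h => ?_⟩, hzb⟩
    exact Set.disjoint_left.1 (disjoint_union_region (R := R) (B := B) w) (Set.mem_iUnion.2 ⟨b, hzb⟩)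
      (interior_subset h)

end Domain

end PlaneBipartiteGraph.Realization


namespace PlaneBipartiteGraph.Realization

open Equiv Finset BipartiteMap CyclicSign Matrix PlanePolygon Filter Topology MeasureTheory
open scoped Classical

variable {n : ℕ} {G : PlaneBipartiteGraph n} {e₀ : G.edges} {ν : G.edges → ℝ}
  {K : Matrix (Fin n) (Fin n) ℝ} {f : Fin n → ℝ} {g : Fin n → ℂ}
  {p : Fin (G.halfDegree e₀ + 1) → ℂ} {ψ : G.DualVertex e₀ → ℂ} {s : ℝ}

/-! ### Lengths of portions of segments -/

section

variable (R : Realization G e₀ ν K f g p ψ s)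
include R

/-- A point that is no end of a segment lies on one segment at most. The side of the tile through it
thus belongs to an edge at `b`; an outer side is impossible by `ell_pos`. -/
theorem seg_inter_ctile {b w : Fin n} {z : ℂ} (hz : z ∈ R.seg b) (hzw : z ∈ ctile ψ s w)
    (hends : ∀ b', z ≠ R.start b' ∧ z ≠ R.finish b') :
    ∃ e : G.edges, e.1 = (b, w) ∧ z ∈ segment ℝ (ψ (G.right e₀ e)) (ψ (G.left e₀ e)) := by
  have hz' : z ∉ tile ψ s w := Set.disjoint_left.1 (R.disjoint_segment_tile b w)
    (openSegment_subset_segment ℝ _ _ hz)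
  obtain ⟨x, hx, hzx⟩ := (R.convex w).mem_segment_of_notMem white_whitePerm hzw hz'
  rcases x with e | i
  · have hzx' : z ∈ segment ℝ (ψ (G.right e₀ e)) (ψ (G.left e₀ e)) := by
      rwa [corner, corner, whiteTail_whitePerm, segment_symm] at hzx
    refine ⟨e, Prod.ext ?_ hx, hzx'⟩
    by_contra hne
    have h1 := (convex_segment _ _).segment_subset (R.right_mem e) (R.left_mem e) hzx'
    have h2 : z ∈ R.seg e.1.1 :=
      mem_openSegment_of_ne_left_right (hends _).1.symm (hends _).2.symm h1
    exact Set.disjoint_left.1 (R.disjoint_seg hne) h2 hz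
  · exfalso
    have h1 := R.ell_pos (Set.mem_iUnion.2 ⟨b, hz⟩) i
    rw [R.corner_inr, R.corner_whitePerm_inr] at hzx
    obtain ⟨α, β, -, -, hαβ, rfl⟩ := hzx
    rw [ell, combination_sub hαβ, sub_self, smul_zero, zero_add, cr_smul, cr_self, mul_zero] at h1
    exact lt_irrefl _ h1

theorem finite_ends : {z | ∃ b, z = R.start b ∨ z = R.finish b}.Finite := by
  refine ((Set.finite_range R.start).union (Set.finite_range R.finish)).subset ?_
  rintro z ⟨b, rfl | rfl⟩
  · exact Or.inl ⟨b, rfl⟩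
  · exact Or.inr ⟨b, rfl⟩

theorem measure_ends : (Measure.hausdorffMeasure 1 : Measure ℂ)
    {z | ∃ b, z = R.start b ∨ z = R.finish b} = 0 := by
  have := Measure.nullSingletonClass_hausdorff ℂ one_pos
  exact R.finite_ends.measure_zero _

theorem measure_seg_inter_ctile_edge (e : G.edges) :
    (Measure.hausdorffMeasure 1 : Measure ℂ) (R.seg e.1.1 ∩ ctile ψ s e.1.2) =
      edist (ψ (G.right e₀ e)) (ψ (G.left e₀ e)) := by
  rw [← hausdorffMeasure_segment]
  refine le_antisymm ?_ ?_
  · refine (measure_mono (t := segment ℝ (ψ (G.right e₀ e)) (ψ (G.left e₀ e)) ∪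
      {z | ∃ b, z = R.start b ∨ z = R.finish b}) ?_).trans ((measure_union_le _ _).trans_eq
        (by rw [R.measure_ends, add_zero]))
    rintro z ⟨hz, hzw⟩
    refine or_iff_not_imp_right.2 fun hends => ?_
    simp only [Set.mem_ofPred_eq, not_exists, not_or] at hends
    obtain ⟨e', he', h⟩ := R.seg_inter_ctile hz hzw hends
    rwa [(Subtype.ext he' : e' = e)] at h
  · refine (measure_mono (t := (R.seg e.1.1 ∩ ctile ψ s e.1.2) ∪
      {z | ∃ b, z = R.start b ∨ z = R.finish b}) ?_).trans ((measure_union_le _ _).trans_eq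
        (by rw [R.measure_ends, add_zero]))
    intro z hz
    refine or_iff_not_imp_right.2 fun hends => ?_
    simp only [Set.mem_ofPred_eq, not_exists, not_or] at hends
    refine ⟨mem_openSegment_of_ne_left_right (Ne.symm (hends _).1) (Ne.symm (hends _).2)
      ((convex_segment _ _).segment_subset (R.right_mem e) (R.left_mem e) hz), ?_⟩
    refine convex_closedTile.segment_subset ?_ ((R.convex _).mem_closedTile (x := Sum.inl e) rfl) hz
    have := (R.convex e.1.2).mem_closedTile (white_whitePerm (e₀ := e₀) (Sum.inl e))
    rwa [corner, whiteTail_whitePerm] at this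

theorem measure_seg_inter_ctile {b w : Fin n} (h : (b, w) ∉ G.edges) :
    (Measure.hausdorffMeasure 1 : Measure ℂ) (R.seg b ∩ ctile ψ s w) = 0 := by
  refine measure_mono_null ?_ R.measure_ends
  rintro z ⟨hz, hzw⟩
  by_contra hends
  simp only [Set.mem_ofPred_eq, not_exists, not_or] at hends
  obtain ⟨e, he, -⟩ := R.seg_inter_ctile hz hzw hends
  exact h (he ▸ e.2)

theorem dist_edge (e : G.edges) :
    dist (ψ (G.right e₀ e)) (ψ (G.left e₀ e)) = ν e * (|f e.1.2| * ‖g e.1.1‖) := by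
  rw [dist_comm, dist_eq_norm, R.grad, norm_smul, norm_mul, Real.norm_eq_abs, Real.norm_eq_abs,
    R.kasteleyn.abs_eq]
  ring

end

namespace Domain

variable {R : Realization G e₀ ν K f g p ψ s} {B : Set ℂ} (D : R.Domain B)
include D

theorem portionLength_edge (e : G.edges) :
    portionLength (R.seg e.1.1) (region p ψ s B e.1.2) = ν e * (|f e.1.2| * ‖g e.1.1‖) := by
  rw [portionLength, D.frontier_region, R.measure_seg_inter_ctile_edge, ← R.dist_edge, dist_edist]

theorem portionLength_eq_zero {b w : Fin n} (h : (b, w) ∉ G.edges) :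
    portionLength (R.seg b) (region p ψ s B w) = 0 := by
  rw [portionLength, D.frontier_region, R.measure_seg_inter_ctile h, ENNReal.toReal_zero]

theorem portionLength_pos_iff (b w : Fin n) :
    (b, w) ∈ G.edges ↔ 0 < portionLength (R.seg b) (region p ψ s B w) := by
  refine ⟨fun h => ?_, fun h => ?_⟩
  · have := D.portionLength_edge ⟨(b, w), h⟩
    rw [this]
    exact mul_pos (R.pos _) (mul_pos (abs_pos.2 (R.f_ne _)) (norm_pos_iff.2 (R.g_ne _)))
  · by_contra hcon
    rw [D.portionLength_eq_zero hcon] at h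
    exact lt_irrefl _ h

theorem gaugeEquivalent : G.GaugeEquivalent
    (fun e => portionLength (R.seg e.1.1) (region p ψ s B e.1.2)) ν := by
  refine ⟨fun w => |f w|, fun b => ‖g b‖, fun w => abs_pos.2 (R.f_ne w),
    fun b => norm_pos_iff.2 (R.g_ne b), fun e => ?_⟩
  exact (congrArg (· / ν e) (D.portionLength_edge e)).trans (mul_div_cancel_left₀ _ (R.pos e).ne')

theorem interior_whiteTile_subset (w : Fin n) :
    interior (G.whiteTile e₀ ψ w) ⊆ region p ψ s B w := by
  have h1 : G.whiteTile e₀ ψ w ⊆ ctile ψ s w := by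
    refine convexHull_min (Set.iUnion_subset ?_) convex_closedTile
    rintro ⟨e, rfl⟩
    refine Set.insert_subset ?_ (Set.singleton_subset_iff.2
      ((R.convex _).mem_closedTile (x := Sum.inl e) rfl))
    have := (R.convex e.1.2).mem_closedTile (white_whitePerm (e₀ := e₀) (Sum.inl e))
    rwa [corner, whiteTail_whitePerm] at this
  intro z hz
  have h2 := interior_closedTile_subset R.s_ne (c := G.white e₀) (i := w) R.side_ne
    (interior_mono h1 hz)
  exact ⟨D.tile_subset w h2, Or.inl h2⟩

end Domain

/-! ### The faces for an enclosing curve -/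

section

variable {R : Realization G e₀ ν K f g p ψ s} {C : Set ℂ}
  (hC : IsEnclosingCurve R.seg (Set.range p) C) (hconv : Convex ℝ (boundedPart C))
include hC

theorem isClosed_curve : IsClosed C := by
  obtain ⟨γ, h1, -, rfl⟩ := hC.simpleClosed
  exact (isCompact_range h1).isClosed

include hconv

theorem domain : R.Domain (boundedPart C) where
  convex := hconv
  isOpen := isOpen_boundedPart (isClosed_curve hC)
  union_subset := hC.encircles
  notMem k hk := hk.1 (hC.roots ⟨k, rfl⟩)

omit hC hconv in
theorem subset_compl {A : Set ℂ} (hA : A ⊆ boundedPart C) (hd : Disjoint R.union A) :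
    A ⊆ (R.union ∪ C)ᶜ := by
  rintro z hz (h | h)
  · exact Set.disjoint_left.1 hd h hz
  · exact (hA hz).1 h

theorem component_cover {z : ℂ} (hz : z ∈ boundedPart C) :
    connectedComponentIn (R.union ∪ C)ᶜ z ⊆
      (⋃ w, region p ψ s (boundedPart C) w) ∪ rootRegion p s (boundedPart C) := by
  intro y hy
  rcases (domain hC hconv).cover (component_subset_boundedPart Set.subset_union_right hz hy)
    (fun h => connectedComponentIn_subset _ _ hy (Or.inl h)) with ⟨w, hw⟩ | h
  · exact Or.inl (Set.mem_iUnion.2 ⟨w, hw⟩)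
  · exact Or.inr h

theorem region_eq_component {w : Fin n} {z : ℂ} (hz : z ∈ region p ψ s (boundedPart C) w) :
    region p ψ s (boundedPart C) w = connectedComponentIn (R.union ∪ C)ᶜ z := by
  have D := domain hC hconv
  refine component_eq_of_cover (A' := (⋃ w' ∈ {w' | w' ≠ w}, region p ψ s (boundedPart C) w') ∪
    rootRegion p s (boundedPart C)) (D.isOpen_region w)
    ((isOpen_biUnion fun w' _ => D.isOpen_region w').union D.isOpen_rootRegion) ?_
    (D.isPreconnected_region w) (subset_compl (fun z h => h.1) (Domain.disjoint_union_region w))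
    hz ((component_cover hC hconv hz.1).trans ?_)
  · refine Set.disjoint_union_right.2 ⟨?_, D.disjoint_rootRegion w⟩
    simp only [Set.disjoint_iUnion_right]
    exact fun w' hw' => D.disjoint_region (Ne.symm hw')
  · rintro y (hy | hy)
    · obtain ⟨w', hw'⟩ := Set.mem_iUnion.1 hy
      by_cases h : w' = w
      · subst h; exact Or.inl hw'
      · exact Or.inr (Or.inl (Set.mem_biUnion h hw'))
    · exact Or.inr (Or.inr hy)

theorem rootRegion_eq_component {z : ℂ} (hz : z ∈ rootRegion p s (boundedPart C)) :
    rootRegion p s (boundedPart C) = connectedComponentIn (R.union ∪ C)ᶜ z := by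
  have D := domain hC hconv
  refine component_eq_of_cover (A' := ⋃ w, region p ψ s (boundedPart C) w) D.isOpen_rootRegion
    (isOpen_iUnion D.isOpen_region) ?_ D.isPreconnected_rootRegion
    (subset_compl (fun z h => h.1) Domain.disjoint_union_rootRegion) hz
    ((component_cover hC hconv hz.1).trans (Set.union_comm _ _).subset)
  simp only [Set.disjoint_iUnion_right]
  exact fun w => (D.disjoint_rootRegion w).symm

theorem isTFace_region (w : Fin n) : IsTFace R.seg C (region p ψ s (boundedPart C) w) := by
  have D := domain hC hconv
  obtain ⟨z, hz⟩ := R.tile_nonempty w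
  have hz' : z ∈ region p ψ s (boundedPart C) w := ⟨D.tile_subset w hz, Or.inl hz⟩
  exact ⟨(isBounded_boundedPart hconv.isPreconnected).subset fun z h => h.1, z,
    subset_compl (fun z h => h.1) (Domain.disjoint_union_region w) hz',
    region_eq_component hC hconv hz'⟩

theorem isTFace_rootRegion : IsTFace R.seg C (rootRegion p s (boundedPart C)) := by
  have D := domain hC hconv
  obtain ⟨z, hz⟩ := D.rootRegion_nonempty
  exact ⟨(isBounded_boundedPart hconv.isPreconnected).subset fun z h => h.1, z,
    subset_compl (fun z h => h.1) Domain.disjoint_union_rootRegion hz,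
    rootRegion_eq_component hC hconv hz⟩

theorem isOuterTFace_rootRegion :
    IsOuterTFace R.seg (Set.range p) C (rootRegion p s (boundedPart C)) := by
  refine ⟨isTFace_rootRegion hC hconv, ?_⟩
  have D := domain hC hconv
  obtain ⟨z, hz⟩ := D.rootRegion_nonempty
  set h := p (Fin.last _ + 1) - p (Fin.last (G.halfDegree e₀)) with hh
  have hne : h ≠ 0 := R.polygon_side_ne _
  have hd : -(s • (Complex.I * h)) ≠ 0 :=
    neg_ne_zero.2 (smul_ne_zero R.s_ne (mul_ne_zero Complex.I_ne_zero hne))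
  -- A ray away from the polygon leaves the bounded region. It can do so only through `C`, and being
  -- strictly beyond the closing side it meets no root.
  set T := (fun t : ℝ => z + t • -(s • (Complex.I * h))) '' Set.Ici 0 with hT
  have hTl : ∀ y ∈ T, ell p s (Fin.last _) y < 0 := by
    rintro _ ⟨t, ht, rfl⟩
    have ht' : (0 : ℝ) ≤ t := ht
    rw [ell, cr_ray]
    have h1 : ell p s (Fin.last _) z < 0 := hz.2
    rw [ell] at h1
    have := mul_nonneg ht' (mul_nonneg (sq_nonneg s) (Complex.normSq_nonneg h))
    linarith
  have hTnot : ¬ T ⊆ rootRegion p s (boundedPart C) := fun hsub =>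
    not_isBounded_ray z hd ((isTFace_rootRegion hC hconv).1.subset hsub)
  obtain ⟨c, hc, hcT⟩ : ∃ c, c ∈ closure (rootRegion p s (boundedPart C)) ∧
      c ∈ T ∧ c ∉ rootRegion p s (boundedPart C) := by
    by_contra! hcon
    have hzT : z ∈ T := ⟨0, Set.self_mem_Ici, by simp⟩
    have hpre : IsPreconnected T := isPreconnected_ray z _
    refine hTnot (hpre.subset_left_of_subset_union
      D.isOpen_rootRegion isClosed_closure.isOpen_compl
      (disjoint_compl_right.mono_left subset_closure) (fun x hx => ?_) ⟨z, hzT, hz⟩)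
    by_cases hx' : x ∈ closure (rootRegion p s (boundedPart C))
    · exact Or.inl (hcon x hx' hx)
    · exact Or.inr hx'
  refine ⟨c, hc, ?_, ?_⟩
  · have h1 := closure_boundedPart_subset (isClosed_curve hC)
      (closure_mono (fun z (h : z ∈ rootRegion p s (boundedPart C)) => h.1) hc)
    exact h1.resolve_left fun h => hcT.2 ⟨h, hTl c hcT.1⟩
  · rintro ⟨k, rfl⟩
    exact not_lt.2 (R.closure_union_subset (R.polygon_mem_closure k) (Fin.last _) rfl)
      (hTl _ hcT.1)

/-- The weighted graph is the dimer graph of its T-graph, up to gauge equivalence. -/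
theorem isDimerGraphUpToGauge : IsDimerGraphUpToGauge G.toBipartiteMap ν R.seg (Set.range p) C
    (region p ψ s (boundedPart C)) (rootRegion p s (boundedPart C)) := by
  have D := domain hC hconv
  have hne : ∀ w, ∃ z, z ∈ region p ψ s (boundedPart C) w := fun w => by
    obtain ⟨z, hz⟩ := R.tile_nonempty w
    exact ⟨z, D.tile_subset w hz, Or.inl hz⟩
  refine ⟨isOuterTFace_rootRegion hC hconv, fun w w' h => ?_, ?_, D.portionLength_pos_iff,
    D.gaugeEquivalent⟩
  · by_contra hww
    obtain ⟨z, hz⟩ := hne w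
    exact Set.disjoint_left.1 (D.disjoint_region hww) hz (h ▸ hz)
  · refine Set.Subset.antisymm ?_ ?_
    · rintro _ ⟨w, rfl⟩
      refine Set.mem_sdiff_singleton.2 ⟨isTFace_region hC hconv w, fun h => ?_⟩
      obtain ⟨z, hz⟩ := hne w
      exact Set.disjoint_left.1 (D.disjoint_rootRegion w) hz
        (by rw [← h]; exact hz)
    · rintro A ⟨⟨hb, z, hz, rfl⟩, hA⟩
      have hzB : z ∈ boundedPart C :=
        mem_boundedPart_of_isBounded hC.encircles (fun h => hz (Or.inr h)) hb
      rcases D.cover hzB (fun h => hz (Or.inl h)) with ⟨w, hw⟩ | h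
      · exact ⟨w, region_eq_component hC hconv hw⟩
      · exact absurd (rootRegion_eq_component hC hconv h).symm hA

end

end PlaneBipartiteGraph.Realization


namespace PlaneBipartiteGraph

open Equiv Finset BipartiteMap CyclicSign Matrix PlanePolygon
open scoped Classical

variable {n : ℕ} {G : PlaneBipartiteGraph n} {e₀ : G.edges} {ν : G.edges → ℝ}
  {K : Matrix (Fin n) (Fin n) ℝ}

/-! ### Gauge vectors -/

variable (e₀ K) in
/-- The factors of the columns in a Kasteleyn flow. -/
noncomputable def whiteFactor (w : Fin n) : ℝ := K⁻¹ w e₀.1.1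

variable (e₀ K) in
/-- The coefficients of the edge vectors of the polygon in the factors of the rows. -/
noncomputable def blackCoeff (k : Fin (G.halfDegree e₀)) (b : Fin n) : ℝ :=
  K⁻¹ (G.exitEdge e₀ k).1.2 b / whiteFactor e₀ K (G.exitEdge e₀ k).1.2

variable (e₀ K) in
/-- The factors of the rows in a Kasteleyn flow. -/
noncomputable def blackFactor (p : Fin (G.halfDegree e₀ + 1) → ℂ) (b : Fin n) : ℂ :=
  ∑ k, blackCoeff e₀ K k b • (p k.succ - p k.castSucc)

section

variable (hdet : K.det ≠ 0)
include hdet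

omit e₀ in
theorem mul_inv_of_det : K * K⁻¹ = 1 := K.mul_nonsing_inv (isUnit_iff_ne_zero.2 hdet)

omit e₀ in
theorem inv_mul_of_det : K⁻¹ * K = 1 := K.nonsing_inv_mul (isUnit_iff_ne_zero.2 hdet)

omit e₀ in
theorem mulVec_inv_col (b : Fin n) : K *ᵥ (fun w => K⁻¹ w b) = Pi.single b 1 := by
  ext b'
  have := congrFun (congrFun (mul_inv_of_det hdet) b') b
  rw [Matrix.mul_apply] at this
  rw [Matrix.mulVec, dotProduct, this, Matrix.one_apply, Pi.single_apply]

-- A zero entry would let `1`-non-degeneracy annihilate the whole column of `K⁻¹`.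
omit e₀ in
theorem inv_ne_zero (h1 : IsNonDegenerate 1 K) (w b : Fin n) : K⁻¹ w b ≠ 0 := fun h => by
  have hc := mulVec_inv_col hdet b
  have := h1.eq_zero_one b w (v := fun w => K⁻¹ w b) h fun b' hb' => by
    rw [hc, Pi.single_eq_of_ne hb']
  rw [this, Matrix.mulVec_zero] at hc
  simpa using congrFun hc b

-- A vanishing minor gives a combination of two columns of `K⁻¹` that vanishes at `w` and `w'` and
-- is killed by all rows but `b` and `b'`. By `2`-non-degeneracy it is zero, although its
-- coefficients are not.
omit e₀ in
theorem inv_minor_ne_zero (h1 : IsNonDegenerate 1 K) (h2 : IsNonDegenerate 2 K)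
    {b b' w w' : Fin n} (hb : b ≠ b') (hw : w ≠ w') :
    K⁻¹ w b * K⁻¹ w' b' - K⁻¹ w' b * K⁻¹ w b' ≠ 0 := fun h => by
  set v : Fin n → ℝ := K⁻¹ w b' • (fun u => K⁻¹ u b) - K⁻¹ w b • (fun u => K⁻¹ u b') with hv
  have hKv : K *ᵥ v = K⁻¹ w b' • Pi.single b 1 - K⁻¹ w b • Pi.single b' 1 := by
    rw [hv, Matrix.mulVec_sub, Matrix.mulVec_smul, Matrix.mulVec_smul, mulVec_inv_col hdet,
      mulVec_inv_col hdet]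
  have h0 := h2.eq_zero_two hb hw (v := v)
    (by simp only [hv, Pi.sub_apply, Pi.smul_apply, smul_eq_mul]; ring)
    (by simp only [hv, Pi.sub_apply, Pi.smul_apply, smul_eq_mul]; linarith)
    fun c hc hc' => by
      rw [hKv, Pi.sub_apply, Pi.smul_apply, Pi.smul_apply, Pi.single_eq_of_ne hc,
        Pi.single_eq_of_ne hc', smul_zero, smul_zero, sub_zero]
  rw [h0, Matrix.mulVec_zero] at hKv
  have := congrFun hKv b
  simp only [Pi.zero_apply, Pi.sub_apply, Pi.smul_apply, Pi.single_eq_same, smul_eq_mul, mul_one,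
    Pi.single_eq_of_ne hb, mul_zero, sub_zero] at this
  exact inv_ne_zero hdet h1 w b' this.symm

theorem sum_blackCoeff_mul (k : Fin (G.halfDegree e₀)) (w : Fin n) :
    ∑ b, blackCoeff e₀ K k b * K b w =
      if (G.exitEdge e₀ k).1.2 = w then (whiteFactor e₀ K w)⁻¹ else 0 := by
  have := congrFun (congrFun (inv_mul_of_det hdet) (G.exitEdge e₀ k).1.2) w
  rw [Matrix.mul_apply, Matrix.one_apply] at this
  simp only [blackCoeff, div_mul_eq_mul_div]
  rw [← sum_div, this]
  split_ifs with h
  · rw [h, one_div]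
  · rw [zero_div]

theorem sum_blackFactor_mul (h1 : IsNonDegenerate 1 K) (p : Fin (G.halfDegree e₀ + 1) → ℂ)
    (w : Fin n) : ∑ b, blackFactor e₀ K p b * (K b w : ℂ) * (whiteFactor e₀ K w : ℂ) =
      ∑ k : Fin (G.halfDegree e₀),
        if (G.exitEdge e₀ k).1.2 = w then p k.succ - p k.castSucc else 0 := by
  have hw : (whiteFactor e₀ K w : ℂ) ≠ 0 := Complex.ofReal_ne_zero.2 (inv_ne_zero hdet h1 _ _)
  have h2 : ∀ b, blackFactor e₀ K p b * (K b w : ℂ) * (whiteFactor e₀ K w : ℂ) =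
      ∑ k, ((blackCoeff e₀ K k b * K b w : ℝ) : ℂ) * ((p k.succ - p k.castSucc) *
        (whiteFactor e₀ K w : ℂ)) := fun b => by
    rw [blackFactor, sum_mul, sum_mul]
    refine sum_congr rfl fun k _ => ?_
    rw [Complex.real_smul]; push_cast; ring
  rw [sum_congr rfl fun b _ => h2 b, sum_comm]
  refine sum_congr rfl fun k _ => ?_
  rw [← sum_mul, ← Complex.ofReal_sum, sum_blackCoeff_mul hdet]
  split_ifs with h
  · rw [Complex.ofReal_inv]; field_simp
  · rw [Complex.ofReal_zero, zero_mul]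

end

theorem sum_polygon_sides {m : ℕ} (p : Fin (m + 1) → ℂ) :
    ∑ k : Fin m, (p k.succ - p k.castSucc) = p (Fin.last m) - p 0 := by
  have h1 := Fin.sum_univ_succ p
  have h2 := Fin.sum_univ_castSucc p
  rw [sum_sub_distrib]
  linear_combination h2 - h1

theorem outerFlow_eq (p : Fin (G.halfDegree e₀ + 1) → ℂ) (w : Fin n) :
    G.outerFlow e₀ p w = ∑ k : Fin (G.halfDegree e₀),
      if (G.exitEdge e₀ k).1.2 = w then p k.succ - p k.castSucc else 0 := by
  refine sum_congr rfl fun k _ => ?_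
  have : ((G.facePerm ^ (k.1 + 1)) e₀).1.2 = (G.exitEdge e₀ k).1.2 :=
    (congrArg (fun e : G.edges => e.1.2) (rotW_exitEdge k)).symm.trans (rotW_snd _)
  rw [this]

theorem sum_outerFlow (p : Fin (G.halfDegree e₀ + 1) → ℂ) :
    ∑ w, G.outerFlow e₀ p w = p (Fin.last _) - p 0 := by
  simp only [outerFlow_eq]
  rw [sum_comm, ← sum_polygon_sides]
  exact sum_congr rfl fun k _ => by rw [sum_ite_eq univ, if_pos (mem_univ _)]

/-! ### Existence and uniqueness of the flow -/

variable {p : Fin (G.halfDegree e₀ + 1) → ℂ}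

section

variable (hdet : K.det ≠ 0) (h1 : IsNonDegenerate 1 K)
include hdet h1

theorem isKasteleynFlow_factor (hg : ∀ b, blackFactor e₀ K p b ≠ 0) : G.IsKasteleynFlow e₀ K p
    fun b w => blackFactor e₀ K p b * (K b w : ℂ) * (whiteFactor e₀ K w : ℂ) where
  gauge := ⟨_, fun w => (whiteFactor e₀ K w : ℂ), hg,
    fun w => Complex.ofReal_ne_zero.2 (inv_ne_zero hdet h1 _ _), fun _ _ => rfl⟩
  row_sum := by
    refine ⟨_, hg e₀.1.1, fun b => ?_⟩
    have h := congrFun (mulVec_inv_col hdet e₀.1.1) b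
    simp only [mul_assoc]
    rw [← mul_sum]
    have h2 : ∑ w, (K b w : ℂ) * (whiteFactor e₀ K w : ℂ) = if b = e₀.1.1 then 1 else 0 := by
      rw [Matrix.mulVec, dotProduct, Pi.single_apply] at h
      have := congrArg (fun x : ℝ => (x : ℂ)) h
      simp only [Complex.ofReal_sum, Complex.ofReal_mul] at this
      rw [show (∑ w, (K b w : ℂ) * (whiteFactor e₀ K w : ℂ)) = _ from this]
      split_ifs <;> simp
    rw [h2]
    split_ifs with hb
    · rw [hb, mul_one]
    · rw [mul_zero]
  col_sum w := by rw [sum_blackFactor_mul hdet h1, outerFlow_eq]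

/-- The row sums determine the column factors up to a scalar, through `K⁻¹`. With the scalar moved
to the row factors, the column sums determine these by `K⁻¹` again. -/
theorem eq_of_isKasteleynFlow {Kt : Matrix (Fin n) (Fin n) ℂ} (h : G.IsKasteleynFlow e₀ K p Kt)
    (b w : Fin n) : Kt b w = blackFactor e₀ K p b * (K b w : ℂ) * (whiteFactor e₀ K w : ℂ) := by
  obtain ⟨g, f, hg, hf, hgf⟩ := h.gauge
  obtain ⟨c, hc, hrow⟩ := h.row_sum
  have hinv1 : ∀ w w', ∑ b, ((K⁻¹ w b : ℝ) : ℂ) * (K b w' : ℂ) = if w = w' then 1 else 0 :=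
    fun w w' => by
      have := congrArg (fun x : ℝ => (x : ℂ)) (congrFun (congrFun (inv_mul_of_det hdet) w) w')
      simp only [Matrix.mul_apply, Matrix.one_apply, Complex.ofReal_sum, Complex.ofReal_mul] at this
      rw [this]; split_ifs <;> simp
  have hinv2 : ∀ b b', ∑ w, (K b w : ℂ) * ((K⁻¹ w b' : ℝ) : ℂ) = if b = b' then 1 else 0 :=
    fun w w' => by
      have := congrArg (fun x : ℝ => (x : ℂ)) (congrFun (congrFun (mul_inv_of_det hdet) w) w')
      simp only [Matrix.mul_apply, Matrix.one_apply, Complex.ofReal_sum, Complex.ofReal_mul] at this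
      rw [this]; split_ifs <;> simp
  have hKf : ∀ b, ∑ w, (K b w : ℂ) * f w = if b = e₀.1.1 then c / g e₀.1.1 else 0 := fun b => by
    have h2 := hrow b
    simp only [hgf, mul_assoc] at h2
    rw [← mul_sum] at h2
    split_ifs at h2 ⊢ with hb
    · rw [eq_div_iff (hg _), ← hb, mul_comm, h2]
    · exact (mul_eq_zero.1 h2).resolve_left (hg b)
  have hf' : ∀ w, f w = (c / g e₀.1.1) * (whiteFactor e₀ K w : ℂ) := fun w => by
    have h2 : ∑ b, ((K⁻¹ w b : ℝ) : ℂ) * ∑ w', (K b w' : ℂ) * f w' = f w := by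
      simp only [mul_sum, ← mul_assoc]
      rw [sum_comm]
      simp only [← sum_mul, hinv1, ite_mul, one_mul, zero_mul]
      rw [sum_ite_eq univ, if_pos (mem_univ _)]
    rw [← h2]
    simp only [hKf, mul_ite, mul_zero]
    rw [sum_ite_eq' univ, if_pos (mem_univ _), whiteFactor, mul_comm]
  set d := c / g e₀.1.1
  have hd : d ≠ 0 := div_ne_zero hc (hg _)
  have hcol : ∀ w, ∑ b, (d * g b) * (K b w : ℂ) = ∑ b, blackFactor e₀ K p b * (K b w : ℂ) :=
    fun w => by
      have hw : (whiteFactor e₀ K w : ℂ) ≠ 0 := Complex.ofReal_ne_zero.2 (inv_ne_zero hdet h1 _ _)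
      refine mul_right_cancel₀ hw ?_
      rw [sum_mul, sum_mul, sum_blackFactor_mul hdet h1, ← outerFlow_eq, ← h.col_sum]
      refine sum_congr rfl fun b _ => ?_
      rw [hgf, hf']; ring
  have hg' : ∀ b, d * g b = blackFactor e₀ K p b := fun b => by
    have h2 : ∀ x : Fin n → ℂ, ∑ w, (∑ b', x b' * (K b' w : ℂ)) * ((K⁻¹ w b : ℝ) : ℂ) = x b :=
      fun x => by
        simp only [sum_mul, mul_assoc]
        rw [sum_comm]
        simp only [← mul_sum, hinv2, mul_ite, mul_one, mul_zero]
        rw [sum_ite_eq' univ, if_pos (mem_univ _)]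
    rw [← h2 (fun b => d * g b), ← h2 (blackFactor e₀ K p)]
    simp only [hcol]
  rw [hgf, hf', ← hg']
  ring

end

/-- The entries have the same total by rows and by columns, and the sum of the edge vectors
telescopes. -/
theorem _root_.BipartiteMap.IsKasteleynFlow.rowSum_eq {Kt : Matrix (Fin n) (Fin n) ℂ}
    (h : G.IsKasteleynFlow e₀ K p Kt) (b : Fin n) :
    ∑ w, Kt b w = if b = e₀.1.1 then p (Fin.last _) - p 0 else 0 := by
  obtain ⟨c, hc, hrow⟩ := h.row_sum
  have h2 : ∑ b, ∑ w, Kt b w = c := by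
    simp only [hrow]; rw [sum_ite_eq' univ, if_pos (mem_univ _)]
  have h3 : ∑ w, ∑ b, Kt b w = c :=
    (sum_comm (s := univ) (t := univ) (f := fun w b => Kt b w)).trans h2
  simp only [h.col_sum] at h3
  rw [hrow, ← h3, sum_outerFlow]

/-! ### Integration of the flow -/

section

variable (hK : G.IsKasteleyn e₀ ν K) (h1 : IsNonDegenerate 1 K)

/-- The function that is `p` on the outer pieces and zero inside accounts for all sources. The rest
of the flow has a potential on the faces, normalized to vanish on the outer face. -/
theorem exists_integral {Kt : Matrix (Fin n) (Fin n) ℂ} (hK : G.IsKasteleyn e₀ ν K)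
    (h : G.IsKasteleynFlow e₀ K p Kt) :
    ∃ ψ, G.IsIntegral e₀ p Kt ψ ∧ ∀ k, ψ (Sum.inr k) = p k := by
  have hKt : ∀ b w, (b, w) ∉ G.edges → Kt b w = 0 := fun b w hbw => by
    obtain ⟨g, f, -, -, hgf⟩ := h.gauge
    rw [hgf, hK.eq_zero b w hbw]; simp
  let ψ₀ : G.DualVertex e₀ → ℂ := Sum.elim (fun _ => 0) p
  obtain ⟨η, hη⟩ := G.exists_potential ℂ
    (ω := fun e => Kt e.1.1 e.1.2 - (ψ₀ (G.left e₀ e) - ψ₀ (G.right e₀ e)))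
    (fun b => by
      rw [sum_sub_distrib, G.sum_fst b _ (hKt b), sum_black_eq, h.rowSum_eq]
      exact sub_self _)
    (fun w => by
      rw [sum_sub_distrib, G.sum_snd w _ fun b => hKt b w, sum_white_eq, h.col_sum, outerFlow_eq]
      exact sub_self _)
  let ψ : G.DualVertex e₀ → ℂ := Sum.elim (fun F => η F.1 - η (G.leftFace e₀)) p
  have hl : ∀ e, ψ (G.left e₀ e) = ψ₀ (G.left e₀ e) + (η (G.leftFace e) - η (G.leftFace e₀)) :=
    fun e => by
      by_cases he : G.leftFace e = G.leftFace e₀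
      · rw [left_boundary he, he, sub_self, add_zero]; rfl
      · rw [left_interior he]; exact (zero_add _).symm
  have hr : ∀ e, ψ (G.right e₀ e) =
      ψ₀ (G.right e₀ e) + (η (G.leftFace (G.rotB.symm e)) - η (G.leftFace e₀)) :=
    fun e => by
      by_cases he : G.leftFace (G.rotB.symm e) = G.leftFace e₀
      · rw [right_boundary he, he, sub_self, add_zero]; rfl
      · rw [right_interior he]; exact (zero_add _).symm
  refine ⟨ψ, ⟨fun e => ?_, rfl⟩, fun k => rfl⟩
  have := hη e
  rw [hl, hr]
  linear_combination -this

-- The difference of two integrals does not change across edges. Going around an outer white vertex,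
-- which meets the outer face only once, equates consecutive outer pieces. The difference therefore
-- descends to the undivided faces and is constant.
include hK h1 in
theorem integral_unique {Kt : Matrix (Fin n) (Fin n) ℂ} {ψ ψ' : G.DualVertex e₀ → ℂ}
    (h : G.IsIntegral e₀ p Kt ψ) (h' : G.IsIntegral e₀ p Kt ψ') : ψ = ψ' := by
  let δ : G.DualVertex e₀ → ℂ := fun v => ψ v - ψ' v
  have hgrad : ∀ e, δ (G.left e₀ e) = δ (G.right e₀ e) := fun e => by
    have h2 := h.grad e
    rw [← h'.grad e] at h2
    simp only [δ]
    linear_combination h2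
  have hstep : ∀ i : Fin (G.halfDegree e₀), δ (Sum.inr i.succ) = δ (Sum.inr i.castSucc) :=
    fun i => by
      have h2 := sum_white_eq (G := G) (e₀ := e₀) δ (G.exitEdge e₀ i).1.2
      rw [sum_eq_zero fun e _ => sub_eq_zero.2 (hgrad e), sum_eq_single i] at h2
      · rw [if_pos rfl] at h2; exact sub_eq_zero.1 h2.symm
      · exact fun j _ hj => if_neg fun hw => hj (exit_white_injective hK h1 hw)
      · exact fun hi => absurd (mem_univ _) hi
  have hpiece : ∀ k, δ (Sum.inr k) = 0 := fun k => by
    induction k using Fin.induction with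
    | zero => exact sub_eq_zero.2 (h.base.trans h'.base.symm)
    | succ i ih => rw [hstep]; exact ih
  let η : G.Face → ℂ := fun F => if hF : F = G.leftFace e₀ then 0 else δ (Sum.inl ⟨F, hF⟩)
  have hl : ∀ e, η (G.leftFace e) = δ (G.left e₀ e) := fun e => by
    by_cases he : G.leftFace e = G.leftFace e₀
    · rw [left_boundary he]; exact (dif_pos he).trans (hpiece _).symm
    · rw [left_interior he]; exact dif_neg he
  have hr : ∀ e, η (G.leftFace (G.rotB.symm e)) = δ (G.right e₀ e) := fun e => by
    by_cases he : G.leftFace (G.rotB.symm e) = G.leftFace e₀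
    · rw [right_boundary he]; exact (dif_pos he).trans (hpiece _).symm
    · rw [right_interior he]; exact dif_neg he
  have hconst := G.face_const_of_gradient (η := η) fun e => by
    have h2 := hr (G.rotB e)
    rw [symm_apply_apply] at h2
    rw [hl, hgrad, h2]
  funext v
  rw [← sub_eq_zero]
  rcases v with F | k
  · have h2 : η F.1 = δ (Sum.inl F) := dif_neg F.2
    have h3 : η (G.leftFace e₀) = 0 := dif_pos rfl
    exact h2.symm.trans ((hconst _ _).trans h3)
  · exact hpiece k

end

end PlaneBipartiteGraph


namespace PlaneBipartiteGraph

open Equiv Finset BipartiteMap CyclicSign Matrix PlanePolygon MvPolynomial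
open scoped Classical

variable {n : ℕ} {G : PlaneBipartiteGraph n} {e₀ : G.edges} {ν : G.edges → ℝ}
  {K : Matrix (Fin n) (Fin n) ℝ}

/-! ### The polynomial of the general position conditions -/

variable (e₀) in
/-- A coordinate of an edge vector of the polygon, as a polynomial. -/
noncomputable def sidePoly (c : Fin 2) (k : Fin (G.halfDegree e₀)) :
    MvPolynomial (Fin (G.halfDegree e₀ + 1) × Fin 2) ℝ := X (k.succ, c) - X (k.castSucc, c)

variable (e₀ K) in
/-- A coordinate of the factor of a row, as a polynomial. -/
noncomputable def blackPoly (c : Fin 2) (b : Fin n) :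
    MvPolynomial (Fin (G.halfDegree e₀ + 1) × Fin 2) ℝ :=
  ∑ k, C (blackCoeff e₀ K k b) * sidePoly e₀ c k

variable (e₀ K) in
/-- The polynomial whose non-vanishing expresses that the rows and the polygon are in general
position. -/
noncomputable def genericPoly : MvPolynomial (Fin (G.halfDegree e₀ + 1) × Fin 2) ℝ :=
  -- For a smaller outer face there are no convex polygons, and any non-zero polynomial serves.
  if 2 ≤ G.halfDegree e₀ then
    (∏ b, ∏ b', if b = b' then 1 else
      blackPoly e₀ K 0 b * blackPoly e₀ K 1 b' - blackPoly e₀ K 1 b * blackPoly e₀ K 0 b') *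
    ∏ b, ∏ i, (blackPoly e₀ K 0 b * sidePoly e₀ 1 i - blackPoly e₀ K 1 b * sidePoly e₀ 0 i)
  else 1

/-- The coordinates of the vertices of a polygon. -/
noncomputable def coords {m : ℕ} (p : Fin (m + 1) → ℂ) (i : Fin (m + 1) × Fin 2) : ℝ :=
  if i.2 = 0 then (p i.1).re else (p i.1).im

variable (p : Fin (G.halfDegree e₀ + 1) → ℂ)

theorem eval_sidePoly_zero (k : Fin (G.halfDegree e₀)) :
    eval (coords p) (sidePoly e₀ 0 k) = (p k.succ - p k.castSucc).re := by
  simp [sidePoly, coords]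

theorem eval_sidePoly_one (k : Fin (G.halfDegree e₀)) :
    eval (coords p) (sidePoly e₀ 1 k) = (p k.succ - p k.castSucc).im := by
  simp [sidePoly, coords]

theorem eval_blackPoly_zero (b : Fin n) :
    eval (coords p) (blackPoly e₀ K 0 b) = (blackFactor e₀ K p b).re := by
  simp [blackPoly, blackFactor, eval_sidePoly_zero]

theorem eval_blackPoly_one (b : Fin n) :
    eval (coords p) (blackPoly e₀ K 1 b) = (blackFactor e₀ K p b).im := by
  simp [blackPoly, blackFactor, eval_sidePoly_one]

theorem eval_genericPoly_ne (hm : 2 ≤ G.halfDegree e₀)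
    (h : eval (coords p) (genericPoly e₀ K) ≠ 0) {s : ℝ} (hs : s ≠ 0) :
    (∀ b b', b ≠ b' → cr s (blackFactor e₀ K p b) (blackFactor e₀ K p b') ≠ 0) ∧
    ∀ b (i : Fin (G.halfDegree e₀)),
      cr s (blackFactor e₀ K p b) (p i.succ - p i.castSucc) ≠ 0 := by
  rw [genericPoly, if_pos hm, eval_mul] at h
  simp only [eval_prod] at h
  obtain ⟨h1, h2⟩ := mul_ne_zero_iff.1 h
  constructor
  · intro b b' hb
    have := (prod_ne_zero_iff.1 ((prod_ne_zero_iff.1 h1) b (mem_univ _))) b' (mem_univ _)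
    rw [if_neg hb, eval_sub, eval_mul, eval_mul, eval_blackPoly_zero, eval_blackPoly_zero,
      eval_blackPoly_one, eval_blackPoly_one] at this
    exact mul_ne_zero hs this
  · intro b i
    have := (prod_ne_zero_iff.1 ((prod_ne_zero_iff.1 h2) b (mem_univ _))) i (mem_univ _)
    rw [eval_sub, eval_mul, eval_mul, eval_blackPoly_zero, eval_blackPoly_one,
      eval_sidePoly_zero, eval_sidePoly_one] at this
    exact mul_ne_zero hs this

theorem partialSum_sides {m : ℕ} (q : Fin m → ℂ) (k : Fin m) :
    Fin.partialSum q k.succ - Fin.partialSum q k.castSucc = q k := by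
  rw [Fin.partialSum_succ, add_sub_cancel_left]

theorem blackFactor_partialSum (k l : Fin (G.halfDegree e₀)) (x y : ℂ) (b : Fin n) :
    blackFactor e₀ K (Fin.partialSum (Pi.single k x + Pi.single l y)) b =
      blackCoeff e₀ K k b • x + blackCoeff e₀ K l b • y := by
  simp only [blackFactor, partialSum_sides, Pi.add_apply, smul_add, sum_add_distrib]
  congr 1
  · rw [sum_eq_single k, Pi.single_eq_same]
    · intro j _ hj; rw [Pi.single_eq_of_ne hj, smul_zero]
    · exact fun h => absurd (mem_univ _) h
  · rw [sum_eq_single l, Pi.single_eq_same]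
    · intro j _ hj; rw [Pi.single_eq_of_ne hj, smul_zero]
    · exact fun h => absurd (mem_univ _) h

/-- Each factor is tested at points with only two non-zero edge vectors, `1` and `I`, realized by
partial sums. Convexity is irrelevant here. The cross product of two row factors becomes a `2 × 2`
minor of `K⁻¹` with rescaled rows, and that of a row factor with an edge vector becomes a single
coefficient. -/
theorem genericPoly_ne_zero (hK : G.IsKasteleyn e₀ ν K) (hdet : K.det ≠ 0)
    (h1 : IsNonDegenerate 1 K) (h2 : IsNonDegenerate 2 K) : genericPoly e₀ K ≠ 0 := by
  rw [genericPoly]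
  split_ifs with hm
  swap
  · exact one_ne_zero
  have hcoeff : ∀ k b, blackCoeff e₀ K k b ≠ 0 := fun k b =>
    div_ne_zero (inv_ne_zero hdet h1 _ _) (inv_ne_zero hdet h1 _ _)
  refine mul_ne_zero (prod_ne_zero_iff.2 fun b _ => prod_ne_zero_iff.2 fun b' _ => ?_)
    (prod_ne_zero_iff.2 fun b _ => prod_ne_zero_iff.2 fun i _ => ?_)
  · split_ifs with hb
    · exact one_ne_zero
    intro h0
    let k : Fin (G.halfDegree e₀) := ⟨0, by omega⟩
    let l : Fin (G.halfDegree e₀) := ⟨1, by omega⟩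
    have hkl : k ≠ l := fun h => by simpa [k, l] using congrArg Fin.val h
    have hw : (G.exitEdge e₀ k).1.2 ≠ (G.exitEdge e₀ l).1.2 := fun h =>
      hkl (exit_white_injective hK h1 h)
    have h3 := congrArg
      (eval (coords (Fin.partialSum (Pi.single k (1 : ℂ) + Pi.single l Complex.I)))) h0
    rw [eval_sub, eval_mul, eval_mul, eval_blackPoly_zero, eval_blackPoly_zero,
      eval_blackPoly_one, eval_blackPoly_one, blackFactor_partialSum,
      blackFactor_partialSum, map_zero] at h3
    simp only [Complex.add_re, Complex.add_im, Complex.real_smul, mul_one, Complex.ofReal_re,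
      Complex.ofReal_im, Complex.re_ofReal_mul, Complex.im_ofReal_mul, Complex.I_re, Complex.I_im,
      mul_zero, add_zero, zero_add] at h3
    refine inv_minor_ne_zero hdet h1 h2 hb hw ?_
    have hf := inv_ne_zero hdet h1 (G.exitEdge e₀ k).1.2 e₀.1.1
    have hf' := inv_ne_zero hdet h1 (G.exitEdge e₀ l).1.2 e₀.1.1
    simp only [blackCoeff, whiteFactor] at h3
    field_simp at h3
    linarith
  · intro h0
    obtain ⟨l, hl⟩ : ∃ l : Fin (G.halfDegree e₀), l ≠ i := by
      have : Nontrivial (Fin (G.halfDegree e₀)) := Fin.nontrivial_iff_two_le.2 hm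
      exact exists_ne i
    have h3 := congrArg
      (eval (coords (Fin.partialSum (Pi.single l (1 : ℂ) + Pi.single i Complex.I)))) h0
    rw [eval_sub, eval_mul, eval_mul, eval_blackPoly_zero, eval_blackPoly_one,
      eval_sidePoly_zero, eval_sidePoly_one, blackFactor_partialSum, partialSum_sides,
      map_zero] at h3
    simp only [Complex.add_re, Complex.add_im, Complex.real_smul, mul_one, Complex.ofReal_re,
      Complex.ofReal_im, Complex.re_ofReal_mul, Complex.im_ofReal_mul, Complex.I_re, Complex.I_im,
      mul_zero, add_zero, zero_add, Pi.add_apply, Pi.single_eq_same, Pi.single_eq_of_ne hl.symm,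
      sub_zero] at h3
    exact hcoeff l b h3

/-! ### The realization of a Kasteleyn flow -/

theorem two_le_of_halfDegree (hK : G.IsKasteleyn e₀ ν K) (h1 : IsNonDegenerate 1 K)
    (hm : 2 ≤ G.halfDegree e₀) : 2 ≤ n := by
  have := Fintype.card_le_of_injective (fun i => (G.exitEdge e₀ i).1.2)
    fun i j h => exit_white_injective hK h1 h
  rw [Fintype.card_fin, Fintype.card_fin] at this
  exact hm.trans this

variable {p}

theorem realization (hK : G.IsKasteleyn e₀ ν K) (hν : ∀ e, 0 < ν e) (hdet : K.det ≠ 0)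
    (h1 : IsNonDegenerate 1 K) (hm : 2 ≤ G.halfDegree e₀)
    (hp : eval (coords p) (genericPoly e₀ K) ≠ 0) {s : ℝ} (hs : s = 1 ∨ s = -1)
    (hps : IsConvexCycle s p) {Kt : Matrix (Fin n) (Fin n) ℂ}
    (hKt : G.IsKasteleynFlow e₀ K p Kt) {ψ : G.DualVertex e₀ → ℂ} (hψ : G.IsIntegral e₀ p Kt ψ)
    (hψp : ∀ k, ψ (Sum.inr k) = p k) :
    Realization G e₀ ν K (whiteFactor e₀ K) (blackFactor e₀ K p) p ψ s := by
  have hs0 : s ≠ 0 := by rcases hs with rfl | rfl <;> norm_num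
  obtain ⟨h3, h4⟩ := eval_genericPoly_ne p hm hp hs0
  exact
    { kasteleyn := hK
      pos := hν
      nondeg := h1
      two_le := two_le_of_halfDegree hK h1 hm
      f_ne := fun w => inv_ne_zero hdet h1 _ _
      mulVec_f := mulVec_inv_col hdet _
      grad := fun e => by
        rw [hψ.grad, eq_of_isKasteleynFlow hdet h1 hKt, Complex.real_smul]
        push_cast
        ring
      outer := hψp
      polygon := hps
      orientation := hs
      black_black := h3
      black_outer := h4 }

end PlaneBipartiteGraph

/-! ### The main theorem -/

open PlaneBipartiteGraph in
theorem mainTheorem3 {n : ℕ} (G : PlaneBipartiteGraph n)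
    (hM : ∃ M : G.graph.Subgraph, M.IsPerfectMatching)
    (hU : ∀ a ∈ G.graph.edgeSet, ∃ M : G.graph.Subgraph, M.IsPerfectMatching ∧ a ∈ M.edgeSet)
    (ν : G.edges → ℝ) (hν : ∀ e, 0 < ν e)
    (e₀ : G.edges) (K : Matrix (Fin n) (Fin n) ℝ) (hK : G.IsKasteleyn e₀ ν K)
    (h1 : IsNonDegenerate 1 K) (h2 : IsNonDegenerate 2 K) :
    ∃ P : MvPolynomial (Fin (G.halfDegree e₀ + 1) × Fin 2) ℝ, P ≠ 0 ∧
      ∀ p : Fin (G.halfDegree e₀ + 1) → ℂ, IsConvexPolygon p →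
        P.eval (fun i => if i.2 = 0 then (p i.1).re else (p i.1).im) ≠ 0 →
        (∃! Kt : Matrix (Fin n) (Fin n) ℂ, G.IsKasteleynFlow e₀ K p Kt) ∧
        ∀ Kt : Matrix (Fin n) (Fin n) ℂ, G.IsKasteleynFlow e₀ K p Kt →
          (∃! ψ : G.DualVertex e₀ → ℂ, G.IsIntegral e₀ p Kt ψ) ∧
          ∀ ψ : G.DualVertex e₀ → ℂ, G.IsIntegral e₀ p Kt ψ →
            ∃ x y : Fin n → ℂ,
              (∀ b, x b ≠ y b ∧ G.blackImage e₀ ψ b = segment ℝ (x b) (y b)) ∧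
              IsTGraph (fun b => openSegment ℝ (x b) (y b)) (Set.range p) ∧
              (∃ C : Set ℂ, IsEnclosingCurve (fun b => openSegment ℝ (x b) (y b))
                (Set.range p) C ∧ Convex ℝ (boundedPart C)) ∧
              (∀ C : Set ℂ, IsEnclosingCurve (fun b => openSegment ℝ (x b) (y b))
                (Set.range p) C → Convex ℝ (boundedPart C) →
                ∃ (F : Fin n → Set ℂ) (Fr : Set ℂ),
                  IsDimerGraphUpToGauge G.toBipartiteMap ν
                    (fun b => openSegment ℝ (x b) (y b)) (Set.range p) C F Fr ∧
                  ∀ w, interior (G.whiteTile e₀ ψ w) ⊆ F w) ∧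
              (∀ v : G.DualVertex e₀, ∃ b, ψ v = x b ∨ ψ v = y b) ∧
              (∀ k, ψ (Sum.inr k) = p k) := by
  have hdet := det_ne_zero hK hν h1
  refine ⟨genericPoly e₀ K, genericPoly_ne_zero hK hdet h1 h2, fun p hp hP => ?_⟩
  have hm : 2 ≤ G.halfDegree e₀ := by have := hp.1; omega
  obtain ⟨s, hs, hps⟩ := hp.exists_orientation
  have hs0 : s ≠ 0 := by rcases hs with rfl | rfl <;> norm_num
  obtain ⟨-, h4⟩ := eval_genericPoly_ne p hm hP hs0
  have hg : ∀ b, blackFactor e₀ K p b ≠ 0 := fun b h =>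
    h4 b ⟨0, by omega⟩ (by rw [h, PlanePolygon.zero_cr])
  refine ⟨⟨_, isKasteleynFlow_factor hdet h1 hg, fun Kt hKt => ?_⟩, fun Kt hKt => ?_⟩
  · ext b w
    exact eq_of_isKasteleynFlow hdet h1 hKt b w
  obtain ⟨ψ₁, hψ₁, hψ₁p⟩ := exists_integral hK hKt
  refine ⟨⟨ψ₁, hψ₁, fun ψ hψ => integral_unique hK h1 hψ hψ₁⟩, fun ψ hψ => ?_⟩
  have hψp : ∀ k, ψ (Sum.inr k) = p k := fun k => by
    rw [integral_unique hK h1 hψ hψ₁]; exact hψ₁p k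
  have R := realization hK hν hdet h1 hm hP hs hps hKt hψ hψp
  exact ⟨R.start, R.finish, fun b => ⟨R.start_ne b, R.blackImage_eq b⟩, R.isTGraph,
    R.exists_enclosingCurve, fun C hC hconv => ⟨_, _, Realization.isDimerGraphUpToGauge hC hconv,
      (Realization.domain hC hconv).interior_whiteTile_subset⟩, R.endpoint, hψp⟩
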